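/- Rings are commutative with unit. An ideal of definition of a topological ring is an open ideal consisting of topologically nilpotent elements. An admissible ring is a topological ring $A$ that has a descending chain $I_1\supseteq I_2\supseteq\cdots$ of ideals as a basis of neighbourhoods of $0$, is separated and complete, and has an ideal of definition. Its formal spectrum $\mathrm{Spf}\,A$ is the space of open prime ideals of $A$ (with the Zariski topology) with the sheaf of topological rings $\varprojlim_J \mathcal O_{\mathrm{Spec}\,A/J}$, where $J$ runs through the open ideals and the sheaves $\mathcal O_{\mathrm{Spec}\,A/J}$ are pseudo-discrete (sections over quasi-compact open sets are discrete). A formal scheme is a topologically ringed space (with a sheaf of topological rings) that is locally isomorphic to formal spectra of admissible rings; morphisms are morphisms of topologically ringed spaces that are local on stalks. A formal scheme is an ordinary scheme if it is covered by open subsets $\mathrm{Spf}\,R=\mathrm{Spec}\,R$ with $R$ discrete. It is Noetherian if it is quasi-compact and covered by open subsets $\mathrm{Spf}\,A$ with $A$ an admissible Noetherian ring whose topology is $I$-adic for some ideal $I$. For a closed ideal $I$ of an admissible ring $A$ let $I^\triangle\subseteq\mathcal O_{\mathrm{Spf}\,A}$ be the ideal sheaf $\varprojlim_J ((I+J)/J)^{\sim}$.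 An ideal sheaf $\mathcal I\subseteq\mathcal O_{\mathcal X}$ is closed if every point of $\mathcal X$ has an affine open neighbourhood $\mathrm{Spf}\,A$ with $\mathcal I|_{\mathrm{Spf}\,A}=I^\triangle$ for some closed ideal $I$ of $A$. A closed immersion is a morphism that is an isomorphism onto $(\mathrm{Supp}\,\mathcal O_{\mathcal X}/\mathcal I,\ \mathcal O_{\mathcal X}/\mathcal I)$ for some closed ideal sheaf $\mathcal I$; an open immersion is an isomorphism onto an open subspace with the restricted sheaf; an immersion is a closed immersion into an open subscheme, that is, a composite $\mathcal Y\to\mathcal U\to\mathcal X$ of a closed immersion and an open immersion. A pseudo-immersion is a morphism $\iota:\mathcal Y\to\mathcal X$ of formal schemes such that for every immersion $Z\to\mathcal Y$ with $Z$ an ordinary scheme the composite $Z\to\mathcal Y\to\mathcal X$ is an immersion. A subscheme (respectively pseudo-subscheme) of $\mathcal X$ is an equivalence class of immersions (respectively pseudo-immersions) into $\mathcal X$, where $f_1:\mathcal Y_1\to\mathcal X$ and $f_2:\mathcal Y_2\to\mathcal X$ are equivalent if $f_1=f_2\circ g$ for some isomorphism $g:\mathcal Y_1\to\mathcal Y_2$.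 **Theorem.** Let $\mathcal X$ be a Noetherian formal scheme. Every pseudo-subscheme of $\mathcal X$ is a subscheme of $\mathcal X$ (that is, every pseudo-immersion into $\mathcal X$ is an immersion) if and only if the underlying topological space of $\mathcal X$ is discrete. -/

import Mathlib

open CategoryTheory AlgebraicGeometry TopologicalSpace Opposite

universe u

noncomputable section

/-! ### Admissible rings -/

/-- An ideal of definition of a topological ring: an open ideal all of whose elements are
topologically nilpotent. -/
structure IsIdealOfDefinition {A : Type u} [CommRing A] [TopologicalSpace A] (I : Ideal A) :
    Prop where
  isOpen : IsOpen (I : Set A)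
  isTopologicallyNilpotent : ∀ f ∈ I, IsTopologicallyNilpotent f

/-- An admissible ring: a topological ring whose topology is given by a descending chain of
ideals, which is separated and complete, and which has an ideal of definition. -/
structure IsAdmissibleRing (A : Type u) [CommRing A] [TopologicalSpace A]
    [IsTopologicalRing A] : Prop where
  exists_basis : ∃ I : ℕ → Ideal A, Antitone I ∧
    (nhds (0 : A)).HasBasis (fun _ => True) (fun n => (I n : Set A))
  separated : T2Space A
  complete : @CompleteSpace A (IsTopologicalAddGroup.rightUniformSpace A)
  exists_idealOfDefinition : ∃ I : Ideal A, IsIdealOfDefinition I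

/-! ### The structure sheaf of `Spec R` as a sheaf of pseudo-discrete rings -/

/-- The ring of sections of the structure sheaf of `Spec R` over `U`. -/
def SpecSections (R : Type u) [CommRing R] (U : Opens (PrimeSpectrum.Top R)) : Type u :=
  (Spec.structureSheaf R).1.obj (op U)

namespace SpecSections

instance (R : Type u) [CommRing R] (U : Opens (PrimeSpectrum.Top R)) :
    CommRing (SpecSections R U) :=
  inferInstanceAs (CommRing ((Spec.structureSheaf R).1.obj (op U)))

/-- For a ring homomorphism `φ : R → S`, the map from sections over `U ⊆ Spec R` to sections over
an open subset `V ⊆ Spec S` that is mapped to `U`. For `φ = id` this is the restriction. -/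
def comap {R S : Type u} [CommRing R] [CommRing S] (φ : R →+* S)
    (U : Opens (PrimeSpectrum.Top R)) (V : Opens (PrimeSpectrum.Top S))
    (h : ∀ p ∈ V, PrimeSpectrum.comap φ p ∈ U) : SpecSections R U →+* SpecSections S V :=
  StructureSheaf.comap φ U V h

/-- Restriction of sections. -/
def res {R : Type u} [CommRing R] {U V : Opens (PrimeSpectrum.Top R)} (h : V ≤ U) :
    SpecSections R U →+* SpecSections R V :=
  ((Spec.structureSheaf R).1.map (homOfLE h).op).hom

/-- The topology on the sections over `U`: the limit of the discrete rings of sections over the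
quasi-compact open subsets of `U`. It is discrete if `U` is quasi-compact. -/
instance (R : Type u) [CommRing R] (U : Opens (PrimeSpectrum.Top R)) :
    TopologicalSpace (SpecSections R U) :=
  ⨅ W : {W : Opens (PrimeSpectrum.Top R) // W ≤ U ∧ IsCompact (W : Set (PrimeSpectrum.Top R))},
    TopologicalSpace.induced (res W.2.1) ⊥

instance (R : Type u) [CommRing R] (U : Opens (PrimeSpectrum.Top R)) :
    IsTopologicalRing (SpecSections R U) := by
  have hmul : ContinuousMul (SpecSections R U) := continuousMul_iInf fun W => by
    let : TopologicalSpace (SpecSections R W.1) := ⊥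
    have : DiscreteTopology (SpecSections R W.1) := ⟨rfl⟩
    exact continuousMul_induced (res W.2.1)
  have hadd : IsTopologicalAddGroup (SpecSections R U) := topologicalAddGroup_iInf fun W => by
    let : TopologicalSpace (SpecSections R W.1) := ⊥
    have : DiscreteTopology (SpecSections R W.1) := ⟨rfl⟩
    exact topologicalAddGroup_induced (res W.2.1)
  exact { }

end SpecSections

/-! ### The formal spectrum -/

/-- The open ideals of a topological ring. -/
abbrev OpenIdeal (A : Type u) [CommRing A] [TopologicalSpace A] : Type u :=
  {J : Ideal A // IsOpen (J : Set A)}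

/-- The underlying space of `Spf A`: the open prime ideals, with the Zariski topology. -/
abbrev SpfPoint (A : Type u) [CommRing A] [TopologicalSpace A] : Type u :=
  {p : PrimeSpectrum A // IsOpen (p.asIdeal : Set A)}

namespace Spf

variable (A : Type u) [CommRing A] [TopologicalSpace A] [IsTopologicalRing A]

/-- The underlying topological space of `Spf A`. -/
abbrev top : TopCat.{u} := TopCat.of (SpfPoint A)

variable {A}

/-- The inclusion `Spec (A / J) → Spf A` for an open ideal `J`, on points. -/
def ofSpec (J : OpenIdeal A) (p : PrimeSpectrum (A ⧸ J.1)) : SpfPoint A :=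
  ⟨PrimeSpectrum.comap (Ideal.Quotient.mk J.1) p, by
    have hle : J.1 ≤ (PrimeSpectrum.comap (Ideal.Quotient.mk J.1) p).asIdeal := by
      intro a ha
      have h0 : Ideal.Quotient.mk J.1 a = 0 := Ideal.Quotient.eq_zero_iff_mem.mpr ha
      change Ideal.Quotient.mk J.1 a ∈ p.asIdeal
      rw [h0]
      exact p.asIdeal.zero_mem
    exact AddSubgroup.isOpen_mono (H₁ := J.1.toAddSubgroup)
      (H₂ := (PrimeSpectrum.comap (Ideal.Quotient.mk J.1) p).asIdeal.toAddSubgroup) hle J.2⟩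

theorem continuous_ofSpec (J : OpenIdeal A) : Continuous (ofSpec J) :=
  Continuous.subtype_mk (PrimeSpectrum.continuous_comap _) _

/-- The open subset `U ∩ Spec (A / J)` of `Spec (A / J)`. -/
def openOf (U : Opens (top A)) (J : OpenIdeal A) : Opens (PrimeSpectrum.Top (A ⧸ J.1)) :=
  ⟨ofSpec J ⁻¹' (U : Set (SpfPoint A)), U.2.preimage (continuous_ofSpec J)⟩

theorem openOf_comap (U : Opens (top A)) {J K : OpenIdeal A} (h : J.1 ≤ K.1) :
    ∀ p ∈ openOf U K, PrimeSpectrum.comap (Ideal.Quotient.factor h) p ∈ openOf U J :=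
  fun _ hp => hp

theorem openOf_mono {U V : Opens (top A)} (h : V ≤ U) (J : OpenIdeal A) :
    openOf V J ≤ openOf U J :=
  fun _ hp => h hp

/-- The sections of the structure sheaf of `Spf A` over `U`: the limit of the topological rings of
sections of `Spec (A / J)` over `U ∩ Spec (A / J)`, where `J` runs through the open ideals. -/
def sections (U : Opens (top A)) : Subring (∀ J : OpenIdeal A, SpecSections (A ⧸ J.1) (openOf U J))
    where
  carrier := {s | ∀ (J K : OpenIdeal A) (h : J.1 ≤ K.1),
    SpecSections.comap (Ideal.Quotient.factor h) (openOf U J) (openOf U K) (openOf_comap U h)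
      (s J) = s K}
  mul_mem' hs ht J K h := by simp only [Pi.mul_apply, map_mul, hs J K h, ht J K h]
  one_mem' J K h := by simp only [Pi.one_apply, map_one]
  add_mem' hs ht J K h := by simp only [Pi.add_apply, map_add, hs J K h, ht J K h]
  zero_mem' J K h := by simp only [Pi.zero_apply, map_zero]
  neg_mem' hs J K h := by simp only [Pi.neg_apply, map_neg, hs J K h]

/-- Restriction of sections on `Spf A`. -/
def res {U V : Opens (top A)} (h : V ≤ U) : sections U →+* sections V where
  toFun s := ⟨fun J => SpecSections.res (openOf_mono h J) (s.1 J), fun J K hJK => by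
    change _ = SpecSections.res (openOf_mono h K) (s.1 K)
    rw [← s.2 J K hJK]
    rfl⟩
  map_one' := Subtype.ext (funext fun J => map_one (SpecSections.res (openOf_mono h J)))
  map_zero' := Subtype.ext (funext fun J => map_zero (SpecSections.res (openOf_mono h J)))
  map_mul' s t := Subtype.ext (funext fun J =>
    map_mul (SpecSections.res (openOf_mono h J)) (s.1 J) (t.1 J))
  map_add' s t := Subtype.ext (funext fun J =>
    map_add (SpecSections.res (openOf_mono h J)) (s.1 J) (t.1 J))

theorem continuous_res {U V : Opens (top A)} (h : V ≤ U) : Continuous (res h) := by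
  refine Continuous.subtype_mk (continuous_pi fun J => ?_) _
  refine Continuous.comp (g := SpecSections.res (openOf_mono h J)) ?_
    ((continuous_apply J).comp continuous_subtype_val)
  refine continuous_iInf_rng.mpr fun W => continuous_induced_rng.mpr ?_
  exact continuous_iInf_dom (i := ⟨W.1, W.2.1.trans (openOf_mono h J), W.2.2⟩)
    continuous_induced_dom

end Spf

/-- The formal spectrum of a topological ring, as a topologically ringed space. -/
def Spf (A : TopCommRingCat.{u}) : PresheafedSpace TopCommRingCat.{u} where
  carrier := Spf.top A
  presheaf :=
    { obj := fun U => TopCommRingCat.of (Spf.sections U.unop)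
      map := fun i => ⟨Spf.res i.unop.le, Spf.continuous_res i.unop.le⟩
      map_id := fun _ => rfl
      map_comp := fun _ _ => rfl }

/-! ### Formal schemes -/

/-- An affine open subset of a topologically ringed space: an open immersion from the formal
spectrum of an admissible ring. -/
structure AffineChart (X : PresheafedSpace TopCommRingCat.{u}) where
  /-- the admissible ring -/
  ring : TopCommRingCat.{u}
  isAdmissible : IsAdmissibleRing ring
  /-- the open immersion -/
  map : Spf ring ⟶ X
  isOpenImmersion : PresheafedSpace.IsOpenImmersion map

/-- The open subset of `X` given by an affine chart. -/
def AffineChart.range {X : PresheafedSpace TopCommRingCat.{u}} (c : AffineChart X) : Opens X :=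
  ⟨Set.range c.map.base, c.isOpenImmersion.base_open.isOpen_range⟩

/-- A formal scheme: a space with a sheaf of topological rings, which is covered by open subsets
that are isomorphic to formal spectra of admissible rings. -/
structure FormalScheme extends PresheafedSpace TopCommRingCat.{u} where
  isSheaf : presheaf.IsSheaf
  exists_chart : ∀ x : carrier, ∃ c : AffineChart toPresheafedSpace, x ∈ c.range

namespace FormalScheme

/-- The ringed space underlying a topologically ringed space. -/
abbrev forgetTopology : PresheafedSpace TopCommRingCat.{u} ⥤ PresheafedSpace CommRingCat.{u} :=
  (forget₂ TopCommRingCat.{u} CommRingCat.{u}).mapPresheaf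

/-- A morphism of formal schemes: a morphism of topologically ringed spaces such that the maps of
stalks are local homomorphisms. -/
@[ext]
structure Hom (X Y : FormalScheme.{u}) where
  /-- the morphism of topologically ringed spaces -/
  hom : X.toPresheafedSpace ⟶ Y.toPresheafedSpace
  isLocalHom : ∀ x : forgetTopology.obj X.toPresheafedSpace,
    IsLocalHom (PresheafedSpace.Hom.stalkMap (forgetTopology.map hom) x).hom

instance : Category FormalScheme.{u} where
  Hom := Hom
  id X := ⟨𝟙 _, fun x => by
    rw [CategoryTheory.Functor.map_id, PresheafedSpace.stalkMap.id]
    exact ⟨fun _ h => h⟩⟩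
  comp f g := ⟨f.hom ≫ g.hom, fun x => by
    rw [CategoryTheory.Functor.map_comp, PresheafedSpace.stalkMap.comp]
    exact @RingHom.isLocalHom_comp _ _ _ _ _ _ _ _ (f.isLocalHom x)
      (g.isLocalHom ((forgetTopology.map f.hom).base x))⟩
  id_comp f := Hom.ext (Category.id_comp f.hom)
  comp_id f := Hom.ext (Category.comp_id f.hom)
  assoc f g h := Hom.ext (Category.assoc f.hom g.hom h.hom)

/-- The ring of sections of the structure sheaf over `U`. -/
abbrev sections (X : FormalScheme.{u}) (U : Opens X.carrier) : TopCommRingCat.{u} :=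
  X.presheaf.obj (op U)

/-- Restriction of sections. -/
abbrev res (X : FormalScheme.{u}) {U V : Opens X.carrier} (h : V ≤ U) :
    X.sections U →+* X.sections V :=
  (X.presheaf.map (homOfLE h).op).1

/-- The inverse image of an open subset. -/
abbrev Hom.preimage {X Y : FormalScheme.{u}} (f : X ⟶ Y) (U : Opens Y.carrier) :
    Opens X.carrier :=
  (Opens.map f.hom.base).obj U

/-- The map `𝒪_Y(U) → 𝒪_X(f⁻¹ U)`. -/
abbrev Hom.app {X Y : FormalScheme.{u}} (f : X ⟶ Y) (U : Opens Y.carrier) :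
    Y.sections U →+* X.sections (Hom.preimage f U) :=
  (f.hom.c.app (op U)).1

/-- An ordinary scheme: a formal scheme that is covered by spectra of discrete rings. -/
def IsOrdinary (X : FormalScheme.{u}) : Prop :=
  ∀ x : X.carrier, ∃ c : AffineChart X.toPresheafedSpace, x ∈ c.range ∧ DiscreteTopology c.ring

/-- A Noetherian formal scheme: a quasi-compact formal scheme that is covered by formal spectra of
Noetherian adic rings. -/
structure IsNoetherian (X : FormalScheme.{u}) : Prop where
  compactSpace : CompactSpace X.carrier
  exists_chart : ∀ x : X.carrier, ∃ c : AffineChart X.toPresheafedSpace, x ∈ c.range ∧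
    IsNoetherianRing c.ring ∧ ∃ I : Ideal c.ring, IsAdic I

/-! ### Ideal sheaves -/

/-- A sheaf of ideals of the structure sheaf. -/
structure IdealSheaf (X : FormalScheme.{u}) where
  /-- the ideal of sections over an open set -/
  ideal : ∀ U : Opens X.carrier, Ideal (X.sections U)
  res_mem : ∀ {U V : Opens X.carrier} (h : V ≤ U), ∀ s ∈ ideal U, X.res h s ∈ ideal V
  mem_of_locally : ∀ (U : Opens X.carrier) (s : X.sections U),
    (∀ x ∈ U, ∃ (V : Opens X.carrier) (h : V ≤ U), x ∈ V ∧ X.res h s ∈ ideal V) → s ∈ ideal U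

/-- The sections over `U` of the ideal sheaf `I^△` on `Spf A` given by an ideal `I` of `A`: the
sections whose component on `Spec (A / J)` lies, for every open ideal `J`, in the quasi-coherent
ideal sheaf given by `(I + J) / J`, that is, vanishes on `Spec (A / (I + J))`. -/
def triangle {A : TopCommRingCat.{u}} (I : Ideal A) (U : Opens (Spf A).carrier) :
    Set ((Spf A).presheaf.obj (op U)) :=
  {s : Spf.sections (A := A) U | ∀ K : OpenIdeal A, I ≤ K.1 → s.1 K = 0}

/-- A closed ideal sheaf: every point has an affine neighbourhood `Spf A` on which the ideal sheaf
is `I^△` for some closed ideal `I` of `A`. -/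
def IdealSheaf.IsClosed {X : FormalScheme.{u}} (𝓘 : IdealSheaf X) : Prop :=
  ∀ x : X.carrier, ∃ c : AffineChart X.toPresheafedSpace, x ∈ c.range ∧
    ∃ I : Ideal c.ring, _root_.IsClosed (I : Set c.ring) ∧
      ∀ U : Opens X.carrier, U ≤ c.range → ∀ s : X.sections U,
        s ∈ 𝓘.ideal U ↔ (c.map.c.app (op U)).1 s ∈ triangle I ((Opens.map c.map.base).obj U)

/-- The support of `𝒪_X / 𝓘`: the points at which the stalk of `𝓘` does not contain `1`. -/
def IdealSheaf.support {X : FormalScheme.{u}} (𝓘 : IdealSheaf X) : Set X.carrier :=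
  {x | ∀ U : Opens X.carrier, x ∈ U → (1 : X.sections U) ∉ 𝓘.ideal U}

/-! ### Immersions -/

/-- The morphism `f : Y → X` is an isomorphism onto the closed subscheme
`(Supp (𝒪_X / 𝓘), 𝒪_X / 𝓘)`: it is a homeomorphism onto the support, and `f_* 𝒪_Y` is the quotient
sheaf of topological rings `𝒪_X / 𝓘`, that is, the kernel of `𝒪_X → f_* 𝒪_Y` is `𝓘` and, for all
`U` in a basis of open sets, `𝒪_Y(f⁻¹ U)` is the quotient of `𝒪_X(U)` with the quotient
topology. -/
structure IsIsoOntoClosedSubscheme {X Y : FormalScheme.{u}} (f : Y ⟶ X) (𝓘 : IdealSheaf X) :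
    Prop where
  isEmbedding : Topology.IsEmbedding f.hom.base
  range_eq : Set.range f.hom.base = 𝓘.support
  ker_eq : ∀ U : Opens X.carrier, RingHom.ker (Hom.app f U) = 𝓘.ideal U
  quotient : ∃ B : Set (Opens X.carrier), Opens.IsBasis B ∧
    ∀ U ∈ B, IsOpenQuotientMap (Hom.app f U)

/-- A closed immersion: an isomorphism onto the closed subscheme defined by a closed ideal
sheaf. -/
def IsClosedImmersion {X Y : FormalScheme.{u}} (f : Y ⟶ X) : Prop :=
  ∃ 𝓘 : IdealSheaf X, 𝓘.IsClosed ∧ IsIsoOntoClosedSubscheme f 𝓘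

/-- An open immersion: an isomorphism onto an open subscheme. -/
def IsOpenImmersion {X Y : FormalScheme.{u}} (f : Y ⟶ X) : Prop :=
  PresheafedSpace.IsOpenImmersion f.hom

/-- An immersion: an isomorphism onto a closed subscheme of an open subscheme. -/
def IsImmersion {X Y : FormalScheme.{u}} (f : Y ⟶ X) : Prop :=
  ∃ (W : FormalScheme.{u}) (i : Y ⟶ W) (j : W ⟶ X),
    IsClosedImmersion i ∧ IsOpenImmersion j ∧ i ≫ j = f

/-- A pseudo-immersion: a morphism `f : Y → X` whose composition with every immersion of an ordinary
scheme into `Y` is an immersion. -/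
def IsPseudoImmersion {X Y : FormalScheme.{u}} (f : Y ⟶ X) : Prop :=
  ∀ (Z : FormalScheme.{u}) (i : Z ⟶ Y), Z.IsOrdinary → IsImmersion i → IsImmersion (i ≫ f)

end FormalScheme

end

/-!
If `X` is not discrete, some point of `X` has a Noetherian adic chart `A` with an open maximal
ideal `m` that is not isolated in `Spf A`. The morphism from the formal spectrum of the `m`-adic
completion of `A` to `X` is a pseudo-immersion, because every ordinary subscheme of its source
factors through some `Spec (A ⧸ m ^ n)`. If it were an immersion, then the map on sections would be
open, so some `m ^ n` would be contained in `m ^ (n + 1) + I` for an ideal of definition `I`; by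
Nakayama's lemma `m` would then be isolated.

Conversely, let `X` be discrete and `f : Y ⟶ X` a pseudo-immersion. Testing `f` against the
ordinary schemes of residue fields and of quotients of charts by open ideals shows that `Y` is
discrete, that `f` is injective, and that the maps on sections have dense image. The rings of `X`
are complete with Artinian quotients, so Chevalley's theorem makes these maps open and surjective,
and `f` is a closed immersion.
-/

noncomputable section

/-! ### Sheaves of topological rings -/

section Sheaf

variable {X : TopCat.{u}} {F : X.Presheaf TopCommRingCat.{u}}

/-- The sections over the union of the cover that are glued from the values of compatible
morphisms `f i : E ⟶ F (U i)` form a ring homomorphism. -/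
def gluedRingHom {E : TopCommRingCat.{u}} {ι : Type u} {U : ι → Opens X}
    (f : ∀ i, E ⟶ F.obj (op (U i)))
    (h : ∀ e : E, ∃! t : F.obj (op (iSup U)), ∀ i, (F.map (Opens.leSupr U i).op).1 t = (f i).1 e) :
    E →+* F.obj (op (iSup U)) where
  toFun e := (h e).choose
  map_one' := ((h 1).choose_spec.2 1 fun i => by rw [map_one, map_one]).symm
  map_zero' := ((h 0).choose_spec.2 0 fun i => by rw [map_zero, map_zero]).symm
  map_mul' a b := ((h (a * b)).choose_spec.2 _ fun i => by
    rw [map_mul, map_mul, (h a).choose_spec.1 i, (h b).choose_spec.1 i]).symm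
  map_add' a b := ((h (a + b)).choose_spec.2 _ fun i => by
    rw [map_add, map_add, (h a).choose_spec.1 i, (h b).choose_spec.1 i]).symm

/-- A ring homomorphism glued from continuous ones is continuous because the topology over a union
is the initial one. -/
theorem isSheaf_of_existsUnique_gluing
    (glue : ∀ (ι : Type u) (U : ι → Opens X) (s : ∀ i, F.obj (op (U i))),
      (∀ i j, (F.map (Opens.infLELeft (U i) (U j)).op).1 (s i) =
        (F.map (Opens.infLERight (U i) (U j)).op).1 (s j)) →
      ∃! t : F.obj (op (iSup U)), ∀ i, (F.map (Opens.leSupr U i).op).1 t = s i)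
    (ind : ∀ (ι : Type u) (U : ι → Opens X),
      (⨅ i, TopologicalSpace.induced (F.map (Opens.leSupr U i).op).1 inferInstance) ≤
        (F.obj (op (iSup U))).isTopologicalSpace) :
    F.IsSheaf := by
  intro E
  refine (isSheaf_iff_isSheaf_of_type _ _).mp
    ((TopCat.Presheaf.isSheaf_iff_isSheafUniqueGluing_types (F ⋙ coyoneda.obj (op E))).mpr ?_)
  intro ι U (f : ∀ i, E ⟶ F.obj (op (U i))) hf
  have hglue (e : E) := glue ι U (fun i => (f i).1 e) fun i j =>
    congrArg (fun g : E ⟶ F.obj (op (U i ⊓ U j)) => g.1 e) (hf i j)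
  have hres (i : ι) (e : E) :
      (F.map (Opens.leSupr U i).op).1 (gluedRingHom f hglue e) = (f i).1 e :=
    (hglue e).choose_spec.1 i
  have hcont : Continuous (gluedRingHom f hglue) := by
    refine continuous_le_rng (ind ι U) ?_
    refine continuous_iInf_rng.mpr fun i => continuous_induced_rng.mpr ?_
    exact (f i).2.congr fun e => (hres i e).symm
  refine ⟨(⟨gluedRingHom f hglue, hcont⟩ : E ⟶ F.obj (op (iSup U))), fun i => ?_, fun t ht => ?_⟩
  · exact Subtype.ext (RingHom.ext (hres i))
  · refine Subtype.ext (RingHom.ext fun e => (hglue e).choose_spec.2 _ fun i => ?_)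
    exact congrArg (fun g : E ⟶ F.obj (op (U i)) => g.1 e) (ht i)

end Sheaf

/-- The ring `ℤ[X]` with the discrete topology, which corepresents the functor of underlying sets
of topological rings. -/
def discretePolynomialRing : TopCommRingCat.{u} :=
  letI : TopologicalSpace (MvPolynomial PUnit.{u + 1} ℤ) := ⊥
  haveI : DiscreteTopology (MvPolynomial PUnit.{u + 1} ℤ) := ⟨rfl⟩
  TopCommRingCat.of (MvPolynomial PUnit.{u + 1} ℤ)

/-- The corepresentation of the functor of underlying sets of topological rings by `ℤ[X]`: a
morphism corresponds to the image of `X`. -/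
def forgetCorepresentableBy :
    (forget TopCommRingCat.{u}).CorepresentableBy discretePolynomialRing.{u} where
  homEquiv :=
    { toFun f := f.1 (MvPolynomial.X PUnit.unit : MvPolynomial PUnit.{u + 1} ℤ)
      invFun r := ⟨(MvPolynomial.aeval (R := ℤ) fun _ : PUnit.{u + 1} => r).toRingHom,
        continuous_bot⟩
      left_inv _ := Subtype.ext (MvPolynomial.ringHom_ext' (Subsingleton.elim _ _) fun _ =>
        MvPolynomial.aeval_X (R := ℤ) _ PUnit.unit)
      right_inv r := MvPolynomial.aeval_X (R := ℤ) (fun _ : PUnit.{u + 1} => r) PUnit.unit }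
  homEquiv_comp _ _ := rfl

theorem existsUnique_gluing_of_isSheaf {X : TopCat.{u}} {F : X.Presheaf TopCommRingCat.{u}}
    (hF : F.IsSheaf) {ι : Type u} (U : ι → Opens X) (s : ∀ i, F.obj (op (U i)))
    (hs : ∀ i j, (F.map (Opens.infLELeft (U i) (U j)).op).1 (s i) =
        (F.map (Opens.infLERight (U i) (U j)).op).1 (s j)) :
    ∃! t : F.obj (op (iSup U)), ∀ i, (F.map (Opens.leSupr U i).op).1 t = s i := by
  have hcoyoneda : TopCat.Presheaf.IsSheaf (F ⋙ coyoneda.obj (op discretePolynomialRing)) :=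
    (isSheaf_iff_isSheaf_of_type _ _).mpr (hF discretePolynomialRing)
  have hforget : TopCat.Presheaf.IsSheaf (F ⋙ forget TopCommRingCat) :=
    TopCat.Presheaf.isSheaf_of_iso
      (Functor.isoWhiskerLeft F forgetCorepresentableBy.toIso) hcoyoneda
  exact (TopCat.Presheaf.isSheaf_iff_isSheafUniqueGluing_types _).mp hforget U s hs

/-! ### Invertible germs -/

theorem exists_isUnit_res_of_isUnit_germ {X : TopCat.{u}} (F : X.Presheaf CommRingCat.{u})
    (U : Opens X) (f : F.obj (op U)) (x : X) (hx : x ∈ U) (h : IsUnit (F.germ U x hx f)) :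
    ∃ (V : Opens X) (i : V ⟶ U) (_ : x ∈ V), IsUnit (F.map i.op f) := by
  obtain ⟨g', heq⟩ := h.exists_right_inv
  obtain ⟨V, hxV, g, rfl⟩ := F.exists_germ_eq g'
  let W := U ⊓ V
  have hxW : x ∈ W := ⟨hx, hxV⟩
  replace heq : (F.germ _ x hxW) ((F.map (U.infLELeft V).op) f *
      (F.map (U.infLERight V).op) g) = (F.germ _ x hxW) 1 := by
    rwa [map_mul, map_one, F.germ_res_apply (Opens.infLELeft U V) x hxW f,
      F.germ_res_apply (Opens.infLERight U V) x hxW g]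
  obtain ⟨W', hxW', i₁, i₂, heq'⟩ := F.germ_eq x hxW hxW _ _ heq
  refine ⟨W', i₁ ≫ Opens.infLELeft U V, hxW', ?_⟩
  simp only [map_mul, map_one] at heq'
  rw [op_comp, Functor.map_comp]
  exact IsUnit.of_mul_eq_one _ heq'

theorem isLocalHom_stalkMap_of_isUnit_res {X Y : PresheafedSpace CommRingCat.{u}} (f : Y ⟶ X)
    (y : Y) (H : ∀ (U : Opens X) (s : X.presheaf.obj (op U)) (V : Opens Y)
      (hV : V ≤ (Opens.map f.base).obj U), y ∈ V →
      IsUnit ((Y.presheaf.map (homOfLE hV).op) (f.c.app (op U) s)) →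
      ∃ (W : Opens X) (hW : W ≤ U), f.base y ∈ W ∧ IsUnit (X.presheaf.map (homOfLE hW).op s)) :
    IsLocalHom (f.stalkMap y).hom := by
  refine ⟨fun a ha => ?_⟩
  obtain ⟨U, hyU, s, rfl⟩ := TopCat.Presheaf.exists_germ_eq X.presheaf a
  replace ha : IsUnit (f.stalkMap y (X.presheaf.germ U (f.base y) hyU s)) := ha
  rw [PresheafedSpace.stalkMap_germ_apply f U y hyU s] at ha
  obtain ⟨V, i, hyV, hV⟩ := exists_isUnit_res_of_isUnit_germ Y.presheaf _ _ _ _ ha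
  obtain ⟨W, hW, hyW, h⟩ := H U s V i.le hyV hV
  rw [← TopCat.Presheaf.germ_res_apply X.presheaf (homOfLE hW) _ hyW s]
  exact RingHom.isUnit_map (X.presheaf.germ W (f.base y) hyW).hom h

theorem isLocalHom_stalkMap_forgetTopology_of_isUnit_res
    {X Y : PresheafedSpace TopCommRingCat.{u}} (f : Y ⟶ X) (y : Y)
    (H : ∀ (U : Opens X) (s : X.presheaf.obj (op U)) (V : Opens Y)
      (hV : V ≤ (Opens.map f.base).obj U), y ∈ V →
      IsUnit ((Y.presheaf.map (homOfLE hV).op).1 ((f.c.app (op U)).1 s)) →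
      ∃ (W : Opens X) (hW : W ≤ U), f.base y ∈ W ∧ IsUnit ((X.presheaf.map (homOfLE hW).op).1 s)) :
    IsLocalHom (PresheafedSpace.Hom.stalkMap (FormalScheme.forgetTopology.map f) y).hom :=
  isLocalHom_stalkMap_of_isUnit_res (FormalScheme.forgetTopology.map f) y H

/-! ### Gluing sections of a formal scheme -/

namespace FormalScheme

variable {X Y : FormalScheme.{u}}

theorem res_res {U V W : Opens X.carrier} (h : V ≤ U) (h' : W ≤ V) (s : X.sections U) :
    X.res h' (X.res h s) = X.res (h'.trans h) s :=
  (congrArg (fun g : X.sections U ⟶ X.sections W => g.1 s)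
    (X.presheaf.map_comp (homOfLE h).op (homOfLE h').op)).symm

theorem res_self {U : Opens X.carrier} (h : U ≤ U) (s : X.sections U) : X.res h s = s :=
  congrArg (fun g : X.sections U ⟶ X.sections U => g.1 s) (X.presheaf.map_id (op U))

theorem app_res (f : Y ⟶ X) {U V : Opens X.carrier} (h : V ≤ U) (s : X.sections U) :
    Hom.app f V (X.res h s) = Y.res (fun _ hx => h hx : Hom.preimage f V ≤ Hom.preimage f U)
      (Hom.app f U s) :=
  congrArg (fun g : X.sections U ⟶ Y.sections (Hom.preimage f V) => g.1 s)
    (f.hom.c.naturality (homOfLE h).op)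

theorem eq_of_locally_eq {U : Opens X.carrier} {s t : X.sections U}
    (h : ∀ x ∈ U, ∃ (V : Opens X.carrier) (hV : V ≤ U), x ∈ V ∧ X.res hV s = X.res hV t) :
    s = t := by
  choose V hV hxV hst using fun x : U => h x.1 x.2
  have hU : U ≤ iSup V := fun x hx => Opens.mem_iSup.mpr ⟨⟨x, hx⟩, hxV ⟨x, hx⟩⟩
  obtain ⟨r, -, hr⟩ := existsUnique_gluing_of_isSheaf X.isSheaf V (fun x => X.res (hV x) s)
    fun i j => (res_res (hV i) _ s).trans (res_res (hV j) _ s).symm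
  have h₁ := hr (X.res (iSup_le hV) s) fun i => res_res _ _ s
  have h₂ := hr (X.res (iSup_le hV) t) fun i => (res_res _ _ t).trans (hst i).symm
  rw [← res_self le_rfl s, ← res_self le_rfl t, ← res_res (iSup_le hV) hU s,
    ← res_res (iSup_le hV) hU t, h₁, h₂]

theorem subsingleton_sections {U : Opens X.carrier} (hU : U = ⊥) : Subsingleton (X.sections U) := by
  subst hU
  exact ⟨fun _ _ => eq_of_locally_eq fun _ hx => hx.elim⟩

theorem exists_gluing_of_disjoint {U V₁ V₂ : Opens X.carrier} (h₁ : V₁ ≤ U) (h₂ : V₂ ≤ U)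
    (hU : U ≤ V₁ ⊔ V₂) (hV : V₁ ⊓ V₂ = ⊥) (s₁ : X.sections V₁) (s₂ : X.sections V₂) :
    ∃ t : X.sections U, X.res h₁ t = s₁ ∧ X.res h₂ t = s₂ := by
  let V : ULift.{u} Bool → Opens X.carrier := fun b => if b.down then V₁ else V₂
  let s : ∀ b, X.sections (V b) := fun b =>
    match b with
    | ⟨true⟩ => s₁
    | ⟨false⟩ => s₂
  have hUV : U ≤ iSup V := fun x hx => Opens.mem_iSup.mpr
    ((hU hx).elim (fun h => ⟨⟨true⟩, h⟩) fun h => ⟨⟨false⟩, h⟩)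
  obtain ⟨t, ht, -⟩ := existsUnique_gluing_of_isSheaf X.isSheaf V s (by
    rintro ⟨_ | _⟩ ⟨_ | _⟩
    · rfl
    · exact @Subsingleton.elim _ (subsingleton_sections ((inf_comm _ _).trans hV)) _ _
    · exact @Subsingleton.elim _ (subsingleton_sections hV) _ _
    · rfl)
  refine ⟨X.res hUV t, ?_, ?_⟩
  · exact (res_res hUV h₁ t).trans (ht ⟨true⟩)
  · exact (res_res hUV h₂ t).trans (ht ⟨false⟩)

end FormalScheme

/-! ### Sections of the structure sheaf of a prime spectrum -/

namespace SpecSections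

variable {R S : Type u} [CommRing R] [CommRing S] {U V : Opens (PrimeSpectrum.Top R)}

/-- The value of a section at a point, in the localization at that point. -/
def value (p : PrimeSpectrum R) (hp : p ∈ U) :
    SpecSections R U →+* Localization.AtPrime p.asIdeal where
  toFun s := s.1 ⟨p, hp⟩
  map_one' := rfl
  map_zero' := rfl
  map_mul' _ _ := rfl
  map_add' _ _ := rfl

theorem ext_value {s t : SpecSections R U}
    (h : ∀ (p : PrimeSpectrum R) (hp : p ∈ U), value p hp s = value p hp t) : s = t :=
  Subtype.ext (funext fun p => h p.1 p.2)

theorem value_res (h : V ≤ U) (p : PrimeSpectrum R) (hp : p ∈ V) (s : SpecSections R U) :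
    value p hp (res h s) = value p (h hp) s := rfl

theorem isUnit_value_congr {p q : PrimeSpectrum R} (hpq : p = q) (hp : p ∈ U) (hq : q ∈ U)
    (s : SpecSections R U) : IsUnit (value p hp s) ↔ IsUnit (value q hq s) := by
  subst hpq
  rfl

theorem value_comap (φ : R →+* S) {V : Opens (PrimeSpectrum.Top S)}
    (h : ∀ p ∈ V, PrimeSpectrum.comap φ p ∈ U) (q : PrimeSpectrum S) (hq : q ∈ V)
    (s : SpecSections R U) :
    value q hq (comap φ U V h s) =
      Localization.localRingHom (PrimeSpectrum.comap φ q).asIdeal q.asIdeal φ rfl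
        (value (PrimeSpectrum.comap φ q) (h q hq) s) :=
  StructureSheaf.comap_apply φ U V h s ⟨q, hq⟩

theorem isUnit_value_comap (φ : R →+* S) {V : Opens (PrimeSpectrum.Top S)}
    (h : ∀ p ∈ V, PrimeSpectrum.comap φ p ∈ U) (q : PrimeSpectrum S) (hq : q ∈ V)
    (s : SpecSections R U) :
    IsUnit (value q hq (comap φ U V h s)) ↔
      IsUnit (value (PrimeSpectrum.comap φ q) (h q hq) s) := by
  rw [value_comap]
  exact ⟨fun h => (Localization.isLocalHom_localRingHom _ _ φ rfl).map_nonunit _ h,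
    fun h => h.map _⟩

/-- The section given by an element of the ring. -/
def ofRing (U : Opens (PrimeSpectrum.Top R)) : R →+* SpecSections R U :=
  algebraMap R ((structureSheafInType R R).obj.obj (op U))

theorem value_ofRing (p : PrimeSpectrum R) (hp : p ∈ U) (r : R) :
    value p hp (ofRing U r) = algebraMap R _ r := rfl

theorem comap_ofRing (φ : R →+* S) {V : Opens (PrimeSpectrum.Top S)}
    (h : ∀ p ∈ V, PrimeSpectrum.comap φ p ∈ U) (r : R) :
    comap φ U V h (ofRing U r) = ofRing V (φ r) := by
  refine ext_value fun q hq => ?_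
  rw [value_comap, value_ofRing, value_ofRing]
  exact Localization.localRingHom_to_map _ _ _ _ _

theorem exists_fraction (s : SpecSections R U) (p : PrimeSpectrum R) (hp : p ∈ U) :
    ∃ (g f : R), p ∈ PrimeSpectrum.basicOpen g ∧ ∃ h : PrimeSpectrum.basicOpen g ≤ U,
      ∀ (q : PrimeSpectrum R) (hq : q ∈ PrimeSpectrum.basicOpen g),
        value q (h hq) s * algebraMap R _ g = algebraMap R _ f := by
  obtain ⟨g, hpg, i, f, h⟩ := StructureSheaf.exists_const U s p hp
  refine ⟨g, f, hpg, i, fun q hq => ?_⟩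
  have hvalue : Localization.mk f ⟨g, hq⟩ = value q (i hq) s :=
    congrFun (congrArg Subtype.val h) ⟨q, hq⟩
  rw [← hvalue, Localization.mk_eq_mk']
  exact IsLocalization.mk'_spec _ f ⟨g, hq⟩

theorem isUnit_algebraMap_iff (p : PrimeSpectrum R) (r : R) :
    IsUnit (algebraMap R (Localization.AtPrime p.asIdeal) r) ↔
      p ∈ PrimeSpectrum.basicOpen r :=
  IsLocalization.AtPrime.isUnit_to_map_iff _ p.asIdeal r

theorem isOpen_isUnit_value (s : SpecSections R U) :
    IsOpen {p : PrimeSpectrum R | ∃ hp : p ∈ U, IsUnit (value p hp s)} := by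
  refine isOpen_iff_forall_mem_open.mpr ?_
  rintro p ⟨hp, hu⟩
  obtain ⟨g, f, hpg, i, h⟩ := exists_fraction s p hp
  have hiff : ∀ (q : PrimeSpectrum R) (hq : q ∈ PrimeSpectrum.basicOpen g),
      IsUnit (value q (i hq) s) ↔ q ∈ PrimeSpectrum.basicOpen f := fun q hq => by
    rw [← isUnit_algebraMap_iff, ← h q hq,
      IsUnit.mul_iff, and_iff_left ((isUnit_algebraMap_iff q g).mpr hq)]
  exact ⟨(PrimeSpectrum.basicOpen g : Set _) ∩ PrimeSpectrum.basicOpen f,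
    fun q hq => ⟨i hq.1, (hiff q hq.1).mpr hq.2⟩,
    (PrimeSpectrum.basicOpen g).2.inter (PrimeSpectrum.basicOpen f).2, hpg, (hiff p hpg).mp hu⟩

theorem isUnit_iff {s : SpecSections R U} :
    IsUnit s ↔ ∀ (p : PrimeSpectrum R) (hp : p ∈ U), IsUnit (value p hp s) := by
  refine ⟨fun h p hp => h.map _, fun h => ?_⟩
  choose v hv using fun p : U => (h p.1 p.2).exists_right_inv
  have hloc : (StructureSheaf.isLocallyFraction R R).pred v := by
    intro p
    obtain ⟨g, f, hpg, i, hs⟩ := exists_fraction s p.1 p.2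
    have hf : PrimeSpectrum.basicOpen g ≤ PrimeSpectrum.basicOpen f := fun q hq => by
      rw [← isUnit_algebraMap_iff, ← hs q hq]
      exact (h q (i hq)).mul ((isUnit_algebraMap_iff q g).mpr hq)
    refine ⟨PrimeSpectrum.basicOpen g, hpg, homOfLE i, g, f, fun q => ⟨hf q.2, ?_⟩⟩
    change v ⟨q.1, i q.2⟩ = Localization.mk g ⟨f, hf q.2⟩
    rw [Localization.mk_eq_mk', IsLocalization.eq_mk'_iff_mul_eq]
    change v ⟨q.1, i q.2⟩ * algebraMap R _ f = _
    rw [← hs q.1 q.2, ← mul_assoc, mul_comm (v _), hv ⟨q.1, i q.2⟩, one_mul]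
  let t : SpecSections R U := ⟨v, hloc⟩
  exact IsUnit.of_mul_eq_one t (ext_value fun p hp => (map_mul _ _ _).trans (hv ⟨p, hp⟩))

theorem subsingleton (hU : ∀ p, p ∉ U) : Subsingleton (SpecSections R U) :=
  ⟨fun _ _ => ext_value fun p hp => (hU p hp).elim⟩

theorem nontrivial (p : PrimeSpectrum R) (hp : p ∈ U) : Nontrivial (SpecSections R U) :=
  (value p hp).domain_nontrivial

theorem eq_zero_of_forall_not_isUnit_value [IsReduced R] {s : SpecSections R U}
    (hs : ∀ (p : PrimeSpectrum R) (hp : p ∈ U), ¬ IsUnit (value p hp s)) : s = 0 := by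
  refine ext_value fun p hp => ?_
  obtain ⟨g, f, hpg, i, h⟩ := exists_fraction s p hp
  have hgf : f * g = 0 := by
    refine (nilpotent_iff_mem_prime.mpr fun q (hq : q.IsPrime) => ?_).eq_zero
    by_contra hfg
    have hg : (⟨q, hq⟩ : PrimeSpectrum R) ∈ PrimeSpectrum.basicOpen g :=
      fun hg => hfg (Ideal.mul_mem_left _ _ hg)
    have hf : (⟨q, hq⟩ : PrimeSpectrum R) ∈ PrimeSpectrum.basicOpen f :=
      fun hf => hfg (Ideal.mul_mem_right _ _ hf)
    have hunit := (isUnit_algebraMap_iff (R := R) _ f).mpr hf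
    rw [← h _ hg, IsUnit.mul_iff] at hunit
    exact hs _ _ hunit.1
  have hg := (isUnit_algebraMap_iff p g).mpr hpg
  rw [map_zero, ← hg.mul_left_inj, h p hpg, zero_mul, ← hg.mul_left_inj, ← map_mul, hgf, map_zero,
    zero_mul]

theorem exists_gluing {ι : Type u} (U : ι → Opens (PrimeSpectrum.Top R))
    (W : Opens (PrimeSpectrum.Top R)) (hU : ∀ i, U i ≤ W) (hW : W ≤ iSup U)
    (s : ∀ i, SpecSections R (U i))
    (hs : ∀ i j, res (inf_le_left : U i ⊓ U j ≤ U i) (s i) =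
      res (inf_le_right : U i ⊓ U j ≤ U j) (s j)) :
    ∃ t : SpecSections R W, ∀ i, res (hU i) t = s i :=
  ((Spec.structureSheaf R).existsUnique_gluing' U W (fun i => homOfLE (hU i)) hW s hs).exists

theorem discreteTopology (hU : IsCompact (U : Set (PrimeSpectrum.Top R))) :
    DiscreteTopology (SpecSections R U) := by
  refine ⟨le_bot_iff.mp ?_⟩
  refine (iInf_le _ ⟨U, le_rfl, hU⟩).trans ?_
  intro t _
  exact ⟨res le_rfl '' t, trivial, Set.preimage_image_eq _ fun _ _ h => h⟩

theorem ofRing_bijective (hU : U = ⊤) : Function.Bijective (ofRing U) := by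
  subst hU
  exact StructureSheaf.algebraMap_obj_top_bijective

theorem exists_pow_mul_eq_ofRing (g : R) (hU : U = PrimeSpectrum.basicOpen g)
    (s : SpecSections R U) : ∃ (n : ℕ) (a : R), s * ofRing U g ^ n = ofRing U a := by
  have hl : IsLocalization.Away g ((structureSheafInType R R).obj.obj (op U)) := by
    rw [hU]
    infer_instance
  obtain ⟨⟨a, ⟨_, n, rfl⟩⟩, h⟩ := IsLocalization.surj (M := Submonoid.powers g)
    (S := (structureSheafInType R R).obj.obj (op U)) s
  refine ⟨n, a, ?_⟩
  rw [← map_pow]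
  exact h

theorem comap_comap {T : Type u} [CommRing T] (φ : R →+* S) (ψ : S →+* T)
    {V : Opens (PrimeSpectrum.Top S)} {W : Opens (PrimeSpectrum.Top T)}
    (h : ∀ p ∈ V, PrimeSpectrum.comap φ p ∈ U) (h' : ∀ p ∈ W, PrimeSpectrum.comap ψ p ∈ V)
    (χ : R →+* T) (hχ : χ = ψ.comp φ) (h'' : ∀ p ∈ W, PrimeSpectrum.comap χ p ∈ U)
    (s : SpecSections R U) : comap ψ V W h' (comap φ U V h s) = comap χ U W h'' s := by
  subst hχ
  exact (DFunLike.congr_fun (StructureSheaf.comap_comp φ ψ U V W h h') s).symm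

theorem comap_injective {φ : R →+* S} (hφ : Function.Bijective φ)
    {V : Opens (PrimeSpectrum.Top S)} (h : ∀ p ∈ V, PrimeSpectrum.comap φ p ∈ U)
    (h' : ∀ p, PrimeSpectrum.comap φ p ∈ U → p ∈ V) : Function.Injective (comap φ U V h) := by
  let e := RingEquiv.ofBijective φ hφ
  have he : (e.symm : S →+* R).comp φ = RingHom.id R := RingHom.ext fun x => e.symm_apply_apply x
  have hcomap (p : PrimeSpectrum R) :
      PrimeSpectrum.comap φ (PrimeSpectrum.comap (e.symm : S →+* R) p) = p := by
    rw [← PrimeSpectrum.comap_comp_apply, he, PrimeSpectrum.comap_id]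
  have hsymm : ∀ p ∈ U, PrimeSpectrum.comap (e.symm : S →+* R) p ∈ V :=
    fun p hp => h' _ ((hcomap p).symm ▸ hp)
  exact Function.LeftInverse.injective (g := comap (e.symm : S →+* R) V U hsymm) fun s =>
    (comap_comap φ _ h hsymm _ he.symm (fun _ hp => hp) s).trans
      (DFunLike.congr_fun (StructureSheaf.comap_id' U) s)

theorem continuous_res_of_isCompact (h : V ≤ U) (hV : IsCompact (V : Set (PrimeSpectrum.Top R))) :
    Continuous (res h) := by
  refine continuous_le_rng ?_ (continuous_le_dom (iInf_le _ (⟨V, h, hV⟩ :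
    {W : Opens (PrimeSpectrum.Top R) // W ≤ U ∧ IsCompact (W : Set (PrimeSpectrum.Top R))}))
      continuous_induced_dom)
  exact bot_le

end SpecSections

/-! ### Sections over a formal spectrum -/

theorem isOpen_ideal_of_le {A : Type*} [CommRing A] [TopologicalSpace A] [IsTopologicalRing A]
    {J K : Ideal A} (h : J ≤ K) (hJ : IsOpen (J : Set A)) : IsOpen (K : Set A) :=
  AddSubgroup.isOpen_mono (H₁ := Submodule.toAddSubgroup J) (H₂ := Submodule.toAddSubgroup K) h hJ

theorem continuous_of_isOpen_of_sub_mem {A : Type*} [CommRing A] [TopologicalSpace A]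
    [IsTopologicalRing A] {T : Type*} [TopologicalSpace T] {J : Ideal A}
    (hJ : IsOpen (J : Set A)) {f : A → T} (hf : ∀ a b, a - b ∈ J → f a = f b) : Continuous f := by
  refine ⟨fun t _ => isOpen_iff_forall_mem_open.mpr fun a ha => ?_⟩
  refine ⟨(fun b => b - a) ⁻¹' (J : Set A), fun b hb => ?_, hJ.preimage (by fun_prop), ?_⟩
  · rwa [Set.mem_preimage, hf b a hb]
  · simp

theorem SpfPoint.mem_of_isTopologicallyNilpotent {A : Type u} [CommRing A] [TopologicalSpace A]
    (p : SpfPoint A) {a : A} (ha : IsTopologicallyNilpotent a) : a ∈ p.1.asIdeal := by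
  obtain ⟨n, hn⟩ := (ha.eventually (p.2.mem_nhds p.1.asIdeal.zero_mem)).exists
  exact p.1.isPrime.mem_of_pow_mem n hn

theorem IsIdealOfDefinition.le {A : Type u} [CommRing A] [TopologicalSpace A] {J : Ideal A}
    (hJ : IsIdealOfDefinition J) (p : SpfPoint A) : J ≤ p.1.asIdeal :=
  fun a ha => p.mem_of_isTopologicallyNilpotent (hJ.isTopologicallyNilpotent a ha)

/-- The intersection of two open ideals. -/
def OpenIdeal.inf {A : Type u} [CommRing A] [TopologicalSpace A] (J K : OpenIdeal A) :
    OpenIdeal A :=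
  ⟨J.1 ⊓ K.1, J.2.inter K.2⟩

namespace Spf

variable {A : Type u} [CommRing A] [TopologicalSpace A] [IsTopologicalRing A]
  {U V : Opens (top A)}

theorem sections_ext {s t : sections U} (h : ∀ J : OpenIdeal A, s.1 J = t.1 J) : s = t :=
  Subtype.ext (funext h)

/-- The component of a section at an open ideal `J`, that is, its restriction to `Spec (A / J)`. -/
def component (U : Opens (top A)) (J : OpenIdeal A) :
    sections U →+* SpecSections (A ⧸ J.1) (openOf U J) :=
  (Pi.evalRingHom (fun J : OpenIdeal A => SpecSections (A ⧸ J.1) (openOf U J)) J).comp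
    (sections U).subtype

theorem continuous_component (U : Opens (top A)) (J : OpenIdeal A) :
    Continuous (component U J) :=
  (continuous_apply J).comp continuous_subtype_val

theorem component_eq_zero {s : sections U} {J K : OpenIdeal A} (h : J.1 ≤ K.1)
    (hs : s.1 J = 0) : s.1 K = 0 := by
  rw [← s.2 J K h, hs, map_zero]

theorem component_eq {s t : sections U} {J K : OpenIdeal A} (h : J.1 ≤ K.1)
    (hs : s.1 J = t.1 J) : s.1 K = t.1 K := by
  rw [← s.2 J K h, hs, t.2 J K h]

theorem exists_openIdeal_of_mem_nhds {N : Set (sections U)} (hN : N ∈ nhds 0) :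
    ∃ J : OpenIdeal A, ∀ s : sections U, s.1 J = 0 → s ∈ N := by
  obtain ⟨N', hN', hNN'⟩ := mem_nhds_subtype _ _ _ |>.mp hN
  rw [nhds_pi, Filter.mem_pi] at hN'
  obtain ⟨F, hF, t, ht, htN⟩ := hN'
  refine ⟨⟨⨅ J ∈ F, J.1, ?_⟩, fun s hs => hNN' (htN fun J hJ => ?_)⟩
  · have hcoe : ((⨅ J ∈ F, J.1 : Ideal A) : Set A) = ⋂ J ∈ F, (J.1 : Set A) := by simp
    rw [hcoe]
    exact hF.isOpen_biInter fun J _ => J.2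
  · rw [component_eq_zero (iInf₂_le J hJ) hs]
    exact mem_of_mem_nhds (ht J)

theorem isOpen_component_eq_zero (J : OpenIdeal A)
    (hU : IsCompact (openOf U J : Set (PrimeSpectrum.Top (A ⧸ J.1)))) :
    IsOpen {s : sections U | s.1 J = 0} := by
  have := SpecSections.discreteTopology hU
  exact (isOpen_discrete {0}).preimage (continuous_component U J)

/-- The section given by an element of the ring. -/
def ofRing (U : Opens (top A)) : A →+* sections U :=
  (RingHom.pi fun J : OpenIdeal A =>
    (SpecSections.ofRing (openOf U J)).comp (Ideal.Quotient.mk J.1)).codRestrict (sections U)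
      fun _ _ _ _ => SpecSections.comap_ofRing _ _ _

theorem continuous_ofRing : Continuous (ofRing U : A → sections U) := by
  refine Continuous.subtype_mk (continuous_pi fun J => ?_) _
  refine continuous_of_isOpen_of_sub_mem J.2 fun a b hab => ?_
  change SpecSections.ofRing _ (Ideal.Quotient.mk J.1 a) =
    SpecSections.ofRing _ (Ideal.Quotient.mk J.1 b)
  rw [Ideal.Quotient.eq.mpr hab]

theorem exists_ofRing_component_eq {J : OpenIdeal A} (hJ : openOf U J = ⊤) (s : sections U) :
    ∃ a : A, s.1 J = (ofRing U a).1 J := by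
  obtain ⟨b, hb⟩ := (SpecSections.ofRing_bijective hJ).2 (s.1 J)
  obtain ⟨a, rfl⟩ := Ideal.Quotient.mk_surjective b
  exact ⟨a, hb.symm⟩

theorem ofRing_component_eq_zero_iff {J : OpenIdeal A} (hJ : openOf U J = ⊤) (a : A) :
    (ofRing U a).1 J = 0 ↔ a ∈ J.1 :=
  (map_eq_zero_iff _ (SpecSections.ofRing_bijective hJ).1).trans Ideal.Quotient.eq_zero_iff_mem

/-! ### Points of the formal spectrum -/

theorem ofSpec_injective (J : OpenIdeal A) : Function.Injective (ofSpec J) := fun _ _ h =>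
  PrimeSpectrum.comap_injective_of_surjective _ Ideal.Quotient.mk_surjective
    (congrArg Subtype.val h)

theorem isEmbedding_ofSpec (J : OpenIdeal A) : Topology.IsEmbedding (ofSpec J) := by
  refine Topology.IsEmbedding.of_comp (continuous_ofSpec J) continuous_subtype_val ?_
  exact (PrimeSpectrum.isClosedEmbedding_comap_of_surjective _ _
    Ideal.Quotient.mk_surjective).isEmbedding

theorem le_ofSpec (J : OpenIdeal A) (q : PrimeSpectrum (A ⧸ J.1)) :
    J.1 ≤ (ofSpec J q).1.asIdeal := by
  intro a ha
  change Ideal.Quotient.mk J.1 a ∈ q.asIdeal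
  rw [Ideal.Quotient.eq_zero_iff_mem.mpr ha]
  exact q.asIdeal.zero_mem

theorem exists_ofSpec_eq {J : OpenIdeal A} {p : SpfPoint A} (h : J.1 ≤ p.1.asIdeal) :
    ∃ q, ofSpec J q = p := by
  have hp : p.1 ∈ Set.range (PrimeSpectrum.comap (Ideal.Quotient.mk J.1)) := by
    rwa [range_comap_of_surjective _ _ Ideal.Quotient.mk_surjective, Ideal.mk_ker]
  obtain ⟨q, hq⟩ := hp
  exact ⟨q, Subtype.ext hq⟩

theorem exists_eq_ofSpec (p : SpfPoint A) :
    ∃ (J : OpenIdeal A) (q : PrimeSpectrum (A ⧸ J.1)), p = ofSpec J q := by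
  obtain ⟨q, hq⟩ := exists_ofSpec_eq (J := ⟨p.1.asIdeal, p.2⟩) (p := p) le_rfl
  exact ⟨_, q, hq.symm⟩

/-- Invertibility of a section at a point `p`: a component whose spectrum contains `p` is invertible
in the local ring at `p`. By `isUnitAt_iff` the choice of the component is immaterial. -/
def IsUnitAt (s : sections U) (p : SpfPoint A) (hp : p ∈ U) : Prop :=
  ∃ (J : OpenIdeal A) (q : PrimeSpectrum (A ⧸ J.1)) (hq : ofSpec J q = p),
    IsUnit (SpecSections.value (U := openOf U J) q (by subst hq; exact hp) (s.1 J))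

theorem isUnitAt_iff (s : sections U) {J : OpenIdeal A} (q : PrimeSpectrum (A ⧸ J.1))
    (hq : ofSpec J q ∈ U) :
    IsUnitAt s (ofSpec J q) hq ↔
      IsUnit (SpecSections.value (U := openOf U J) q hq (s.1 J)) := by
  refine ⟨?_, fun h => ⟨J, q, rfl, h⟩⟩
  rintro ⟨K, r, hr, h⟩
  have h₁ : (J.inf K).1 ≤ J.1 := inf_le_left
  have h₂ : (J.inf K).1 ≤ K.1 := inf_le_right
  have heq : PrimeSpectrum.comap (Ideal.Quotient.factor h₁) q =
      PrimeSpectrum.comap (Ideal.Quotient.factor h₂) r := ofSpec_injective _ hr.symm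
  rw [← s.2 _ _ h₂, SpecSections.isUnit_value_comap] at h
  rw [← s.2 _ _ h₁]
  refine (SpecSections.isUnit_value_comap _ (openOf_comap U h₁) q hq _).mpr ?_
  exact (SpecSections.isUnit_value_congr heq _ _ _).mpr h

theorem isUnitAt_res (h : V ≤ U) (s : sections U) (p : SpfPoint A) (hp : p ∈ V) :
    IsUnitAt (res h s) p hp ↔ IsUnitAt s p (h hp) := Iff.rfl

theorem isUnit_iff {s : sections U} : IsUnit s ↔ ∀ p hp, IsUnitAt s p hp := by
  constructor
  · intro h p hp
    obtain ⟨J, q, rfl⟩ := exists_eq_ofSpec p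
    exact (isUnitAt_iff s q hp).mpr ((h.map (component U J)).map _)
  · intro h
    have hcomponent (J : OpenIdeal A) : IsUnit (s.1 J) :=
      SpecSections.isUnit_iff.mpr fun q hq => (isUnitAt_iff s q hq).mp (h _ _)
    choose t ht using fun J => (hcomponent J).exists_right_inv
    refine IsUnit.of_mul_eq_one ⟨t, fun J K hJK => ?_⟩ (sections_ext ht)
    refine (hcomponent K).mul_left_cancel ?_
    rw [ht K, ← s.2 J K hJK, ← map_mul, ht J, map_one]

theorem isUnitAt_one_sub {s : sections U} {p : SpfPoint A} {hp : p ∈ U} (h : ¬ IsUnitAt s p hp) :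
    IsUnitAt (1 - s) p hp := by
  obtain ⟨J, q, rfl⟩ := exists_eq_ofSpec p
  rw [isUnitAt_iff] at h ⊢
  have := (IsLocalRing.isUnit_or_isUnit_one_sub_self
    (SpecSections.value (U := openOf U J) q hp (s.1 J))).resolve_left h
  rwa [← map_one (SpecSections.value (U := openOf U J) q hp), ← map_sub] at this

theorem nontrivial_sections (p : SpfPoint A) (hp : p ∈ U) : Nontrivial (sections U) := by
  obtain ⟨J, q, rfl⟩ := exists_eq_ofSpec p
  have := SpecSections.nontrivial (U := openOf U J) q hp
  exact (component U J).domain_nontrivial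

theorem isHomeomorph_ofSpec {J : Ideal A} (hJ : IsIdealOfDefinition J) :
    IsHomeomorph (ofSpec ⟨J, hJ.isOpen⟩) := by
  rw [isHomeomorph_iff_isEmbedding_surjective]
  exact ⟨isEmbedding_ofSpec _, fun p => exists_ofSpec_eq (hJ.le p)⟩

theorem isOpen_isUnitAt (hA : IsAdmissibleRing A) (s : sections U) :
    IsOpen {p : SpfPoint A | ∃ hp : p ∈ U, IsUnitAt s p hp} := by
  obtain ⟨J, hJ⟩ := hA.exists_idealOfDefinition
  rw [← (isHomeomorph_ofSpec hJ).isQuotientMap.isOpen_preimage]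
  convert SpecSections.isOpen_isUnit_value (s.1 ⟨J, hJ.isOpen⟩) using 1
  ext q
  exact ⟨fun ⟨h, h'⟩ => ⟨h, (isUnitAt_iff s q h).mp h'⟩,
    fun ⟨h, h'⟩ => ⟨h, (isUnitAt_iff s q h).mpr h'⟩⟩

theorem exists_isUnit_res (hA : IsAdmissibleRing A) (s : sections U) {p : SpfPoint A} (hp : p ∈ U)
    (h : IsUnitAt s p hp) : ∃ (V : Opens (top A)) (hV : V ≤ U), p ∈ V ∧ IsUnit (res hV s) :=
  ⟨⟨_, isOpen_isUnitAt hA s⟩, fun _ h => h.1, ⟨hp, h⟩, isUnit_iff.mpr fun _ h => h.2⟩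

end Spf

/-! ### The formal spectrum as a formal scheme -/

theorem exists_finset_isCompact_cover {X ι : Type*} [TopologicalSpace X] [PrespectralSpace X]
    (U : ι → Opens X) {K : Set X} (hK : IsCompact K) (hKU : ∀ x ∈ K, ∃ i, x ∈ U i) :
    ∃ t : Finset (Opens X), (∀ D ∈ t, IsCompact (D : Set X) ∧ ∃ i, D ≤ U i) ∧
      ∀ x ∈ K, ∃ D ∈ t, x ∈ D := by
  classical
  have hlocal : ∀ x ∈ K, ∃ D : Opens X, x ∈ D ∧ IsCompact (D : Set X) ∧ ∃ i, D ≤ U i := by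
    intro x hx
    obtain ⟨i, hi⟩ := hKU x hx
    obtain ⟨D, hD, hxD, hDU⟩ := Opens.isBasis_iff_nbhd.mp (PrespectralSpace.isBasis_opens X) hi
    exact ⟨D, hxD, hD, i, hDU⟩
  choose! D hxD hD using hlocal
  obtain ⟨t, htK, ht⟩ := hK.elim_nhds_subcover (fun x => (D x : Set X))
    fun x hx => (D x).2.mem_nhds (hxD x hx)
  refine ⟨t.image D, fun E hE => ?_, fun x hx => ?_⟩
  · obtain ⟨x, hx, rfl⟩ := Finset.mem_image.mp hE
    exact hD x (htK x hx)
  · obtain ⟨y, hy, hxy⟩ := Set.mem_iUnion₂.mp (ht hx)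
    exact ⟨D y, Finset.mem_image_of_mem D hy, hxy⟩

namespace SpecSections

variable {R S : Type u} [CommRing R] [CommRing S] {U : Opens (PrimeSpectrum.Top R)}
  {V : Opens (PrimeSpectrum.Top S)}

theorem continuous_comap (φ : R →+* S) (h : ∀ p ∈ V, PrimeSpectrum.comap φ p ∈ U) :
    Continuous (comap φ U V h) := by
  refine continuous_iInf_rng.mpr fun W => continuous_induced_rng.mpr ?_
  obtain ⟨W', hW', hW'open, hWW', hW'U⟩ := PrespectralSpace.exists_isCompact_and_isOpen_between
    (W.2.2.image (PrimeSpectrum.continuous_comap φ)) U.2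
    (Set.image_subset_iff.mpr fun q hq => h q (W.2.1 hq))
  let D : Opens (PrimeSpectrum.Top R) := ⟨W', hW'open⟩
  have hWD : ∀ p ∈ W.1, PrimeSpectrum.comap φ p ∈ D := fun p hp => hWW' ⟨p, hp, rfl⟩
  change @Continuous _ _ _ ⊥ (comap φ D W.1 hWD ∘ res hW'U)
  have := discreteTopology (U := D) hW'
  exact @Continuous.mk _ _ _ ⊥ _ fun T _ =>
    (continuous_res_of_isCompact hW'U hW').isOpen_preimage (comap φ D W.1 hWD ⁻¹' T)
      (isOpen_discrete _)

end SpecSections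

namespace Spf

variable {A : Type u} [CommRing A] [TopologicalSpace A] [IsTopologicalRing A]

theorem exists_mem_openOf_of_mem_iSup {ι : Type*} (U : ι → Opens (top A)) {J : OpenIdeal A}
    {p : PrimeSpectrum (A ⧸ J.1)} (hp : p ∈ openOf (iSup U) J) : ∃ i, p ∈ openOf (U i) J := by
  have hmem : ofSpec J p ∈ iSup U := hp
  rwa [Opens.mem_iSup] at hmem

theorem continuous_res_component {U V : Opens (top A)} (h : V ≤ U) {J : OpenIdeal A}
    {D : Opens (PrimeSpectrum.Top (A ⧸ J.1))} (hDV : D ≤ openOf V J) (hDU : D ≤ openOf U J)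
    (hD : IsCompact (D : Set (PrimeSpectrum.Top (A ⧸ J.1)))) :
    @Continuous _ _ (TopologicalSpace.induced (res h) inferInstance) _
      fun s : sections U => SpecSections.res hDU (s.1 J) :=
  @Continuous.comp _ _ _ (TopologicalSpace.induced (res h) inferInstance) _ _ (res h)
    (SpecSections.res hDV ∘ component V J)
    ((SpecSections.continuous_res_of_isCompact hDV hD).comp (continuous_component V J))
    continuous_induced_dom

theorem iInf_induced_res_le {ι : Type*} (U : ι → Opens (top A)) :
    (⨅ i, TopologicalSpace.induced (res (le_iSup U i)) inferInstance) ≤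
      (inferInstance : TopologicalSpace (sections (iSup U))) := by
  let τ : TopologicalSpace (sections (iSup U)) :=
    ⨅ i, TopologicalSpace.induced (res (le_iSup U i)) inferInstance
  change τ ≤ TopologicalSpace.induced Subtype.val
    (⨅ J : OpenIdeal A, TopologicalSpace.induced (fun s => s J) (⨅ W, TopologicalSpace.induced _ ⊥))
  simp only [induced_iInf, induced_compose]
  refine le_iInf fun J => le_iInf fun W => ?_
  have : PrespectralSpace (PrimeSpectrum.Top (A ⧸ J.1)) :=
    inferInstanceAs (PrespectralSpace (PrimeSpectrum (A ⧸ J.1)))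
  rintro _ ⟨S, -, rfl⟩
  obtain ⟨t, ht, htW⟩ := exists_finset_isCompact_cover (fun i => openOf (U i) J) W.2.2
    (fun p hp => exists_mem_openOf_of_mem_iSup U (W.2.1 hp))
  have hle (D : t) : D.1 ≤ openOf (iSup U) J := by
    obtain ⟨-, i, hi⟩ := ht D.1 D.2
    exact fun p hp => openOf_mono (le_iSup U i) J (hi hp)
  have hopen (D : t) (s₀ : sections (iSup U)) :
      @IsOpen _ τ {s : sections (iSup U) |
        SpecSections.res (hle D) (s.1 J) = SpecSections.res (hle D) (s₀.1 J)} := by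
    obtain ⟨hD, i, hi⟩ := ht D.1 D.2
    have := SpecSections.discreteTopology (U := D.1) hD
    exact (continuous_iInf_dom (i := i) (continuous_res_component (le_iSup U i) hi (hle D)
      hD)).isOpen_preimage {SpecSections.res (hle D) (s₀.1 J)} (isOpen_discrete _)
  refine (@isOpen_iff_forall_mem_open _ τ _).mpr fun s₀ hs₀ => ⟨_, fun s hs => ?_,
    @isOpen_iInter_of_finite _ _ τ _ _ fun D => hopen D s₀, Set.mem_iInter.mpr fun _ => rfl⟩
  have heq : SpecSections.res W.2.1 (s.1 J) = SpecSections.res W.2.1 (s₀.1 J) := by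
    refine SpecSections.ext_value fun p hp => ?_
    obtain ⟨D, hD, hpD⟩ := htW p hp
    exact congrArg (SpecSections.value (R := A ⧸ J.1) (U := D) p hpD)
      (Set.mem_iInter.mp hs ⟨D, hD⟩)
  change SpecSections.res W.2.1 (s.1 J) ∈ S
  rw [heq]
  exact hs₀

theorem existsUnique_gluing {ι : Type u} (U : ι → Opens (top A)) (s : ∀ i, sections (U i))
    (hs : ∀ i j, res (inf_le_left : U i ⊓ U j ≤ U i) (s i) =
      res (inf_le_right : U i ⊓ U j ≤ U j) (s j)) :
    ∃! t : sections (iSup U), ∀ i, res (le_iSup U i) t = s i := by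
  have hglue : ∀ J : OpenIdeal A, ∃ t : SpecSections (A ⧸ J.1) (openOf (iSup U) J),
      ∀ i, SpecSections.res (openOf_mono (le_iSup U i) J) t = (s i).1 J := fun J =>
    SpecSections.exists_gluing (fun i => openOf (U i) J) _
      (fun i => openOf_mono (le_iSup U i) J)
      (fun p hp => Opens.mem_iSup.mpr (exists_mem_openOf_of_mem_iSup U hp)) (fun i => (s i).1 J)
      (fun i j => congrFun (congrArg Subtype.val (hs i j)) J)
  choose t ht using hglue
  have hvalue (J : OpenIdeal A) (i) (p) (hp : p ∈ openOf (U i) J) :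
      SpecSections.value p (openOf_mono (le_iSup U i) J hp) (t J) =
        SpecSections.value p hp ((s i).1 J) := by
    rw [← ht J i]
    rfl
  have hcompatible : t ∈ sections (iSup U) := fun J K h => by
    refine SpecSections.ext_value fun p hp => ?_
    obtain ⟨i, hi⟩ := exists_mem_openOf_of_mem_iSup U hp
    refine Eq.trans ?_ (hvalue K i p hi).symm
    rw [← (s i).2 J K h]
    refine (SpecSections.value_comap _ _ _ hp _).trans
      (Eq.trans ?_ (SpecSections.value_comap _ _ _ hi _).symm)
    exact congrArg _ (hvalue J i _ hi)
  refine ⟨⟨t, hcompatible⟩, fun i => sections_ext fun J => ht J i,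
    fun t' ht' => sections_ext fun J => SpecSections.ext_value fun p hp => ?_⟩
  obtain ⟨i, hi⟩ := exists_mem_openOf_of_mem_iSup U hp
  refine Eq.trans ?_ (hvalue J i p hi).symm
  rw [← ht' i]
  rfl

theorem isSheaf (A : TopCommRingCat.{u}) : (Spf A).presheaf.IsSheaf :=
  isSheaf_of_existsUnique_gluing (fun _ U s hs => existsUnique_gluing U s hs)
    fun _ U => iInf_induced_res_le U

/-- The formal spectrum of an admissible ring as a formal scheme. -/
def formalScheme (A : TopCommRingCat.{u}) (hA : IsAdmissibleRing A) : FormalScheme.{u} where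
  toPresheafedSpace := Spf A
  isSheaf := isSheaf A
  exists_chart x := ⟨⟨A, hA, 𝟙 _, inferInstance⟩, x, rfl⟩

/-! ### Morphisms of formal spectra -/

/-- The map of formal spectra given by a continuous ring homomorphism. -/
def mapPoint {A B : Type u} [CommRing A] [TopologicalSpace A] [CommRing B] [TopologicalSpace B]
    {φ : A →+* B} (hφ : Continuous φ) (q : SpfPoint B) : SpfPoint A :=
  ⟨PrimeSpectrum.comap φ q.1, q.2.preimage hφ⟩

theorem continuous_mapPoint {A B : Type u} [CommRing A] [TopologicalSpace A] [CommRing B]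
    [TopologicalSpace B] {φ : A →+* B} (hφ : Continuous φ) : Continuous (mapPoint hφ) :=
  Continuous.subtype_mk ((PrimeSpectrum.continuous_comap φ).comp continuous_subtype_val) _

section Map

variable {B : Type u} [CommRing B] [TopologicalSpace B] [IsTopologicalRing B]
  {φ : A →+* B} (hφ : Continuous φ)

/-- The inverse image of an open ideal under a continuous homomorphism. -/
def comapIdeal (K : OpenIdeal B) : OpenIdeal A := ⟨K.1.comap φ, K.2.preimage hφ⟩

/-- The inverse image of an open set under the map of formal spectra. -/
def mapOpen (U : Opens (top A)) : Opens (top B) :=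
  ⟨mapPoint hφ ⁻¹' U, U.2.preimage (continuous_mapPoint hφ)⟩

/-- The homomorphism `A / φ⁻¹ K → B / K` induced by `φ`. -/
abbrev quotientMap (K : OpenIdeal B) : A ⧸ (comapIdeal hφ K).1 →+* B ⧸ K.1 :=
  Ideal.quotientMap K.1 φ le_rfl

theorem openOf_quotientMap (U : Opens (top A)) (K : OpenIdeal B) :
    ∀ p ∈ openOf (mapOpen hφ U) K,
      PrimeSpectrum.comap (quotientMap hφ K) p ∈ openOf U (comapIdeal hφ K) :=
  fun _ hp => hp

/-- Pullback of sections along the map of formal spectra given by `φ`. -/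
def pullback (U : Opens (top A)) : sections U →+* sections (mapOpen hφ U) where
  toFun s := ⟨fun K => SpecSections.comap (quotientMap hφ K) _ _ (openOf_quotientMap hφ U K)
      (s.1 (comapIdeal hφ K)), fun K L h => by
    have hcomp : (comapIdeal hφ K).1 ≤ (comapIdeal hφ L).1 := Ideal.comap_mono h
    dsimp only
    rw [← s.2 _ _ hcomp, SpecSections.comap_comap _ _ _ _ _ rfl (fun p hp => hp),
      SpecSections.comap_comap _ _ _ _ ((Ideal.Quotient.factor h).comp (quotientMap hφ K)) ?_
        (fun p hp => hp)]
    exact Ideal.Quotient.ringHom_ext rfl⟩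
  map_one' := sections_ext fun K => map_one _
  map_zero' := sections_ext fun K => map_zero _
  map_mul' s t := sections_ext fun K => map_mul _ _ _
  map_add' s t := sections_ext fun K => map_add _ _ _

theorem pullback_component (U : Opens (top A)) (s : sections U) (K : OpenIdeal B) :
    (pullback hφ U s).1 K = SpecSections.comap (quotientMap hφ K) _ _ (openOf_quotientMap hφ U K)
      (s.1 (comapIdeal hφ K)) := rfl

theorem continuous_pullback (U : Opens (top A)) : Continuous (pullback hφ U) := by
  refine Continuous.subtype_mk (continuous_pi fun K => ?_) _
  exact (SpecSections.continuous_comap _ _).comp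
    ((continuous_apply (comapIdeal hφ K)).comp continuous_subtype_val)

theorem pullback_ofRing (U : Opens (top A)) (a : A) :
    pullback hφ U (ofRing U a) = ofRing (mapOpen hφ U) (φ a) :=
  sections_ext fun _ => SpecSections.comap_ofRing _ _ _

theorem isUnitAt_pullback {U : Opens (top A)} (s : sections U) (q : SpfPoint B)
    (hq : q ∈ mapOpen hφ U) (h : IsUnitAt (pullback hφ U s) q hq) :
    IsUnitAt s (mapPoint hφ q) hq := by
  obtain ⟨K, r, rfl, hr⟩ := h
  rw [pullback_component, SpecSections.isUnit_value_comap] at hr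
  exact ⟨comapIdeal hφ K, PrimeSpectrum.comap (quotientMap hφ K) r, rfl, hr⟩

end Map

/-- The morphism of formal spectra given by a continuous ring homomorphism. -/
def map {A B : TopCommRingCat.{u}} (φ : A ⟶ B) : Spf B ⟶ Spf A where
  base := TopCat.ofHom ⟨mapPoint φ.2, continuous_mapPoint φ.2⟩
  c :=
    { app U := ⟨pullback φ.2 U.unop, continuous_pullback φ.2 U.unop⟩
      naturality _ _ _ := rfl }

/-- The morphism of formal schemes given by a continuous homomorphism of admissible rings. -/
def mapHom {A B : TopCommRingCat.{u}} (hA : IsAdmissibleRing A) (hB : IsAdmissibleRing B)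
    (φ : A ⟶ B) : formalScheme B hB ⟶ formalScheme A hA where
  hom := map φ
  isLocalHom q := by
    refine isLocalHom_stalkMap_forgetTopology_of_isUnit_res (map φ) q fun U s V hV hq hu => ?_
    have hunit : IsUnitAt (pullback φ.2 U s) q (hV hq) :=
      (isUnitAt_res hV (pullback φ.2 U s) q hq).mp (isUnit_iff.mp hu q hq)
    exact exists_isUnit_res hA s _ (isUnitAt_pullback φ.2 s q _ hunit)

end Spf

namespace FormalScheme

theorem isIso_c_app_of_isOpenImmersion
    {C : Type*} [Category C] {X Y : PresheafedSpace C}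
    (f : Y ⟶ X) [PresheafedSpace.IsOpenImmersion f] (U : Opens X)
    (hU : (U : Set X) ⊆ Set.range f.base) : IsIso (f.c.app (op U)) :=
  PresheafedSpace.IsOpenImmersion.c_iso' f ((Opens.map f.base).obj U)
    (Opens.ext (Set.image_preimage_eq_of_subset hU).symm)

theorem isHomeomorph_of_isIso {R S : TopCommRingCat.{u}} (f : R ⟶ S)
    [IsIso f] : IsHomeomorph f.1 := by
  refine isHomeomorph_iff_exists_inverse.mpr ⟨f.2, (inv f).1, fun x => ?_, fun x => ?_, (inv f).2⟩
  · exact congrArg (fun g : R ⟶ R => g.1 x) (IsIso.hom_inv_id f)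
  · exact congrArg (fun g : S ⟶ S => g.1 x) (IsIso.inv_hom_id f)

/-- An affine chart as a morphism of formal schemes. -/
def chartHom {X : FormalScheme.{u}} (c : AffineChart X.toPresheafedSpace) :
    Spf.formalScheme c.ring c.isAdmissible ⟶ X where
  hom := c.map
  isLocalHom q := by
    refine isLocalHom_stalkMap_forgetTopology_of_isUnit_res c.map q fun U s V hV hq hu => ?_
    have hop := c.isOpenImmersion.base_open
    let W : Opens X.carrier := hop.functor.obj V
    have hWU : W ≤ U := by
      rintro _ ⟨v, hv, rfl⟩
      exact hV hv
    have hWV : (Opens.map c.map.base).obj W = V :=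
      Opens.ext (Set.preimage_image_eq _ hop.injective)
    refine ⟨W, hWU, ⟨q, hq, rfl⟩, ?_⟩
    have := c.isOpenImmersion.c_iso V
    have hb := (isHomeomorph_of_isIso (c.map.c.app (op W))).bijective
    have hu' : IsUnit ((c.map.c.app (op W)).1 (X.res hWU s)) := by
      have hnaturality := congrArg
        (fun g : X.sections U ⟶ (Spf c.ring).presheaf.obj (op _) => g.1 s)
        (c.map.c.naturality (homOfLE hWU).op)
      refine (congrArg IsUnit hnaturality).mpr ?_
      exact hu.map ((Spf c.ring).presheaf.map (homOfLE hWV.le).op).1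
    exact (MulEquiv.isUnit_map (RingEquiv.ofBijective (c.map.c.app (op W)).1 hb)).mp hu'

end FormalScheme

/-! ### Properties of immersions -/

namespace FormalScheme

variable {X Y Z : FormalScheme.{u}}

theorem IsImmersion.isEmbedding {f : Y ⟶ X} (hf : IsImmersion f) :
    Topology.IsEmbedding f.hom.base := by
  obtain ⟨W, i, j, ⟨𝓘, -, hi⟩, hj, rfl⟩ := hf
  exact hj.base_open.isEmbedding.comp hi.isEmbedding

theorem IsImmersion.exists_isOpenQuotientMap {f : Y ⟶ X} (hf : IsImmersion f) (y : Y.carrier)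
    (V : Opens X.carrier) (hV : f.hom.base y ∈ V) :
    ∃ U : Opens X.carrier, U ≤ V ∧ f.hom.base y ∈ U ∧ IsOpenQuotientMap (Hom.app f U) := by
  obtain ⟨W, i, j, ⟨𝓘, -, hi⟩, hj, rfl⟩ := hf
  obtain ⟨B, hB, hq⟩ := hi.quotient
  have hV' : i.hom.base y ∈ (Opens.map j.hom.base).obj V := hV
  obtain ⟨U, hU, hyU, hUV⟩ := (Opens.isBasis_iff_nbhd.mp hB) hV'
  have hop := hj.base_open
  let U' : Opens X.carrier := hop.functor.obj U
  have hU' : (Opens.map j.hom.base).obj U' = U :=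
    Opens.ext (Set.preimage_image_eq _ hop.injective)
  refine ⟨U', ?_, ⟨_, hyU, rfl⟩, ?_⟩
  · rintro _ ⟨w, hw, rfl⟩
    exact hUV hw
  · have happ : IsOpenQuotientMap (Hom.app i ((Opens.map j.hom.base).obj U')) :=
      hq _ (hU'.symm ▸ hU)
    have := hj.c_iso U
    have hhomeo := isHomeomorph_of_isIso (j.hom.c.app (op U'))
    exact happ.comp ⟨hhomeo.surjective, hhomeo.continuous, hhomeo.isOpenMap⟩

theorem IsClosedImmersion.isImmersion {f : Y ⟶ X} (hf : IsClosedImmersion f) : IsImmersion f :=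
  ⟨X, f, 𝟙 X, hf, (inferInstance : PresheafedSpace.IsOpenImmersion (𝟙 X.toPresheafedSpace)),
    Category.comp_id f⟩

theorem IsClosedImmersion.isImmersion_comp_chartHom (c : AffineChart X.toPresheafedSpace)
    {f : Y ⟶ Spf.formalScheme c.ring c.isAdmissible} (hf : IsClosedImmersion f) :
    IsImmersion (f ≫ chartHom c) :=
  ⟨_, f, chartHom c, hf, c.isOpenImmersion, rfl⟩

end FormalScheme

theorem AffineChart.isHomeomorph_app {X : FormalScheme.{u}} (c : AffineChart X.toPresheafedSpace)
    {U : Opens X.carrier} (hU : U ≤ c.range) : IsHomeomorph (c.map.c.app (op U)).1 := by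
  have := c.isOpenImmersion
  have := FormalScheme.isIso_c_app_of_isOpenImmersion c.map U hU
  exact FormalScheme.isHomeomorph_of_isIso _

/-! ### Completeness in terms of sequences -/

theorem sub_mem_of_forall_succ_sub_mem {A : Type*} [CommRing A] {I : ℕ → Ideal A}
    (hI : Antitone I) {a : ℕ → A} (ha : ∀ n, a (n + 1) - a n ∈ I n) {m n : ℕ} (h : n ≤ m) :
    a m - a n ∈ I n := by
  induction m, h using Nat.le_induction with
  | base => simp
  | succ m hm ih => simpa using add_mem (hI hm (ha m)) ih

theorem exists_forall_sub_mem_of_completeSpace {A : Type*} [CommRing A] [TopologicalSpace A]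
    [IsTopologicalRing A] {I : ℕ → Ideal A}
    (hc : @CompleteSpace A (IsTopologicalAddGroup.rightUniformSpace A)) (hI : Antitone I)
    (hb : (nhds (0 : A)).HasBasis (fun _ => True) (fun n => (I n : Set A))) (a : ℕ → A)
    (ha : ∀ n, a (n + 1) - a n ∈ I n) : ∃ x, ∀ n, x - a n ∈ I n := by
  let := IsTopologicalAddGroup.rightUniformSpace A
  have : IsUniformAddGroup A := isUniformAddGroup_of_addCommGroup
  have hunif := hb.uniformity_of_nhds_zero
  have hcauchy : CauchySeq a := hunif.cauchySeq_iff.mpr fun n _ => ⟨n, fun m hm k hk => by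
    have := sub_mem (sub_mem_of_forall_succ_sub_mem hI ha hk)
      (sub_mem_of_forall_succ_sub_mem hI ha hm)
    simpa using this⟩
  obtain ⟨x, hx⟩ := cauchySeq_tendsto_of_complete hcauchy
  refine ⟨x, fun n => ?_⟩
  have hopen : IsOpen (I n : Set A) := AddSubgroup.isOpen_of_mem_nhds
    (Submodule.toAddSubgroup (I n)) (hb.mem_of_mem trivial)
  have hclosed : IsClosed (I n : Set A) :=
    AddSubgroup.isClosed_of_isOpen (Submodule.toAddSubgroup (I n)) hopen
  exact hclosed.mem_of_tendsto (hx.sub_const (a n)) (Filter.eventually_atTop.mpr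
    ⟨n, fun m hm => sub_mem_of_forall_succ_sub_mem hI ha hm⟩)

theorem completeSpace_of_forall_exists_sub_mem {A : Type*} [CommRing A] [TopologicalSpace A]
    [IsTopologicalRing A] {I : ℕ → Ideal A}
    (hb : (nhds (0 : A)).HasBasis (fun _ => True) (fun n => (I n : Set A)))
    (h : ∀ a : ℕ → A, (∀ n, a (n + 1) - a n ∈ I n) → ∃ x, ∀ n, x - a n ∈ I n) :
    @CompleteSpace A (IsTopologicalAddGroup.rightUniformSpace A) := by
  let := IsTopologicalAddGroup.rightUniformSpace A
  have : IsUniformAddGroup A := isUniformAddGroup_of_addCommGroup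
  have : (nhds (0 : A)).IsCountablyGenerated := hb.isCountablyGenerated
  have := IsUniformAddGroup.uniformity_countably_generated (α := A)
  have hunif := hb.uniformity_of_nhds_zero
  refine UniformSpace.complete_of_cauchySeq_tendsto fun u hu => ?_
  have hcauchy (k : ℕ) : ∃ N, ∀ m ≥ N, ∀ n ≥ N, u n - u m ∈ I k :=
    hunif.cauchySeq_iff.mp hu k trivial
  choose N hN using hcauchy
  let M : ℕ → ℕ := fun k => (Finset.range (k + 1)).sup N
  have hM : Monotone M := fun i j hij => Finset.sup_mono (by simpa using hij)
  have hNM : ∀ k, N k ≤ M k := fun k => Finset.le_sup (f := N) (by simp)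
  obtain ⟨x, hx⟩ := h (fun k => u (M k)) fun k =>
    hN k _ (hNM k) _ ((hNM k).trans (hM (Nat.le_succ k)))
  refine ⟨x, ?_⟩
  rw [← tendsto_sub_nhds_zero_iff, hb.tendsto_right_iff]
  intro k _
  filter_upwards [Filter.eventually_ge_atTop (M k)] with n hn
  have := sub_mem (hN k _ (hNM k) n ((hNM k).trans hn)) (hx k)
  simpa using this

theorem IsAdmissibleRing.of_discreteTopology (A : Type u) [CommRing A] [TopologicalSpace A]
    [IsTopologicalRing A] [DiscreteTopology A] : IsAdmissibleRing A where
  exists_basis := ⟨fun _ => ⊥, antitone_const, by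
    rw [nhds_discrete]
    exact ⟨fun t => by simp⟩⟩
  separated := inferInstance
  complete := completeSpace_of_forall_exists_sub_mem (I := fun _ => ⊥) (by
    rw [nhds_discrete]
    exact ⟨fun t => by simp⟩) fun a ha => ⟨a 0, fun n => by
      induction n with
      | zero => simp
      | succ n ih =>
        have hsucc := ha n
        rw [Ideal.mem_bot, sub_eq_zero] at hsucc ih ⊢
        rw [hsucc, ih]⟩
  exists_idealOfDefinition := ⟨⊥, isOpen_discrete _, fun f hf => by
    rw [Ideal.mem_bot.mp hf]
    exact IsTopologicallyNilpotent.zero⟩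

/-! ### Ideal sheaves on formal spectra -/

namespace Spf

/-- The sets `I^△` of sections of a formal spectrum, as a sheaf of ideals. -/
def triangleSheaf (A : TopCommRingCat.{u}) (hA : IsAdmissibleRing A) (I : Ideal A) :
    FormalScheme.IdealSheaf (formalScheme A hA) where
  ideal U :=
    { carrier := FormalScheme.triangle I U
      add_mem' := fun {s t} hs ht K hK => by
        change (s : sections U).1 K + (t : sections U).1 K = 0
        rw [hs K hK, ht K hK, add_zero]
      zero_mem' := fun _ _ => rfl
      smul_mem' := fun s t ht K hK => by
        change (s : sections U).1 K * (t : sections U).1 K = 0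
        rw [ht K hK, mul_zero] }
  res_mem {U V} h s hs K hK := by
    change SpecSections.res (openOf_mono h K) ((s : sections U).1 K) = 0
    rw [hs K hK, map_zero]
  mem_of_locally U s hs K hK := by
    refine SpecSections.ext_value fun p hp => ?_
    obtain ⟨V, hV, hpV, h⟩ := hs (ofSpec K p) hp
    exact congrArg (SpecSections.value (U := openOf V K) p hpV) (h K hK)

theorem isClosed_triangleSheaf (A : TopCommRingCat.{u}) (hA : IsAdmissibleRing A) (I : Ideal A)
    (hI : IsClosed (I : Set A)) : (triangleSheaf A hA I).IsClosed := by
  intro x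
  exact ⟨⟨A, hA, 𝟙 (Spf A), (inferInstance : PresheafedSpace.IsOpenImmersion (𝟙 (Spf A)))⟩,
    ⟨x, rfl⟩, I, hI, fun _ _ _ => Iff.rfl⟩

theorem mem_support_triangleSheaf {A : TopCommRingCat.{u}} {hA : IsAdmissibleRing A} {I : Ideal A}
    (hI : IsOpen (I : Set A)) (p : SpfPoint A) :
    p ∈ (triangleSheaf A hA I).support ↔ I ≤ p.1.asIdeal := by
  constructor
  · intro h
    by_contra hp
    let U : Opens (top A) := ⟨{q | ¬ I ≤ q.1.asIdeal},
      ((PrimeSpectrum.isClosed_zeroLocus (I : Set A)).isOpen_compl).preimage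
        continuous_subtype_val⟩
    refine h U hp fun K hK => ?_
    have := SpecSections.subsingleton (U := openOf U K) fun q hq => hq (hK.trans (le_ofSpec K q))
    exact Subsingleton.elim _ _
  · intro hp U hpU h
    obtain ⟨q, hq⟩ := exists_ofSpec_eq (J := ⟨I, hI⟩) (p := p) hp
    subst hq
    have := SpecSections.nontrivial (U := openOf U ⟨I, hI⟩) q hpU
    exact one_ne_zero (h ⟨I, hI⟩ le_rfl)

/-! ### Basic open subsets and formal spectra of discrete rings -/

variable {A : Type u} [CommRing A] [TopologicalSpace A]

/-- The basic open subset of the formal spectrum given by an element of the ring. -/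
def basicOpen (g : A) : Opens (top A) :=
  ⟨{p | g ∉ p.1.asIdeal}, (PrimeSpectrum.basicOpen g).2.preimage continuous_subtype_val⟩

theorem isBasis_basicOpen : Opens.IsBasis (Set.range (basicOpen : A → Opens (top A))) := by
  refine Opens.isBasis_iff_nbhd.mpr fun {U p} hp => ?_
  obtain ⟨V, hV, hUV⟩ := U.2
  have hpV : p.1 ∈ (⟨V, hV⟩ : Opens (PrimeSpectrum A)) := by
    change p ∈ Subtype.val ⁻¹' V
    rw [hUV]
    exact hp
  obtain ⟨_, ⟨g, rfl⟩, hpg, hg⟩ :=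
    Opens.isBasis_iff_nbhd.mp PrimeSpectrum.isBasis_basic_opens hpV
  refine ⟨basicOpen g, ⟨g, rfl⟩, hpg, fun q hq => ?_⟩
  have : q ∈ Subtype.val ⁻¹' V := hg hq
  rwa [hUV] at this

theorem continuous_mk (J : OpenIdeal A) : Continuous (Ideal.Quotient.mk J.1) :=
  continuous_quot_mk

theorem bijective_quotientMap {B : Type u} [CommRing B] [TopologicalSpace B] {φ : A →+* B}
    (hφ : Continuous φ) (hs : Function.Surjective φ) (K : OpenIdeal B) :
    Function.Bijective (quotientMap hφ K) :=
  ⟨Ideal.quotientMap_injective, Ideal.quotientMap_surjective hs⟩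

theorem isEmbedding_mapPoint {B : Type u} [CommRing B] [TopologicalSpace B] {φ : A →+* B}
    (hφ : Continuous φ) (hs : Function.Surjective φ) : Topology.IsEmbedding (mapPoint hφ) := by
  refine Topology.IsEmbedding.of_comp (continuous_mapPoint hφ) continuous_subtype_val ?_
  exact (PrimeSpectrum.isClosedEmbedding_comap_of_surjective _ _ hs).isEmbedding.comp
    Topology.IsEmbedding.subtypeVal

theorem range_mapPoint {B : Type u} [CommRing B] [TopologicalSpace B] [DiscreteTopology B]
    {φ : A →+* B} (hφ : Continuous φ) (hs : Function.Surjective φ) :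
    Set.range (mapPoint hφ) = {p | RingHom.ker φ ≤ p.1.asIdeal} := by
  ext p
  constructor
  · rintro ⟨q, rfl⟩
    exact Ideal.comap_mono bot_le
  · intro hp
    have hrange : p.1 ∈ Set.range (PrimeSpectrum.comap φ) := by
      rw [range_comap_of_surjective _ _ hs]
      exact hp
    obtain ⟨q, hq⟩ := hrange
    exact ⟨⟨q, isOpen_discrete _⟩, Subtype.ext hq⟩

variable [IsTopologicalRing A]

theorem sections_ext_bot [DiscreteTopology A] {U : Opens (top A)} {s t : sections U}
    (h : s.1 ⟨⊥, isOpen_discrete _⟩ = t.1 ⟨⊥, isOpen_discrete _⟩) : s = t :=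
  sections_ext fun _ => component_eq bot_le h

theorem discreteTopology_sections [DiscreteTopology A] {U : Opens (top A)}
    (hU : IsCompact
      (openOf U ⟨⊥, isOpen_discrete _⟩ : Set (PrimeSpectrum.Top (A ⧸ (⊥ : Ideal A))))) :
    DiscreteTopology (sections U) := by
  refine discreteTopology_of_isOpen_singleton_zero ?_
  convert isOpen_component_eq_zero _ hU
  ext s
  exact ⟨fun h => by rw [h]; rfl, fun h => sections_ext_bot h⟩

theorem isCompact_openOf_basicOpen (g : A) (J : OpenIdeal A) :
    IsCompact (openOf (basicOpen g) J : Set (PrimeSpectrum.Top (A ⧸ J.1))) :=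
  PrimeSpectrum.isCompact_basicOpen (Ideal.Quotient.mk J.1 g)

theorem isUnit_ofRing_basicOpen (g : A) : IsUnit (ofRing (basicOpen g) g) := by
  refine isUnit_iff.mpr fun p hp => ?_
  obtain ⟨J, q, rfl⟩ := exists_eq_ofSpec p
  exact (isUnitAt_iff _ q hp).mpr ((SpecSections.isUnit_algebraMap_iff _ _).mpr hp)

/-! ### Closed subschemes given by open ideals -/

theorem discreteTopology_quotient (J : OpenIdeal A) : DiscreteTopology (A ⧸ J.1) :=
  QuotientAddGroup.discreteTopology (N := J.1.toAddSubgroup) J.2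

theorem pullback_eq_zero_iff {B : Type u} [CommRing B] [TopologicalSpace B] {φ : A →+* B}
    [IsTopologicalRing B] [DiscreteTopology B] (hφ : Continuous φ) (hs : Function.Surjective φ)
    {U : Opens (top A)} (s : sections U) :
    pullback hφ U s = 0 ↔ ∀ K : OpenIdeal A, RingHom.ker φ ≤ K.1 → s.1 K = 0 := by
  constructor
  · intro h K hK
    let L : OpenIdeal B := ⟨K.1.map φ, isOpen_discrete _⟩
    have hL : comapIdeal hφ L = K := Subtype.ext ((Ideal.comap_map_of_surjective φ hs K.1).trans
      (sup_eq_left.mpr hK))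
    have hzero : (pullback hφ U s).1 L = 0 := by rw [h]; rfl
    clear_value L
    subst hL
    rw [pullback_component] at hzero
    exact SpecSections.comap_injective (bijective_quotientMap hφ hs L) _ (fun p hp => hp)
      (hzero.trans (map_zero _).symm)
  · intro h
    refine sections_ext fun L => ?_
    rw [pullback_component, h _ (Ideal.comap_mono bot_le), map_zero]
    rfl

theorem pullback_basicOpen_surjective {B : Type u} [CommRing B] [TopologicalSpace B] {φ : A →+* B}
    [IsTopologicalRing B] [DiscreteTopology B] (hφ : Continuous φ) (hs : Function.Surjective φ)
    (g : A) : Function.Surjective (pullback hφ (basicOpen g)) := by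
  intro t
  let O : OpenIdeal B := ⟨⊥, isOpen_discrete _⟩
  obtain ⟨n, a, h⟩ := SpecSections.exists_pow_mul_eq_ofRing
    (U := openOf (mapOpen hφ (basicOpen g)) O) (Ideal.Quotient.mk _ (φ g)) rfl (t.1 O)
  obtain ⟨b, rfl⟩ := Ideal.Quotient.mk_surjective a
  obtain ⟨c, rfl⟩ := hs b
  obtain ⟨v, hv⟩ := (isUnit_ofRing_basicOpen g).exists_right_inv
  refine ⟨ofRing _ c * v ^ n, sections_ext_bot ?_⟩
  have hmul : pullback hφ _ (ofRing _ c * v ^ n) * pullback hφ _ (ofRing (basicOpen g) g) ^ n =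
      ofRing _ (φ c) := by
    rw [← pullback_ofRing, ← map_pow, ← map_mul, mul_assoc, ← mul_pow, mul_comm v, hv, one_pow,
      mul_one]
  have hunit : IsUnit ((pullback hφ _ (ofRing (basicOpen g) g)).1 O ^ n) :=
    (((isUnit_ofRing_basicOpen g).map (pullback hφ _)).map (component _ O)).pow n
  refine hunit.mul_right_cancel ((congrFun (congrArg Subtype.val hmul) O).trans (h.symm.trans ?_))
  rw [pullback_ofRing]
  rfl

theorem isClosedImmersion_mapHom {A B : TopCommRingCat.{u}} [DiscreteTopology B]
    (hA : IsAdmissibleRing A) (hB : IsAdmissibleRing B) (φ : A ⟶ B)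
    (hs : Function.Surjective φ.1) : FormalScheme.IsClosedImmersion (mapHom hA hB φ) := by
  have hker : IsOpen (RingHom.ker φ.1 : Set A) := (isOpen_discrete {(0 : B)}).preimage φ.2
  refine ⟨triangleSheaf A hA (RingHom.ker φ.1), isClosed_triangleSheaf A hA _ ?_, ?_, ?_, ?_, ?_⟩
  · exact AddSubgroup.isClosed_of_isOpen (Submodule.toAddSubgroup (RingHom.ker φ.1)) hker
  · exact isEmbedding_mapPoint φ.2 hs
  · refine (range_mapPoint φ.2 hs).trans (Set.ext fun p => ?_)
    exact (mem_support_triangleSheaf hker p).symm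
  · intro U
    ext s
    exact pullback_eq_zero_iff φ.2 hs s
  · refine ⟨_, isBasis_basicOpen, ?_⟩
    rintro _ ⟨g, rfl⟩
    have : DiscreteTopology (sections (mapOpen φ.2 (basicOpen g))) :=
      discreteTopology_sections (isCompact_openOf_basicOpen (φ.1 g) _)
    exact ⟨pullback_basicOpen_surjective φ.2 hs g, continuous_pullback φ.2 _,
      fun S _ => isOpen_discrete (α := sections (mapOpen φ.2 (basicOpen g))) _⟩

end Spf

/-! ### Adic completions -/

/-- The `m`-adic completion of a ring `A`, to be equipped with the limit topology of the discrete
rings `A ⧸ m ^ n`, for which it is an admissible ring even if `m` is not finitely generated. -/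
def AdicLimit {A : Type u} [CommRing A] (m : Ideal A) : Type u :=
  AdicCompletion m A

namespace AdicLimit

variable {A : Type u} [CommRing A] (m : Ideal A)

instance : CommRing (AdicLimit m) := inferInstanceAs (CommRing (AdicCompletion m A))

/-- The projection of the completion onto its truncation modulo `m ^ n`. -/
def proj (n : ℕ) : AdicLimit m →+* A ⧸ m ^ n :=
  (AdicCompletion.evalₐ m n : AdicCompletion m A →+* A ⧸ m ^ n)

/-- The canonical homomorphism of a ring to its completion. -/
def of : A →+* AdicLimit m :=
  algebraMap A (AdicCompletion m A)

variable {m}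

theorem proj_of (n : ℕ) (a : A) : proj m n (of m a) = Ideal.Quotient.mk (m ^ n) a :=
  AdicCompletion.evalₐ_of m n a

theorem ext {x y : AdicLimit m} (h : ∀ n, proj m n x = proj m n y) : x = y :=
  AdicCompletion.ext_evalₐ h

theorem factor_proj {k n : ℕ} (h : k ≤ n) (x : AdicLimit m) :
    Ideal.Quotient.factor (Ideal.pow_le_pow_right h) (proj m n x) = proj m k x := by
  obtain ⟨a, rfl⟩ := AdicCompletion.mk_surjective m A x
  change Ideal.Quotient.factor _ (AdicCompletion.evalₐ m n _) = AdicCompletion.evalₐ m k _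
  rw [AdicCompletion.evalₐ_mk, AdicCompletion.evalₐ_mk, Ideal.Quotient.factor_mk]
  exact (AdicCompletion.Ideal.mk_eq_mk m h a)

theorem exists_proj_eq {a : ℕ → A} (ha : ∀ n, a (n + 1) - a n ∈ m ^ n) :
    ∃ x : AdicLimit m, ∀ n, proj m n x = Ideal.Quotient.mk (m ^ n) (a n) := by
  refine ⟨AdicCompletion.mk m A (.mk m A a fun n => ?_), fun n => AdicCompletion.evalₐ_mk m n _⟩
  rw [SModEq.comm, SModEq.sub_mem, smul_eq_mul, Ideal.mul_top]
  exact ha n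

instance : TopologicalSpace (AdicLimit m) := ⨅ n, TopologicalSpace.induced (proj m n) ⊥

instance : IsTopologicalRing (AdicLimit m) := by
  have hmul : ContinuousMul (AdicLimit m) := continuousMul_iInf fun n => by
    let : TopologicalSpace (A ⧸ m ^ n) := ⊥
    have : DiscreteTopology (A ⧸ m ^ n) := ⟨rfl⟩
    exact continuousMul_induced (proj m n)
  have hadd : IsTopologicalAddGroup (AdicLimit m) := topologicalAddGroup_iInf fun n => by
    let : TopologicalSpace (A ⧸ m ^ n) := ⊥
    have : DiscreteTopology (A ⧸ m ^ n) := ⟨rfl⟩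
    exact topologicalAddGroup_induced (proj m n)
  exact { }

theorem antitone_ker_proj : Antitone fun n => RingHom.ker (proj m n) := fun k n h x hx => by
  rw [RingHom.mem_ker] at hx ⊢
  rw [← factor_proj h, hx, map_zero]

theorem hasBasis_nhds_zero :
    (nhds (0 : AdicLimit m)).HasBasis (fun _ => True)
      fun n => (RingHom.ker (proj m n) : Set (AdicLimit m)) := by
  have hnhds : nhds (0 : AdicLimit m) = ⨅ n, Filter.principal (RingHom.ker (proj m n)) := by
    rw [nhds_iInf]
    refine iInf_congr fun n => ?_
    let : TopologicalSpace (A ⧸ m ^ n) := ⊥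
    have : DiscreteTopology (A ⧸ m ^ n) := ⟨rfl⟩
    rw [nhds_induced, nhds_discrete, Filter.comap_pure, map_zero]
    rfl
  rw [hnhds]
  exact Filter.hasBasis_iInf_principal
    (Antitone.directed_ge fun _ _ h => antitone_ker_proj h)

theorem isOpen_ker_proj (n : ℕ) : IsOpen (RingHom.ker (proj m n) : Set (AdicLimit m)) :=
  AddSubgroup.isOpen_of_mem_nhds (Submodule.toAddSubgroup (RingHom.ker (proj m n)))
    (hasBasis_nhds_zero.mem_of_mem trivial)

theorem exists_ker_proj_le {K : Ideal (AdicLimit m)} (hK : IsOpen (K : Set (AdicLimit m))) :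
    ∃ n, RingHom.ker (proj m n) ≤ K := by
  obtain ⟨n, -, hn⟩ := hasBasis_nhds_zero.mem_iff.mp (hK.mem_nhds K.zero_mem)
  exact ⟨n, hn⟩

theorem exists_sub_of_mem_ker (x : AdicLimit m) (n : ℕ) :
    ∃ a : A, x - of m a ∈ RingHom.ker (proj m n) := by
  obtain ⟨a, ha⟩ := Ideal.Quotient.mk_surjective (proj m n x)
  exact ⟨a, by rw [RingHom.mem_ker, map_sub, proj_of, ha, sub_self]⟩

theorem exists_sub_of_mem {K : Ideal (AdicLimit m)} (hK : IsOpen (K : Set (AdicLimit m)))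
    (x : AdicLimit m) : ∃ a : A, x - of m a ∈ K := by
  obtain ⟨n, hn⟩ := exists_ker_proj_le hK
  obtain ⟨a, ha⟩ := exists_sub_of_mem_ker x n
  exact ⟨a, hn ha⟩

theorem of_mem_ker_proj {a : A} {n : ℕ} : of m a ∈ RingHom.ker (proj m n) ↔ a ∈ m ^ n := by
  rw [RingHom.mem_ker, proj_of, Ideal.Quotient.eq_zero_iff_mem]

theorem exists_pow_le_comap {K : Ideal (AdicLimit m)} (hK : IsOpen (K : Set (AdicLimit m))) :
    ∃ n, m ^ n ≤ K.comap (of m) := by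
  obtain ⟨n, hn⟩ := exists_ker_proj_le hK
  exact ⟨n, fun a ha => hn (of_mem_ker_proj.mpr ha)⟩

theorem pow_mem_ker_proj {x : AdicLimit m} (hx : x ∈ RingHom.ker (proj m 1)) (n : ℕ) :
    x ^ n ∈ RingHom.ker (proj m n) := by
  obtain ⟨a, ha⟩ := exists_sub_of_mem_ker x (n + 1)
  have ha_mem : a ∈ m := by
    rw [← pow_one m, ← of_mem_ker_proj]
    simpa using sub_mem hx (antitone_ker_proj n.succ_pos ha)
  replace ha := antitone_ker_proj n.le_succ ha
  rw [RingHom.mem_ker, map_sub, sub_eq_zero, proj_of] at ha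
  rw [RingHom.mem_ker, map_pow, ha, ← map_pow, Ideal.Quotient.eq_zero_iff_mem]
  exact Ideal.pow_mem_pow ha_mem n

theorem isAdmissibleRing : IsAdmissibleRing (AdicLimit m) where
  exists_basis := ⟨_, antitone_ker_proj, hasBasis_nhds_zero⟩
  separated := by
    refine IsTopologicalAddGroup.t2Space_of_zero_sep fun x hx => ?_
    by_contra! h
    exact hx (ext fun n => h _ (hasBasis_nhds_zero.mem_of_mem (i := n) trivial))
  complete := by
    refine completeSpace_of_forall_exists_sub_mem hasBasis_nhds_zero fun a ha => ?_
    choose b hb using fun n => exists_sub_of_mem_ker (a n) n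
    have hb_succ : ∀ n, b (n + 1) - b n ∈ m ^ n := fun n => by
      rw [← of_mem_ker_proj]
      convert sub_mem (add_mem (ha n) (hb n)) (antitone_ker_proj n.le_succ (hb (n + 1))) using 1
      rw [map_sub]
      ring
    obtain ⟨x, hx⟩ := exists_proj_eq hb_succ
    refine ⟨x, fun n => ?_⟩
    have hxb : x - of m (b n) ∈ RingHom.ker (proj m n) := by
      rw [RingHom.mem_ker, map_sub, hx, proj_of, sub_self]
    simpa using sub_mem hxb (hb n)
  exists_idealOfDefinition :=
    ⟨RingHom.ker (proj m 1), isOpen_ker_proj 1, fun x hx =>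
      hasBasis_nhds_zero.tendsto_right_iff.mpr fun n _ => by
        filter_upwards [Filter.eventually_ge_atTop n] with k hk
        exact antitone_ker_proj hk (pow_mem_ker_proj hx k)⟩

theorem continuous_of [TopologicalSpace A] [IsTopologicalRing A]
    (hm : ∀ n, IsOpen ((m ^ n : Ideal A) : Set A)) : Continuous (of m) := by
  refine continuous_iInf_rng.mpr fun n => continuous_induced_rng.mpr ?_
  refine @continuous_of_isOpen_of_sub_mem _ _ _ _ _ ⊥ _ (hm n) _ fun a b hab => ?_
  exact Ideal.Quotient.eq.mpr hab

theorem comap_of_eq [hm : m.IsMaximal] {K : Ideal (AdicLimit m)} [hK : K.IsPrime]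
    (hK' : IsOpen (K : Set (AdicLimit m))) : K.comap (of m) = m := by
  obtain ⟨n, hn⟩ := exists_pow_le_comap hK'
  have hp : (K.comap (of m)).IsPrime := Ideal.comap_isPrime _ _
  exact (hm.eq_of_le hp.ne_top (hp.le_of_pow_le hn)).symm

theorem subsingleton_spfPoint [m.IsMaximal] : Subsingleton (SpfPoint (AdicLimit m)) := by
  have hle : ∀ p q : SpfPoint (AdicLimit m), p.1.asIdeal ≤ q.1.asIdeal := fun p q x hx => by
    obtain ⟨a, ha⟩ := exists_sub_of_mem (K := p.1.asIdeal ⊓ q.1.asIdeal) (p.2.inter q.2) x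
    have hap : a ∈ p.1.asIdeal.comap (of m) := by simpa using sub_mem hx ha.1
    have haq : a ∈ q.1.asIdeal.comap (of m) := by rwa [comap_of_eq q.2, ← comap_of_eq p.2]
    simpa using add_mem ha.2 haq
  exact ⟨fun p q => Subtype.ext (PrimeSpectrum.ext (le_antisymm (hle p q) (hle q p)))⟩

theorem nonempty_spfPoint [hm : m.IsMaximal] : Nonempty (SpfPoint (AdicLimit m)) := by
  have h : (m ^ 1).IsPrime := by
    rw [pow_one]
    exact hm.isPrime
  exact ⟨⟨⟨RingHom.ker (proj m 1), RingHom.ker_isPrime _⟩, isOpen_ker_proj 1⟩⟩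

end AdicLimit

/-! ### A pseudo-immersion that is not an immersion -/

theorem le_of_isAdic_of_isOpen {A : Type u} [CommRing A] [TopologicalSpace A]
    [IsTopologicalRing A] {I p : Ideal A} [hp : p.IsPrime] (hI : IsAdic I)
    (hpo : IsOpen (p : Set A)) : I ≤ p := by
  obtain ⟨n, -, hn⟩ := hI.hasBasis_nhds_zero.mem_iff.mp (hpo.mem_nhds p.zero_mem)
  exact hp.le_of_pow_le hn

namespace Spf

theorem exists_pow_le_of_isOpenMap_pullback {A : Type u} [CommRing A] [TopologicalSpace A]
    [IsTopologicalRing A] [IsNoetherianRing A] {m I : Ideal A} [m.IsMaximal]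
    (hI : IsOpen (I : Set A)) (hφ : Continuous (AdicLimit.of m)) {U : Opens (top A)}
    (hU : ∀ q, mapPoint hφ q ∈ U) (h : IsOpenMap (pullback hφ U)) :
    ∃ n, m ^ n ≤ m ^ (n + 1) ⊔ I := by
  have htop : ∀ K, openOf (mapOpen hφ U) K = ⊤ := fun K => eq_top_iff.mpr fun q _ => hU (ofSpec K q)
  have hN : IsOpen {s : sections U | s.1 ⟨I, hI⟩ = 0} :=
    isOpen_component_eq_zero ⟨I, hI⟩ (NoetherianSpace.isCompact (α := PrimeSpectrum (A ⧸ I)) _)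
  obtain ⟨J, hJ⟩ := exists_openIdeal_of_mem_nhds ((h _ hN).mem_nhds ⟨0, rfl, map_zero _⟩)
  obtain ⟨n, hn⟩ := AdicLimit.exists_pow_le_comap J.2
  refine ⟨n, fun a ha => ?_⟩
  have hzero : (ofRing (mapOpen hφ U) (AdicLimit.of m a)).1 J = 0 :=
    (ofRing_component_eq_zero_iff (htop J) _).mpr (hn ha)
  obtain ⟨s, hs, hsa⟩ := hJ _ hzero
  let K : OpenIdeal (AdicLimit m) :=
    ⟨((m ^ (n + 1) ⊔ I).map (Ideal.Quotient.mk (m ^ (n + 1)))).comap (AdicLimit.proj m (n + 1)),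
      isOpen_ideal_of_le (Ideal.comap_mono bot_le) (AdicLimit.isOpen_ker_proj (n + 1))⟩
  have hK : (comapIdeal hφ K).1 = m ^ (n + 1) ⊔ I := by
    change ((m ^ (n + 1) ⊔ I).map (Ideal.Quotient.mk (m ^ (n + 1)))).comap
      (Ideal.Quotient.mk (m ^ (n + 1))) = _
    rw [Ideal.comap_map_of_surjective _ Ideal.Quotient.mk_surjective]
    refine sup_eq_left.mpr (le_trans ?_ le_sup_left)
    rw [← RingHom.ker_eq_comap_bot, Ideal.mk_ker]
  have hsK : (pullback hφ U s).1 K = 0 := by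
    rw [pullback_component, component_eq_zero (J := ⟨I, hI⟩) (le_sup_right.trans hK.ge) hs,
      map_zero]
  rw [hsa, ofRing_component_eq_zero_iff (htop K)] at hsK
  rw [← hK]
  exact hsK

theorem isOpen_singleton_of_pow_le {A : Type u} [CommRing A] [TopologicalSpace A]
    [IsTopologicalRing A] [IsNoetherianRing A] {I : Ideal A} (x : SpfPoint A)
    (hI : ∀ p : SpfPoint A, I ≤ p.1.asIdeal) (hx : x.1.asIdeal.IsMaximal) {n : ℕ}
    (h : x.1.asIdeal ^ n ≤ x.1.asIdeal ^ (n + 1) ⊔ I) : IsOpen {x} := by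
  obtain ⟨r, hr, hle⟩ := Submodule.exists_sub_one_mem_and_smul_le_of_fg_of_le_sup
    (I := x.1.asIdeal) (N := I) (N' := x.1.asIdeal ^ n) (P := x.1.asIdeal ^ n)
    (IsNoetherian.noetherian _) le_rfl (by rwa [smul_eq_mul, ← pow_succ', sup_comm])
  convert (basicOpen r).2 using 1
  ext p
  constructor
  · rintro rfl hp
    refine hx.ne_top ((Ideal.eq_top_iff_one _).mpr ?_)
    simpa using sub_mem hp hr
  · intro hp
    have hpow : x.1.asIdeal ^ n ≤ p.1.asIdeal := fun a ha =>
      (p.1.isPrime.mem_or_mem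
        (hI p (hle (Submodule.smul_mem_pointwise_smul a r _ ha)))).resolve_left hp
    exact Subtype.ext (PrimeSpectrum.ext
      (hx.eq_of_le p.1.isPrime.ne_top (p.1.isPrime.le_of_pow_le hpow)).symm)

end Spf

namespace FormalScheme

variable {X Y Z : FormalScheme.{u}}

theorem res_eq_zero_iff {U V : Opens X.carrier} (h : V ≤ U) (h' : U ≤ V) (s : X.sections U) :
    X.res h s = 0 ↔ s = 0 := by
  refine ⟨fun hs => ?_, fun hs => by rw [hs, map_zero]⟩
  rw [← res_self le_rfl s, ← res_res h h', hs, map_zero]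

theorem IsOrdinary.discreteTopology_sections (hZ : Z.IsOrdinary) [Subsingleton Z.carrier]
    (V : Opens Z.carrier) : DiscreteTopology (Z.sections V) := by
  rcases V.1.eq_empty_or_nonempty with hV | ⟨z, hz⟩
  · have : Subsingleton (Z.sections V) := subsingleton_sections (Opens.ext hV)
    infer_instance
  obtain ⟨c, hzc, _⟩ := hZ z
  have hVc : V ≤ c.range := fun w _ => Subsingleton.elim z w ▸ hzc
  have htop : (Opens.map c.map.base).obj V = ⊤ :=
    eq_top_iff.mpr fun p _ => show c.map.base p ∈ V from Subsingleton.elim z (c.map.base p) ▸ hz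
  have hd : DiscreteTopology (Spf.sections (A := c.ring) ((Opens.map c.map.base).obj V)) := by
    refine Spf.discreteTopology_sections ?_
    rw [htop]
    exact isCompact_univ (X := PrimeSpectrum (c.ring ⧸ (⊥ : Ideal c.ring)))
  have h := (c.isHomeomorph_app hVc).isEmbedding
  exact @Topology.IsEmbedding.discreteTopology _ _ _ _ _ hd h

theorem nontrivial_sections {U : Opens X.carrier} {x : X.carrier} (hx : x ∈ U) :
    Nontrivial (X.sections U) := by
  obtain ⟨c, p, rfl⟩ := X.exists_chart x
  have := Spf.nontrivial_sections (U := (Opens.map c.map.base).obj U) p hx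
  exact RingHom.domain_nontrivial
    (show X.sections U →+* Spf.sections (A := c.ring) ((Opens.map c.map.base).obj U) from
      (c.map.c.app (op U)).1)

section OnePoint

variable {A : TopCommRingCat.{u}} {hA : IsAdmissibleRing A} (f : Z ⟶ Spf.formalScheme A hA)

/-- The map on points of a morphism to a formal spectrum. -/
def spfBase : Z.carrier → SpfPoint A :=
  f.hom.base

/-- The inverse image under a morphism to a formal spectrum. -/
def spfPreimage (U : Opens (Spf.top A)) : Opens Z.carrier :=
  Hom.preimage f U

/-- The comorphism of a morphism to a formal spectrum, as a map out of the explicit sections. -/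
def spfApp (U : Opens (Spf.top A)) : Spf.sections U →+* Z.sections (spfPreimage f U) :=
  Hom.app f U

theorem continuous_spfApp (U : Opens (Spf.top A)) : Continuous (spfApp f U) :=
  (f.hom.c.app (op U)).2

/-- The kernel of the homomorphism from a ring `A` to the global sections of a formal scheme over
`Spf A`. For a closed immersion of a one-point scheme it is the ideal of the image. -/
def kerOfRing : Ideal A :=
  RingHom.ker ((spfApp f ⊤).comp (Spf.ofRing ⊤))

variable {f} {U : Opens (Spf.top A)}

theorem spfPreimage_mono {V : Opens (Spf.top A)} (h : V ≤ U) : spfPreimage f V ≤ spfPreimage f U :=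
  fun _ hz => h hz

theorem spfApp_ofRing (a : A) :
    spfApp f U (Spf.ofRing U a) =
      Z.res (spfPreimage_mono le_top) (spfApp f ⊤ (Spf.ofRing ⊤ a)) :=
  app_res f (U := (⊤ : Opens (Spf.top A))) (V := U) (fun _ _ => trivial) (Spf.ofRing ⊤ a)

theorem spfApp_ofRing_eq_zero_iff (hU : ∀ z, spfBase f z ∈ U) (a : A) :
    spfApp f U (Spf.ofRing U a) = 0 ↔ a ∈ kerOfRing f := by
  have hle : spfPreimage f ⊤ ≤ spfPreimage f U := fun z _ => hU z
  rw [spfApp_ofRing, res_eq_zero_iff _ hle]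
  rfl

theorem kerOfRing_le (z : Z.carrier) : kerOfRing f ≤ (spfBase f z).1.asIdeal := fun a ha => by
  by_contra hz
  have := nontrivial_sections (show z ∈ spfPreimage f (Spf.basicOpen a) from hz)
  refine ((Spf.isUnit_ofRing_basicOpen a).map (spfApp f (Spf.basicOpen a))).ne_zero ?_
  rw [spfApp_ofRing, show spfApp f ⊤ (Spf.ofRing ⊤ a) = 0 from ha, map_zero]

variable {K : OpenIdeal A}

theorem le_kerOfRing (hzero : ∀ s : Spf.sections ⊤, s.1 K = 0 → spfApp f ⊤ s = 0) :
    K.1 ≤ kerOfRing f := fun _ ha =>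
  hzero _ ((Spf.ofRing_component_eq_zero_iff rfl _).mpr ha)

theorem spfApp_eq_zero_iff_mem_triangle (hU : ∀ z, spfBase f z ∈ U)
    (hK : ∀ p : SpfPoint A, K.1 ≤ p.1.asIdeal → p ∈ Set.range (spfBase f))
    (hzero : ∀ s : Spf.sections U, s.1 K = 0 → spfApp f U s = 0) (hle : K.1 ≤ kerOfRing f)
    (s : Spf.sections U) : spfApp f U s = 0 ↔ s ∈ triangle (kerOfRing f) U := by
  have htop : ∀ L : OpenIdeal A, K.1 ≤ L.1 → Spf.openOf U L = ⊤ := fun L hL =>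
    eq_top_iff.mpr fun q _ => by
      obtain ⟨z, hz⟩ := hK (Spf.ofSpec L q) (hL.trans (Spf.le_ofSpec L q))
      change Spf.ofSpec L q ∈ U
      exact hz ▸ hU z
  let I : OpenIdeal A := ⟨kerOfRing f, isOpen_ideal_of_le hle K.2⟩
  obtain ⟨a, ha⟩ := Spf.exists_ofRing_component_eq (htop K le_rfl) s
  have happ : spfApp f U s = spfApp f U (Spf.ofRing U a) := by
    rw [← sub_eq_zero, ← map_sub]
    exact hzero _ (sub_eq_zero.mpr ha)
  have hcomponent : s.1 I = 0 ↔ a ∈ kerOfRing f := by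
    rw [Spf.component_eq (K := I) hle ha]
    exact Spf.ofRing_component_eq_zero_iff (htop I hle) a
  rw [happ, spfApp_ofRing_eq_zero_iff hU, ← hcomponent]
  exact ⟨fun h L hL => Spf.component_eq_zero hL h, fun h => h I le_rfl⟩

theorem isClosedImmersion_of_component_eq_zero [Subsingleton Z.carrier]
    (hdiscrete : ∀ V, DiscreteTopology (Z.sections V))
    (hK : ∀ p : SpfPoint A, K.1 ≤ p.1.asIdeal → p ∈ Set.range (spfBase f))
    (hzero : ∀ U : Opens (Spf.top A), (∀ z, spfBase f z ∈ U) →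
      ∀ s : Spf.sections U, s.1 K = 0 → spfApp f U s = 0)
    (hsurj : ∀ U : Opens (Spf.top A), (∀ z, spfBase f z ∈ U) →
      Function.Surjective (spfApp f U)) : IsClosedImmersion f := by
  have hle : K.1 ≤ kerOfRing f := le_kerOfRing (hzero ⊤ fun _ => trivial)
  have hopen : IsOpen (kerOfRing f : Set A) := isOpen_ideal_of_le hle K.2
  have hrange : ∀ p : SpfPoint A, p ∈ Set.range (spfBase f) ↔ kerOfRing f ≤ p.1.asIdeal := fun p =>
    ⟨by rintro ⟨z, rfl⟩; exact kerOfRing_le z, fun hp => hK p (hle.trans hp)⟩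
  have hbot : ∀ U : Opens (Spf.top A), ¬(∀ z, spfBase f z ∈ U) →
      Subsingleton (Z.sections (spfPreimage f U)) := fun U hU =>
    subsingleton_sections (eq_bot_iff.mpr fun w hw => hU fun z => Subsingleton.elim w z ▸ hw)
  refine ⟨Spf.triangleSheaf A hA (kerOfRing f), Spf.isClosed_triangleSheaf A hA _ ?_,
    .of_subsingleton _, ?_, fun U => ?_, Set.univ, Opens.isBasis_iff_nbhd.mpr ?_, fun U _ => ?_⟩
  · exact AddSubgroup.isClosed_of_isOpen (Submodule.toAddSubgroup (kerOfRing f)) hopen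
  · exact Set.ext fun p => (hrange p).trans (Spf.mem_support_triangleSheaf hopen p).symm
  · ext s
    by_cases hU : ∀ z, spfBase f z ∈ U
    · exact spfApp_eq_zero_iff_mem_triangle hU hK (hzero U hU) hle s
    · refine ⟨fun _ L hL => ?_, fun _ => (hbot U hU).elim _ _⟩
      have := SpecSections.subsingleton (U := Spf.openOf U L) fun q hq => hU fun z => by
        obtain ⟨w, hw⟩ := (hrange _).mpr (hL.trans (Spf.le_ofSpec L q))
        rw [Subsingleton.elim z w, hw]
        exact hq
      exact Subsingleton.elim _ _
  · exact fun {U x} hx => ⟨U, trivial, hx, le_rfl⟩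
  · have hsurjU : Function.Surjective (spfApp f U) := by
      by_cases hU : ∀ z, spfBase f z ∈ U
      · exact hsurj U hU
      · have := hbot U hU
        exact fun t => ⟨0, Subsingleton.elim _ _⟩
    have := hdiscrete (spfPreimage f U)
    exact ⟨hsurjU, continuous_spfApp f U,
      fun S _ => isOpen_discrete (α := Z.sections (spfPreimage f U)) _⟩

end OnePoint

section Dense

variable {A B : TopCommRingCat.{u}} {hA : IsAdmissibleRing A} {hB : IsAdmissibleRing B} {φ : A ⟶ B}
  {i : Z ⟶ Spf.formalScheme B hB}

theorem spfApp_comp_mapHom_surjective {K : OpenIdeal B} {U : Opens (Spf.top A)}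
    (hdense : ∀ b : B, ∃ a : A, b - φ.1 a ∈ K.1) (htop : Spf.openOf (Spf.mapOpen φ.2 U) K = ⊤)
    (hsurj : Function.Surjective (spfApp i (Spf.mapOpen φ.2 U)))
    (hzero : ∀ t : Spf.sections (Spf.mapOpen φ.2 U),
      t.1 K = 0 → spfApp i (Spf.mapOpen φ.2 U) t = 0) :
    Function.Surjective (spfApp (i ≫ Spf.mapHom hA hB φ) U) := fun t => by
  obtain ⟨t, rfl⟩ := hsurj t
  obtain ⟨b, hb⟩ := Spf.exists_ofRing_component_eq htop t
  obtain ⟨a, ha⟩ := hdense b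
  refine ⟨Spf.ofRing U a, ?_⟩
  suffices spfApp i (Spf.mapOpen φ.2 U) (Spf.pullback φ.2 U (Spf.ofRing U a)) = spfApp i _ t from
    this
  rw [Spf.pullback_ofRing, eq_comm]
  refine sub_eq_zero.mp ((map_sub (spfApp i (Spf.mapOpen φ.2 U)) _ _).symm.trans (hzero _ ?_))
  have hcomponent := (Spf.ofRing_component_eq_zero_iff htop (b - φ.1 a)).mpr ha
  rw [map_sub] at hcomponent
  rw [← hcomponent]
  exact congrArg (· - (Spf.ofRing (Spf.mapOpen φ.2 U) (φ.1 a)).1 K) hb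

theorem exists_openIdeal_spfApp_eq_zero {U : Opens (Spf.top B)}
    [DiscreteTopology (Z.sections (spfPreimage i U))] :
    ∃ K : OpenIdeal B, ∀ t : Spf.sections U, t.1 K = 0 → spfApp i U t = 0 := by
  refine Spf.exists_openIdeal_of_mem_nhds (N := {t | spfApp i U t = 0}) ?_
  exact ((isOpen_discrete {0}).preimage (continuous_spfApp i U)).mem_nhds (map_zero _)

theorem isClosedImmersion_comp_mapHom [Subsingleton (SpfPoint B)]
    (hdense : ∀ (K : OpenIdeal B) (b : B), ∃ a : A, b - φ.1 a ∈ K.1)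
    (hpoint : ∀ (K : OpenIdeal B) (p : SpfPoint A) (q : SpfPoint B),
      (Spf.comapIdeal φ.2 K).1 ≤ p.1.asIdeal → p = Spf.mapPoint φ.2 q)
    (hZ : Z.IsOrdinary) (hi : IsImmersion i) : IsClosedImmersion (i ≫ Spf.mapHom hA hB φ) := by
  have : Subsingleton Z.carrier := hi.isEmbedding.injective.subsingleton (β := SpfPoint B)
  have hdiscrete := hZ.discreteTopology_sections
  rcases isEmpty_or_nonempty Z.carrier with hempty | ⟨⟨z⟩⟩
  · have hsub : ∀ V : Opens Z.carrier, Subsingleton (Z.sections V) := fun V =>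
      subsingleton_sections (eq_bot_iff.mpr fun z _ => isEmptyElim z)
    exact isClosedImmersion_of_component_eq_zero (K := ⟨⊤, isOpen_univ⟩) hdiscrete
      (fun p hp => (p.1.isPrime.ne_top (top_le_iff.mp hp)).elim)
      (fun _ _ _ _ => (hsub _).elim _ _) fun _ _ _ => ⟨0, (hsub _).elim _ _⟩
  have htop : ∀ V : Opens (Spf.top B), spfBase i z ∈ V → V = ⊤ := fun V hV =>
    eq_top_iff.mpr fun w _ => Subsingleton.elim (spfBase i z) w ▸ hV
  obtain ⟨K, hK⟩ := exists_openIdeal_spfApp_eq_zero (i := i) (U := ⊤)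
  have hzero : ∀ V, spfBase i z ∈ V → ∀ t : Spf.sections V, t.1 K = 0 → spfApp i V t = 0 :=
    fun V hV => by
      obtain rfl := htop V hV
      exact hK
  refine isClosedImmersion_of_component_eq_zero (K := Spf.comapIdeal φ.2 K) hdiscrete
    (fun p hp => ⟨z, (hpoint K p (spfBase i z) hp).symm⟩) (fun U hU s hs => ?_) fun U hU => ?_
  · refine hzero (Spf.mapOpen φ.2 U) (hU z) (Spf.pullback φ.2 U s) ?_
    rw [Spf.pullback_component, hs, map_zero]
  · have hz : spfBase i z ∈ Spf.mapOpen φ.2 U := hU z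
    obtain ⟨V, -, hV, hquot⟩ := hi.exists_isOpenQuotientMap z _ hz
    obtain rfl : V = Spf.mapOpen φ.2 U := (htop V hV).trans (htop _ hz).symm
    refine spfApp_comp_mapHom_surjective (hdense K) ?_ hquot.surjective (hzero _ hz)
    rw [htop _ hz]
    rfl

end Dense

/-- The homomorphism from `A` to its completion at `m`, as a morphism of topological rings. -/
def adicCompletionHom {A : TopCommRingCat.{u}} {m : Ideal A} (h : Continuous (AdicLimit.of m)) :
    A ⟶ TopCommRingCat.of (AdicLimit m) :=
  ⟨AdicLimit.of m, h⟩

-- An ordinary subscheme of `Spf` of the completion at `m` lies in some `Spec A / m ^ n`, which is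
-- also a closed subscheme of `Spf A`.
theorem isPseudoImmersion_adicCompletion (c : AffineChart X.toPresheafedSpace)
    [IsNoetherianRing c.ring] {m : Ideal c.ring} [hm : m.IsMaximal]
    (h : Continuous (AdicLimit.of m)) :
    IsPseudoImmersion (Spf.mapHom c.isAdmissible AdicLimit.isAdmissibleRing
      (adicCompletionHom h) ≫ chartHom c) := fun Z i hZ hi => by
  have : Subsingleton (SpfPoint (AdicLimit m)) := AdicLimit.subsingleton_spfPoint
  rw [← Category.assoc]
  refine IsClosedImmersion.isImmersion_comp_chartHom c ?_
  refine isClosedImmersion_comp_mapHom (fun K b => AdicLimit.exists_sub_of_mem K.2 b)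
    (fun K p q hKp => Subtype.ext (PrimeSpectrum.ext ?_)) hZ hi
  obtain ⟨n, hn⟩ := AdicLimit.exists_pow_le_comap K.2
  have hmp : m = p.1.asIdeal :=
    hm.eq_of_le p.1.isPrime.ne_top (p.1.isPrime.le_of_pow_le (hn.trans hKp))
  exact hmp.symm.trans (AdicLimit.comap_of_eq q.2).symm

theorem isOpen_singleton_of_isImmersion_adicCompletion (c : AffineChart X.toPresheafedSpace)
    [IsNoetherianRing c.ring] {I : Ideal c.ring} (hI : IsAdic I) {x : SpfPoint c.ring}
    [hx : x.1.asIdeal.IsMaximal] (h : Continuous (AdicLimit.of x.1.asIdeal))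
    (himm : IsImmersion (Spf.mapHom c.isAdmissible AdicLimit.isAdmissibleRing
      (adicCompletionHom h) ≫ chartHom c)) : IsOpen {x} := by
  have : Subsingleton (SpfPoint (AdicLimit x.1.asIdeal)) := AdicLimit.subsingleton_spfPoint
  obtain ⟨q⟩ : Nonempty (SpfPoint (AdicLimit x.1.asIdeal)) := AdicLimit.nonempty_spfPoint
  obtain ⟨U, hU, hxU, hq⟩ := himm.exists_isOpenQuotientMap q c.range ⟨_, rfl⟩
  have hopen : IsOpenMap (Spf.pullback h ((Opens.map c.map.base).obj U)) := by
    have happ := c.isHomeomorph_app hU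
    exact happ.homeomorph.comp_isOpenMap_iff'.mp hq.isOpenMap
  have hIopen : IsOpen (I : Set c.ring) := by simpa using (isAdic_iff.mp hI).1 1
  obtain ⟨n, hn⟩ := Spf.exists_pow_le_of_isOpenMap_pullback hIopen h
    (fun q' => show _ from Subsingleton.elim q q' ▸ hxU) hopen
  exact Spf.isOpen_singleton_of_pow_le x
    (fun p => le_of_isAdic_of_isOpen (hp := p.1.isPrime) hI p.2) hx hn

theorem discreteTopology_of_isImmersion (hX : X.IsNoetherian)
    (h : ∀ (Y : FormalScheme.{u}) (f : Y ⟶ X), IsPseudoImmersion f → IsImmersion f) :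
    DiscreteTopology X.carrier := by
  refine discreteTopology_iff_isOpen_singleton.mpr fun x₀ => ?_
  obtain ⟨c, ⟨p, rfl⟩, hN, I, hI⟩ := hX.exists_chart x₀
  obtain ⟨m, hm, hpm⟩ := p.1.asIdeal.exists_le_maximal p.1.isPrime.ne_top
  let x : SpfPoint c.ring := ⟨⟨m, hm.isPrime⟩, isOpen_ideal_of_le hpm p.2⟩
  have : x.1.asIdeal.IsMaximal := hm
  have hIm : I ≤ m := le_of_isAdic_of_isOpen hI x.2
  have hof : Continuous (AdicLimit.of m) := AdicLimit.continuous_of fun n =>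
    isOpen_ideal_of_le (Ideal.pow_right_mono hIm n) ((isAdic_iff.mp hI).1 n)
  have hx : IsOpen {x} := isOpen_singleton_of_isImmersion_adicCompletion c hI hof
    (h _ _ (isPseudoImmersion_adicCompletion c hof))
  have hpx : p ⤳ x := Topology.IsInducing.subtypeVal.specializes_iff.mp
    ((PrimeSpectrum.le_iff_specializes p.1 x.1).mp hpm)
  rw [show p = x from hpx.mem_open hx rfl]
  exact (congrArg IsOpen Set.image_singleton).mp (c.isOpenImmersion.base_open.isOpenMap _ hx)

end FormalScheme

/-! ### Chains of open ideals in complete rings with Artinian quotients -/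

theorem exists_seq_of_forall_exists {α : Type*} {P : ℕ → α → Prop} {R : ℕ → α → α → Prop}
    {a : α} (ha : P 0 a) (hstep : ∀ n a, P n a → ∃ b, P (n + 1) b ∧ R n a b) :
    ∃ u : ℕ → α, u 0 = a ∧ (∀ n, P n (u n)) ∧ ∀ n, R n (u n) (u (n + 1)) := by
  choose! next hP hR using hstep
  let u : ℕ → α := fun n => Nat.rec a next n
  have hu : ∀ n, P n (u n) := fun n => Nat.rec ha (fun n hn => hP n (u n) hn) n
  exact ⟨u, rfl, hu, fun n => hR n (u n) (hu n)⟩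

section Chevalley

variable {A : Type u} [CommRing A] {𝔞 I : ℕ → Ideal A}

/-- Completeness for a descending chain of ideals: a sequence whose `n`-th difference lies in
`𝔞 n` has a limit. The limit is not required to be unique. -/
def IsCompleteChain (𝔞 : ℕ → Ideal A) : Prop :=
  ∀ a : ℕ → A, (∀ n, a (n + 1) - a n ∈ 𝔞 n) → ∃ x, ∀ n, x - a n ∈ 𝔞 n

theorem IsCompleteChain.add_left (h : IsCompleteChain 𝔞) (k : ℕ) :
    IsCompleteChain fun n => 𝔞 (k + n) := fun a ha => by
  obtain ⟨x, hx⟩ := h (fun n => a (n - k)) fun n => by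
    rcases lt_or_ge n k with hn | hn
    · simp [Nat.sub_eq_zero_of_le hn.le, Nat.sub_eq_zero_of_le hn]
    · obtain ⟨j, rfl⟩ := Nat.exists_eq_add_of_le hn
      simpa [add_assoc] using ha j
  exact ⟨x, fun n => by simpa using hx (k + n)⟩

theorem exists_forall_sup_le_sup (hI : Antitone I) (J : Ideal A) [IsArtinianRing (A ⧸ J)] :
    ∃ n, ∀ m, I n ⊔ J ≤ I m ⊔ J := by
  let F : ℕ →o (Ideal (A ⧸ J))ᵒᵈ :=
    ⟨fun n => OrderDual.toDual ((I n).map (Ideal.Quotient.mk J)),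
      fun i j h => Ideal.map_mono (hI h)⟩
  obtain ⟨n, hn⟩ := IsArtinian.monotone_stabilizes F
  refine ⟨n, fun m => ?_⟩
  rcases le_total n m with hnm | hmn
  · have hmap : (I n).map (Ideal.Quotient.mk J) = (I m).map (Ideal.Quotient.mk J) := hn m hnm
    have hcomap := congrArg (Ideal.comap (Ideal.Quotient.mk J)) hmap
    simp only [Ideal.comap_map_of_surjective _ Ideal.Quotient.mk_surjective,
      ← RingHom.ker_eq_comap_bot, Ideal.mk_ker] at hcomap
    exact hcomap.le
  · exact sup_le_sup_right (hI hmn) J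

theorem exists_mem_iInf_sub_mem (hart : ∀ k, IsArtinianRing (A ⧸ 𝔞 k))
    (hc : IsCompleteChain 𝔞) (hI : Antitone I) (hIo : ∀ n, ∃ k, 𝔞 k ≤ I n) :
    ∃ n, ∀ a ∈ I n, ∃ x ∈ ⨅ n, I n, x - a ∈ 𝔞 0 := by
  choose N hN using fun k => exists_forall_sup_le_sup hI (𝔞 k)
  let Q : ℕ → Ideal A := fun k => I (N k) ⊔ 𝔞 k
  have hstep : ∀ k, ∀ a ∈ Q k, ∃ b ∈ Q (k + 1), b - a ∈ 𝔞 k := fun k a ha => by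
    obtain ⟨b, hb, c, hc, rfl⟩ := Submodule.mem_sup.mp (hN k (N (k + 1)) ha)
    exact ⟨b, Submodule.mem_sup_left hb, by simpa using hc⟩
  refine ⟨N 0, fun a ha => ?_⟩
  obtain ⟨u, rfl, huQ, hu⟩ := exists_seq_of_forall_exists
    (show a ∈ Q 0 from Submodule.mem_sup_left ha) hstep
  obtain ⟨x, hx⟩ := hc u hu
  refine ⟨x, Ideal.mem_iInf.mpr fun n => ?_, hx 0⟩
  obtain ⟨k, hk⟩ := hIo n
  have huI : u k ∈ I n := sup_le le_rfl hk (hN k n (huQ k))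
  exact (Submodule.sub_mem_iff_left _ huI).mp (hk (hx k))

theorem exists_le_sup_iInf (h𝔞 : Antitone 𝔞) (hart : ∀ k, IsArtinianRing (A ⧸ 𝔞 k))
    (hc : IsCompleteChain 𝔞) (hI : Antitone I) (hIo : ∀ n, ∃ k, 𝔞 k ≤ I n) (k : ℕ) :
    ∃ n, I n ≤ 𝔞 k ⊔ ⨅ n, I n := by
  obtain ⟨n, hn⟩ := exists_mem_iInf_sub_mem (𝔞 := fun n => 𝔞 (k + n))
    (fun n => hart (k + n)) (hc.add_left k) hI fun n =>
      (hIo n).imp fun j hj => (h𝔞 (Nat.le_add_left j k)).trans hj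
  refine ⟨n, fun a ha => ?_⟩
  obtain ⟨x, hx, hxa⟩ := hn a ha
  have hax : a = -(x - a) + x := by ring
  rw [hax]
  exact add_mem (Submodule.mem_sup_left (neg_mem hxa)) (Submodule.mem_sup_right hx)

variable {S : Type*} [CommRing S] {𝔫 : ℕ → Ideal S} {β : A →+* S}

theorem exists_forall_map_mem_imp (h𝔞 : Antitone 𝔞) (hart : ∀ k, IsArtinianRing (A ⧸ 𝔞 k))
    (hc : IsCompleteChain 𝔞) (h𝔫 : Antitone 𝔫) (hsep : ⨅ n, 𝔫 n = ⊥)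
    (hcont : ∀ n, ∃ k, 𝔞 k ≤ (𝔫 n).comap β) (k : ℕ) :
    ∃ n, ∀ a, β a ∈ 𝔫 n → ∃ b ∈ 𝔞 k, β b = β a := by
  have hanti : Antitone fun n => (𝔫 n).comap β := fun i j h => Ideal.comap_mono (h𝔫 h)
  obtain ⟨n, hn⟩ := exists_le_sup_iInf h𝔞 hart hc hanti hcont k
  refine ⟨n, fun a ha => ?_⟩
  obtain ⟨b, hb, c, hc, rfl⟩ := Submodule.mem_sup.mp (hn (show a ∈ (𝔫 n).comap β from ha))
  have hβc : β c = 0 := by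
    rwa [← Ideal.comap_iInf, hsep] at hc
  exact ⟨b, hb, by rw [map_add, hβc, add_zero]⟩

theorem surjective_of_isCompleteChain (h𝔞 : Antitone 𝔞) (hart : ∀ k, IsArtinianRing (A ⧸ 𝔞 k))
    (hc : IsCompleteChain 𝔞) (h𝔫 : Antitone 𝔫) (hsep : ⨅ n, 𝔫 n = ⊥)
    (hcont : ∀ n, ∃ k, 𝔞 k ≤ (𝔫 n).comap β) (hdense : ∀ t n, ∃ a, t - β a ∈ 𝔫 n) :
    Function.Surjective β := fun t => by
  choose N hN using exists_forall_map_mem_imp h𝔞 hart hc h𝔫 hsep hcont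
  let M : ℕ → ℕ := fun k => max k (N k)
  have hstep : ∀ k a, t - β a ∈ 𝔫 (M k) → ∃ b, t - β b ∈ 𝔫 (M (k + 1)) ∧ b - a ∈ 𝔞 k :=
    fun k a ha => by
      obtain ⟨b, hb⟩ := hdense t (max (N k) (M (k + 1)))
      have hba : β (b - a) ∈ 𝔫 (N k) := by
        rw [map_sub, ← sub_sub_sub_cancel_left (β a) (β b) t]
        exact sub_mem (h𝔫 (le_max_right _ _) ha) (h𝔫 (le_max_left _ _) hb)
      obtain ⟨c, hc, hcb⟩ := hN k _ hba
      refine ⟨a + c, ?_, by rwa [add_sub_cancel_left]⟩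
      rw [map_add, hcb, ← map_add, add_sub_cancel]
      exact h𝔫 (le_max_right _ _) hb
  obtain ⟨a, ha⟩ := hdense t (M 0)
  obtain ⟨u, -, hut, hu⟩ := exists_seq_of_forall_exists ha hstep
  obtain ⟨x, hx⟩ := hc u hu
  have hxt : t - β x ∈ ⨅ n, 𝔫 n := Ideal.mem_iInf.mpr fun j => by
    obtain ⟨k, hk⟩ := hcont j
    have htu : t - β (u (max j k)) ∈ 𝔫 j :=
      h𝔫 ((le_max_left j k).trans (le_max_left _ _)) (hut (max j k))
    have hxu : β (x - u (max j k)) ∈ 𝔫 j := hk (h𝔞 (le_max_right j k) (hx _))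
    rw [map_sub] at hxu
    simpa only [sub_sub_sub_cancel_right] using sub_mem htu hxu
  rw [hsep] at hxt
  exact ⟨x, (sub_eq_zero.mp hxt).symm⟩

theorem isOpenQuotientMap_of_isCompleteChain [TopologicalSpace A] [IsTopologicalRing A]
    [TopologicalSpace S] [IsTopologicalRing S] (h𝔞 : Antitone 𝔞)
    (hb : (nhds (0 : A)).HasBasis (fun _ => True) (fun n => (𝔞 n : Set A)))
    (hart : ∀ k, IsArtinianRing (A ⧸ 𝔞 k)) (hc : IsCompleteChain 𝔞) (h𝔫 : Antitone 𝔫)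
    (hsep : ⨅ n, 𝔫 n = ⊥) (h𝔫o : ∀ n, IsOpen (𝔫 n : Set S)) (hβ : Continuous β)
    (hdense : ∀ t n, ∃ a, t - β a ∈ 𝔫 n) : IsOpenQuotientMap β := by
  have hcont : ∀ n, ∃ k, 𝔞 k ≤ (𝔫 n).comap β := fun n => by
    have hmem : β ⁻¹' (𝔫 n : Set S) ∈ nhds 0 :=
      ((h𝔫o n).preimage hβ).mem_nhds ((𝔫 n).comap β).zero_mem
    exact (hb.mem_iff.mp hmem).imp fun k hk => hk.2
  refine ⟨surjective_of_isCompleteChain h𝔞 hart hc h𝔫 hsep hcont hdense, hβ, ?_⟩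
  refine IsTopologicalAddGroup.isOpenMap_iff_nhds_zero.mpr fun N hN => ?_
  obtain ⟨k, -, hk⟩ := hb.mem_iff.mp hN
  obtain ⟨n, hn⟩ := exists_forall_map_mem_imp h𝔞 hart hc h𝔫 hsep hcont k
  refine Filter.mem_of_superset ((h𝔫o n).mem_nhds (zero_mem (𝔫 n))) fun t ht => ?_
  obtain ⟨a, rfl⟩ := surjective_of_isCompleteChain h𝔞 hart hc h𝔫 hsep hcont hdense t
  obtain ⟨b, hb, hba⟩ := hn a ht
  exact hba ▸ hk hb

end Chevalley

namespace FormalScheme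

variable {X Y Z : FormalScheme.{u}}

/-! ### The ordinary closed subschemes of a chart -/

/-- The quotient of a topological ring by an open ideal. -/
abbrev quotientRing {B : TopCommRingCat.{u}} (J : OpenIdeal B) : TopCommRingCat.{u} :=
  TopCommRingCat.of (B ⧸ J.1)

theorem discreteTopology_quotientRing {B : TopCommRingCat.{u}} (J : OpenIdeal B) :
    DiscreteTopology (quotientRing J) :=
  Spf.discreteTopology_quotient J

theorem isAdmissibleRing_quotientRing {B : TopCommRingCat.{u}} (J : OpenIdeal B) :
    IsAdmissibleRing (quotientRing J) :=
  have := discreteTopology_quotientRing J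
  IsAdmissibleRing.of_discreteTopology _

/-- The quotient map by an open ideal. -/
def quotientHom {B : TopCommRingCat.{u}} (J : OpenIdeal B) : B ⟶ quotientRing J :=
  ⟨Ideal.Quotient.mk J.1, Spf.continuous_mk J⟩

/-- The immersion of the ordinary scheme given by an open ideal of the ring of a chart. -/
def quotientImmersion (c : AffineChart X.toPresheafedSpace) (J : OpenIdeal c.ring) :
    Spf.formalScheme (quotientRing J) (isAdmissibleRing_quotientRing J) ⟶ X :=
  Spf.mapHom c.isAdmissible (isAdmissibleRing_quotientRing J) (quotientHom J) ≫ chartHom c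

theorem isImmersion_quotientImmersion (c : AffineChart X.toPresheafedSpace)
    (J : OpenIdeal c.ring) : IsImmersion (quotientImmersion c J) :=
  have := discreteTopology_quotientRing J
  (Spf.isClosedImmersion_mapHom c.isAdmissible _ (quotientHom J)
    Ideal.Quotient.mk_surjective).isImmersion_comp_chartHom c

theorem isOrdinary_formalScheme {A : TopCommRingCat.{u}} (hA : IsAdmissibleRing A)
    [DiscreteTopology A] : (Spf.formalScheme A hA).IsOrdinary := fun x =>
  ⟨⟨A, hA, 𝟙 (Spf A), (inferInstance : PresheafedSpace.IsOpenImmersion (𝟙 (Spf A)))⟩, ⟨x, rfl⟩, ‹_›⟩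

theorem IsPseudoImmersion.isImmersion_quotientImmersion_comp {f : Y ⟶ X}
    (hf : IsPseudoImmersion f) (c : AffineChart Y.toPresheafedSpace) (J : OpenIdeal c.ring) :
    IsImmersion (quotientImmersion c J ≫ f) :=
  have := discreteTopology_quotientRing J
  hf _ _ (isOrdinary_formalScheme _) (isImmersion_quotientImmersion c J)

theorem IsPseudoImmersion.discreteTopology {f : Y ⟶ X} (hf : IsPseudoImmersion f)
    [DiscreteTopology X.carrier] : DiscreteTopology Y.carrier := by
  refine discreteTopology_iff_isOpen_singleton.mpr fun y => ?_
  obtain ⟨c, p, rfl⟩ := Y.exists_chart y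
  obtain ⟨J, hJ⟩ := c.isAdmissible.exists_idealOfDefinition
  let J' : OpenIdeal c.ring := ⟨J, hJ.isOpen⟩
  have := discreteTopology_quotientRing J'
  have hquot : DiscreteTopology (SpfPoint (quotientRing J')) :=
    @Topology.IsEmbedding.discreteTopology _ X.carrier _ _ _ ‹_›
      (hf.isImmersion_quotientImmersion_comp c J').isEmbedding
  have hhomeo : IsHomeomorph (Spf.mapPoint (quotientHom J').2) := by
    refine isHomeomorph_iff_isEmbedding_surjective.mpr
      ⟨Spf.isEmbedding_mapPoint _ Ideal.Quotient.mk_surjective, fun q => ?_⟩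
    refine (Set.ext_iff.mp (Spf.range_mapPoint (quotientHom J').2
      Ideal.Quotient.mk_surjective) q).mpr ?_
    exact (show RingHom.ker (quotientHom J').1 = J from Ideal.mk_ker).le.trans (hJ.le q)
  obtain ⟨q, rfl⟩ := hhomeo.surjective p
  have hq : IsOpen {Spf.mapPoint (quotientHom J').2 q} := by
    rw [← Set.image_singleton]
    exact hhomeo.isOpenMap {q} (isOpen_discrete _)
  exact (congrArg IsOpen Set.image_singleton).mp (c.isOpenImmersion.base_open.isOpenMap _ hq)

section FieldScheme

/-- The product of the fields `κ t` for the points `t` of an open set, with the product of the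
discrete topologies. -/
def FieldSections {T : TopCat.{u}} (κ : T → Type u) (U : Opens T) : Type u := ∀ t : U, κ t.1

variable {T : TopCat.{u}} (κ : T → Type u)

instance (U : Opens T) : TopologicalSpace (FieldSections κ U) :=
  ⨅ t : U, TopologicalSpace.induced (fun s : FieldSections κ U => s t) ⊥

variable {κ} in
theorem continuous_fieldSections_iff {S : Type*} [TopologicalSpace S] {U : Opens T}
    {g : S → FieldSections κ U} :
    Continuous g ↔ ∀ t : U, @Continuous _ _ _ ⊥ fun x => g x t :=
  continuous_iInf_rng.trans (forall_congr' fun _ => continuous_induced_rng)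

variable {κ} in
theorem continuous_fieldSections_apply {U : Opens T} (t : U) :
    @Continuous _ _ _ ⊥ fun s : FieldSections κ U => s t :=
  continuous_fieldSections_iff.mp continuous_id t

variable [∀ t, Field (κ t)]

instance (U : Opens T) : CommRing (FieldSections κ U) :=
  inferInstanceAs (CommRing (∀ t : U, κ t.1))

instance (U : Opens T) : IsTopologicalRing (FieldSections κ U) :=
  let : ∀ t : U, TopologicalSpace (κ t.1) := fun _ => ⊥
  have : ∀ t : U, DiscreteTopology (κ t.1) := fun _ => ⟨rfl⟩
  inferInstanceAs (IsTopologicalRing (∀ t : U, κ t.1))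

/-- The sheaf of products of the fields `κ t`. -/
def fieldPresheaf : T.Presheaf TopCommRingCat.{u} where
  obj U := TopCommRingCat.of (FieldSections κ U.unop)
  map {U V} i := ⟨RingHom.pi fun t : V.unop =>
      Pi.evalRingHom (fun t : U.unop => κ t.1) ⟨t.1, i.unop.le t.2⟩,
    continuous_fieldSections_iff.mpr fun _ => continuous_fieldSections_apply _⟩
  map_id _ := rfl
  map_comp _ _ := rfl

theorem isSheaf_fieldPresheaf : (fieldPresheaf κ).IsSheaf := by
  refine isSheaf_of_existsUnique_gluing (fun ι U s hs => ?_) fun ι U => ?_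
  · have hs' : ∀ i j (t : T) (hi : t ∈ U i) (hj : t ∈ U j),
        (s i : FieldSections κ (U i)) ⟨t, hi⟩ = (s j : FieldSections κ (U j)) ⟨t, hj⟩ :=
      fun i j t hi hj => congrFun (hs i j) ⟨t, hi, hj⟩
    choose k hk using fun t : (iSup U : Opens T) => Opens.mem_iSup.mp t.2
    refine ⟨fun t => (s (k t) : FieldSections κ (U (k t))) ⟨t.1, hk t⟩, fun i => ?_,
      fun t' ht' => ?_⟩
    · exact funext fun t => hs' _ _ _ _ _
    · exact funext fun t => congrFun (ht' (k t)) ⟨t.1, hk t⟩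
  · refine le_iInf fun t => ?_
    obtain ⟨i, hi⟩ := Opens.mem_iSup.mp t.2
    refine (iInf_le _ i).trans (continuous_iff_le_induced.mp ?_)
    have hres := @continuous_induced_dom _ _ ((fieldPresheaf κ).map (Opens.leSupr U i).op).1
      (inferInstanceAs (TopologicalSpace (FieldSections κ (U i))))
    exact @Continuous.comp _ _ _ (_) _ (_) _ _ (continuous_fieldSections_apply ⟨t.1, hi⟩) hres

/-- The topologically ringed space of a family of fields. -/
def fieldSpace : PresheafedSpace TopCommRingCat.{u} := ⟨T, fieldPresheaf κ⟩

/-- The field `κ t` as a discrete ring. -/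
def fieldRing (t : T) : TopCommRingCat.{u} :=
  let : TopologicalSpace (κ t) := ⊥
  have : DiscreteTopology (κ t) := ⟨rfl⟩
  TopCommRingCat.of (κ t)

instance (t : T) : DiscreteTopology (fieldRing κ t) := ⟨rfl⟩

theorem isAdmissibleRing_fieldRing (t : T) : IsAdmissibleRing (fieldRing κ t) :=
  IsAdmissibleRing.of_discreteTopology _

instance (t : T) : Unique (SpfPoint (fieldRing κ t)) where
  default := ⟨(⊥ : PrimeSpectrum (κ t)), isOpen_discrete _⟩
  uniq _ := Subtype.ext (Subsingleton.elim (α := PrimeSpectrum (κ t)) _ _)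

open Classical in
/-- The map on sections of the inclusion of a point. -/
def fieldChartApp (t : T) (U : Opens T) (V : Opens (Spf.top (fieldRing κ t)))
    (hV : t ∉ U → V = ⊥) : FieldSections κ U →+* Spf.sections V :=
  if h : t ∈ U then
    (Spf.ofRing V).comp (Pi.evalRingHom (fun t : U => κ t.1) ⟨t, h⟩)
  else
    have : Subsingleton (Spf.sections V) :=
      subsingleton_sections (X := Spf.formalScheme _ (isAdmissibleRing_fieldRing κ t)) (hV h)
    { toFun _ := 0
      map_one' := Subsingleton.elim _ _
      map_mul' _ _ := Subsingleton.elim _ _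
      map_zero' := Subsingleton.elim _ _
      map_add' _ _ := Subsingleton.elim _ _ }

theorem fieldChartApp_apply {t : T} {U : Opens T} {V : Opens (Spf.top (fieldRing κ t))}
    (hV : t ∉ U → V = ⊥) (h : t ∈ U) (s : FieldSections κ U) :
    fieldChartApp κ t U V hV s = Spf.ofRing (A := fieldRing κ t) V (s ⟨t, h⟩) := by
  rw [fieldChartApp, dif_pos h]
  rfl

theorem continuous_fieldChartApp {t : T} {U : Opens T} {V : Opens (Spf.top (fieldRing κ t))}
    (hV : t ∉ U → V = ⊥) : Continuous (fieldChartApp κ t U V hV) := by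
  by_cases h : t ∈ U
  · rw [funext (fieldChartApp_apply κ hV h)]
    exact Spf.continuous_ofRing.comp (continuous_fieldSections_apply (κ := κ) ⟨t, h⟩)
  · have : Subsingleton (Spf.sections V) :=
      subsingleton_sections (X := Spf.formalScheme _ (isAdmissibleRing_fieldRing κ t)) (hV h)
    exact continuous_of_const fun _ _ => Subsingleton.elim _ _

/-- The inclusion of a point. -/
def fieldChartMap (t : T) : Spf (fieldRing κ t) ⟶ fieldSpace κ where
  base := TopCat.ofHom ⟨fun _ => t, continuous_const⟩
  c :=
    { app U := ⟨fieldChartApp κ t U.unop _ fun h => eq_bot_iff.mpr fun _ hp => h hp,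
        continuous_fieldChartApp κ _⟩
      naturality U V i := by
        refine Subtype.ext (RingHom.ext fun s => ?_)
        by_cases h : t ∈ V.unop
        · refine (fieldChartApp_apply κ (fun h' => (h' h).elim) h _).trans ?_
          exact (congrArg (Spf.res (A := fieldRing κ t)
            (show (Opens.map (TopCat.ofHom ⟨fun _ => t, continuous_const⟩)).obj V.unop ≤
              (Opens.map (TopCat.ofHom ⟨fun _ => t, continuous_const⟩)).obj U.unop from
              fun _ hp => i.unop.le hp)) (fieldChartApp_apply κ
            (fun h' => (h' (i.unop.le h)).elim) (i.unop.le h) s)).symm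
        · exact (subsingleton_sections
            (X := Spf.formalScheme _ (isAdmissibleRing_fieldRing κ t))
            (eq_bot_iff.mpr fun _ hp => h hp)).elim _ _ }

theorem fieldChartApp_bijective {t : T} {U : Opens T} {V : Opens (Spf.top (fieldRing κ t))}
    (hV : t ∉ U → V = ⊥) (hU : ∀ t' ∈ U, t' = t) (hUV : t ∈ U → V = ⊤) :
    Function.Bijective (fieldChartApp κ t U V hV) := by
  let J : OpenIdeal (fieldRing κ t) := ⟨⊥, isOpen_discrete _⟩
  have hJ : t ∈ U → Spf.openOf V J = ⊤ := fun h => by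
    rw [hUV h]
    rfl
  constructor
  · refine (injective_iff_map_eq_zero _).mpr fun s hs => funext fun ⟨t', h⟩ => ?_
    obtain rfl := hU t' h
    rw [fieldChartApp_apply κ hV h] at hs
    exact (Spf.ofRing_component_eq_zero_iff (hJ h) (s ⟨t', h⟩)).mp (by rw [hs]; rfl)
  · intro σ
    by_cases h : t ∈ U
    · obtain ⟨a, ha⟩ := Spf.exists_ofRing_component_eq (hJ h) σ
      let a' : κ t := a
      refine ⟨fun t' => (hU t'.1 t'.2).symm ▸ a', ?_⟩
      exact (fieldChartApp_apply κ hV h _).trans (Spf.sections_ext_bot ha.symm)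
    · have : Subsingleton (Spf.sections V) :=
        subsingleton_sections (X := Spf.formalScheme _ (isAdmissibleRing_fieldRing κ t)) (hV h)
      exact ⟨0, Subsingleton.elim _ _⟩

theorem isHomeomorph_fieldChartApp {t : T} {U : Opens T} {V : Opens (Spf.top (fieldRing κ t))}
    (hV : t ∉ U → V = ⊥) (hU : ∀ t' ∈ U, t' = t) (hUV : t ∈ U → V = ⊤) :
    IsHomeomorph (fieldChartApp κ t U V hV) := by
  let J : OpenIdeal (fieldRing κ t) := ⟨⊥, isOpen_discrete _⟩
  have hs : Subsingleton (PrimeSpectrum (fieldRing κ t ⧸ J.1)) :=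
    (Spf.ofSpec_injective J).subsingleton
  have hd : DiscreteTopology (Spf.sections V) :=
    Spf.discreteTopology_sections (Set.Subsingleton.isCompact fun p _ q _ => hs.elim p q)
  exact ⟨continuous_fieldChartApp κ hV, fun _ _ => isOpen_discrete _,
    fieldChartApp_bijective κ hV hU hUV⟩

theorem isIso_of_isHomeomorph {R S : TopCommRingCat.{u}} (f : R ⟶ S)
    (hf : IsHomeomorph f.1) : IsIso f := by
  have : IsIso ((forget₂ TopCommRingCat.{u} TopCat.{u}).map f) :=
    (TopCat.isIso_iff_isHomeomorph _).mpr hf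
  exact isIso_of_reflects_iso f (forget₂ TopCommRingCat.{u} TopCat.{u})

theorem isOpenImmersion_fieldChartMap [DiscreteTopology T] (t : T) :
    PresheafedSpace.IsOpenImmersion (fieldChartMap κ t) := by
  have hop : Topology.IsOpenEmbedding (fieldChartMap κ t).base := by
    refine .of_continuous_injective_isOpenMap (ContinuousMap.continuous _)
      (fun p q _ => Subsingleton.elim (α := SpfPoint (fieldRing κ t)) _ _)
      fun _ _ => isOpen_discrete (α := T) _
  refine ⟨hop, fun U => isIso_of_isHomeomorph _ ?_⟩
  refine isHomeomorph_fieldChartApp κ (fun h => eq_bot_iff.mpr fun _ hp => h hp) ?_ ?_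
  · rintro _ ⟨_, _, rfl⟩
    rfl
  · exact fun h => eq_top_iff.mpr fun _ _ => h

/-- The chart given by a point. -/
def fieldChart [DiscreteTopology T] (t : T) : AffineChart (fieldSpace κ) :=
  ⟨fieldRing κ t, isAdmissibleRing_fieldRing κ t, fieldChartMap κ t,
    isOpenImmersion_fieldChartMap κ t⟩

/-- The ordinary scheme given by a family of fields on a discrete space. -/
def fieldScheme [DiscreteTopology T] : FormalScheme.{u} where
  toPresheafedSpace := fieldSpace κ
  isSheaf := isSheaf_fieldPresheaf κ
  exists_chart (t : T) := ⟨fieldChart κ t, (default : SpfPoint (fieldRing κ t)), rfl⟩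

theorem isOrdinary_fieldScheme [DiscreteTopology T] : (fieldScheme κ).IsOrdinary := fun (t : T) =>
  ⟨fieldChart κ t, ⟨(default : SpfPoint (fieldRing κ t)), rfl⟩,
    inferInstanceAs (DiscreteTopology (fieldRing κ t))⟩

end FieldScheme

end FormalScheme

theorem Spf.not_isUnitAt_of_component_eq_zero {A : Type u} [CommRing A] [TopologicalSpace A]
    [IsTopologicalRing A] {U : Opens (Spf.top A)} {s : Spf.sections U} {J : OpenIdeal A}
    (hs : s.1 J = 0) {p : SpfPoint A} (hp : p ∈ U) (h : J.1 ≤ p.1.asIdeal) :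
    ¬ Spf.IsUnitAt s p hp := by
  obtain ⟨q, rfl⟩ := Spf.exists_ofSpec_eq h
  rw [Spf.isUnitAt_iff, hs, map_zero]
  exact not_isUnit_zero

theorem Spf.isCompact_openOf_of_subsingleton {A : Type u} [CommRing A] [TopologicalSpace A]
    [IsTopologicalRing A] {V : Opens (Spf.top A)} (hV : (V : Set (SpfPoint A)).Subsingleton)
    (J : OpenIdeal A) : IsCompact (Spf.openOf V J : Set (PrimeSpectrum.Top (A ⧸ J.1))) :=
  Set.Subsingleton.isCompact fun _ hp _ hq => Spf.ofSpec_injective J (hV hp hq)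

/-! ### Points and sections in a chart -/

namespace AffineChart

variable {X : FormalScheme.{u}} (c : AffineChart X.toPresheafedSpace)

/-- The point of a formal scheme given by a point of a chart. -/
def point (p : SpfPoint c.ring) : X.carrier := c.map.base p

/-- The inverse image of an open subset in a chart. -/
def preimage (U : Opens X.carrier) : Opens (Spf.top c.ring) := (Opens.map c.map.base).obj U

/-- The pullback of sections to a chart. -/
def pull (U : Opens X.carrier) : X.sections U →+* Spf.sections (c.preimage U) :=
  (c.map.c.app (op U)).1

theorem point_injective : Function.Injective c.point := c.isOpenImmersion.base_open.injective

theorem point_mem_range (p : SpfPoint c.ring) : c.point p ∈ c.range := ⟨p, rfl⟩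

theorem continuous_pull (U : Opens X.carrier) : Continuous (c.pull U) := (c.map.c.app (op U)).2

theorem isHomeomorph_pull {U : Opens X.carrier} (hU : U ≤ c.range) : IsHomeomorph (c.pull U) :=
  c.isHomeomorph_app hU

theorem pull_res {U V : Opens X.carrier} (h : V ≤ U) (s : X.sections U) :
    c.pull V (X.res h s) =
      Spf.res (show c.preimage V ≤ c.preimage U from fun _ hx => h hx) (c.pull U s) :=
  FormalScheme.app_res (FormalScheme.chartHom c) h s

theorem isUnit_pull_iff {U : Opens X.carrier} (hU : U ≤ c.range) (s : X.sections U) :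
    IsUnit (c.pull U s) ↔ IsUnit s :=
  MulEquiv.isUnit_map (RingEquiv.ofBijective (c.pull U) (c.isHomeomorph_pull hU).bijective)

end AffineChart

namespace FormalScheme

variable {X Y : FormalScheme.{u}}

theorem exists_point_eq (x : X.carrier) :
    ∃ (c : AffineChart X.toPresheafedSpace) (p : SpfPoint c.ring), c.point p = x :=
  X.exists_chart x

/-- The kernel of a morphism as an ideal sheaf. -/
def kerSheaf (f : Y ⟶ X) : IdealSheaf X where
  ideal U := RingHom.ker (Hom.app f U)
  res_mem {U V} h s hs := by
    rw [RingHom.mem_ker] at hs ⊢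
    rw [app_res, hs, map_zero]
  mem_of_locally U s h := by
    refine eq_of_locally_eq fun y hy => ?_
    obtain ⟨V, hV, hyV, hs⟩ := h (f.hom.base y) hy
    refine ⟨Hom.preimage f V, fun _ hz => hV hz, hyV, ?_⟩
    rw [map_zero]
    exact (app_res f hV s).symm.trans hs

/-! ### Formal schemes with discrete underlying space -/

section Discrete

variable [DiscreteTopology X.carrier] [DiscreteTopology Y.carrier]

/-- A point of a discrete formal scheme as an open subset. -/
def pt (x : X.carrier) : Opens X.carrier := ⟨{x}, isOpen_discrete _⟩

theorem mem_pt (x : X.carrier) : x ∈ pt x := rfl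

theorem eq_of_mem_pt {x y : X.carrier} (h : y ∈ pt x) : y = x := h

theorem pt_le {x : X.carrier} {U : Opens X.carrier} (h : x ∈ U) : pt x ≤ U := by
  rintro _ rfl
  exact h

theorem isBasis_pt : Opens.IsBasis (Set.range (pt (X := X))) :=
  Opens.isBasis_iff_nbhd.mpr fun {_ x} hx => ⟨pt x, ⟨x, rfl⟩, mem_pt x, pt_le hx⟩

theorem isUnit_res_pt_iff (c : AffineChart X.toPresheafedSpace) (p : SpfPoint c.ring)
    {U : Opens X.carrier} (h : c.point p ∈ U) (s : X.sections U) :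
    IsUnit (X.res (pt_le h) s) ↔ Spf.IsUnitAt (c.pull U s) p h := by
  rw [← c.isUnit_pull_iff (pt_le (c.point_mem_range p)), c.pull_res, Spf.isUnit_iff]
  refine ⟨fun hu => hu p (mem_pt _), fun hu q hq => ?_⟩
  obtain rfl := c.point_injective (eq_of_mem_pt hq)
  exact hu

theorem isUnit_pt_iff (c : AffineChart X.toPresheafedSpace) (p : SpfPoint c.ring)
    (s : X.sections (pt (c.point p))) :
    IsUnit s ↔ Spf.IsUnitAt (c.pull _ s) p (mem_pt (c.point p)) := by
  rw [← isUnit_res_pt_iff, res_self]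

instance isLocalRing_sections_pt (x : X.carrier) : IsLocalRing (X.sections (pt x)) := by
  have := nontrivial_sections (mem_pt x)
  refine IsLocalRing.of_isUnit_or_isUnit_one_sub_self fun s => ?_
  obtain ⟨c, p, rfl⟩ := exists_point_eq x
  rw [isUnit_pt_iff c p, isUnit_pt_iff c p, map_sub, map_one]
  exact or_iff_not_imp_left.mpr Spf.isUnitAt_one_sub

theorem subsingleton_preimage_pt (c : AffineChart X.toPresheafedSpace) (x : X.carrier) :
    (c.preimage (pt x) : Set (SpfPoint c.ring)).Subsingleton :=
  fun _ hp _ hq => c.point_injective ((eq_of_mem_pt hp).trans (eq_of_mem_pt hq).symm)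

theorem isOpen_pull_component_eq_zero (c : AffineChart X.toPresheafedSpace) (x : X.carrier)
    (J : OpenIdeal c.ring) : IsOpen {s : X.sections (pt x) | (c.pull (pt x) s).1 J = 0} :=
  (Spf.isOpen_component_eq_zero J (Spf.isCompact_openOf_of_subsingleton
    (subsingleton_preimage_pt c x) J)).preimage (c.continuous_pull (pt x))

theorem isOpen_maximalIdeal_pt (x : X.carrier) :
    IsOpen (IsLocalRing.maximalIdeal (X.sections (pt x)) : Set (X.sections (pt x))) := by
  obtain ⟨c, p, rfl⟩ := exists_point_eq x
  refine AddSubgroup.isOpen_of_mem_nhds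
    (IsLocalRing.maximalIdeal (X.sections (pt (c.point p)))).toAddSubgroup
    (g := 0) (Filter.mem_of_superset ((isOpen_pull_component_eq_zero c (c.point p)
      ⟨p.1.asIdeal, p.2⟩).mem_nhds ?_) fun s hs => ?_)
  · change (c.pull _ 0).1 _ = 0
    rw [map_zero]
    rfl
  · refine (IsLocalRing.mem_maximalIdeal s).mpr fun hu => ?_
    exact Spf.not_isUnitAt_of_component_eq_zero hs (mem_pt (c.point p)) le_rfl
      ((isUnit_pt_iff c p s).mp hu)

/-! ### The residue fields of a discrete formal scheme -/

variable (Y) in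
/-- The residue field of a point. -/
abbrev residueField (y : Y.carrier) : Type u := IsLocalRing.ResidueField (Y.sections (pt y))

/-- The value of a section in the residue field of a point. -/
def residue {U : Opens Y.carrier} {y : Y.carrier} (hy : y ∈ U) :
    Y.sections U →+* residueField Y y :=
  (IsLocalRing.residue (Y.sections (pt y))).comp (Y.res (pt_le hy))

theorem residue_res {U V : Opens Y.carrier} (h : V ≤ U) {y : Y.carrier} (hy : y ∈ V)
    (s : Y.sections U) : residue hy (Y.res h s) = residue (h hy) s :=
  congrArg (IsLocalRing.residue (Y.sections (pt y))) (res_res h (pt_le hy) s)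

theorem residue_eq_zero_iff {U : Opens Y.carrier} {y : Y.carrier} (hy : y ∈ U) (s : Y.sections U) :
    residue hy s = 0 ↔ ¬ IsUnit (Y.res (pt_le hy) s) :=
  (IsLocalRing.residue_eq_zero_iff _).trans (IsLocalRing.mem_maximalIdeal _)

theorem continuous_residue {U : Opens Y.carrier} {y : Y.carrier} (hy : y ∈ U) :
    @Continuous _ _ _ ⊥ (residue (Y := Y) hy) := by
  let : TopologicalSpace (residueField Y y) := ⊥
  refine Continuous.comp (g := IsLocalRing.residue (Y.sections (pt y))) ?_
    (Y.presheaf.map (homOfLE (pt_le hy)).op).2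
  exact continuous_of_isOpen_of_sub_mem (isOpen_maximalIdeal_pt y) fun _ _ =>
    Ideal.Quotient.eq.mpr

variable (Y) in
/-- The family of residue fields of a discrete formal scheme as an ordinary scheme. -/
abbrev residueScheme : FormalScheme.{u} := fieldScheme (T := Y.carrier) (residueField Y)

/-- The map from the sections to the products of the residue fields. -/
def residueApp (U : Opens Y.carrier) : Y.sections U →+* FieldSections (residueField Y) U :=
  RingHom.pi fun y : U => residue y.2

theorem residueApp_eq_zero_iff {U : Opens Y.carrier} (s : Y.sections U) :
    residueApp U s = 0 ↔ ∀ (y : Y.carrier) (hy : y ∈ U), ¬ IsUnit (Y.res (pt_le hy) s) := by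
  refine funext_iff.trans ⟨fun h y hy => ?_, fun h y => ?_⟩
  · exact (residue_eq_zero_iff hy s).mp (h ⟨y, hy⟩)
  · exact (residue_eq_zero_iff y.2 s).mpr (h y.1 y.2)

theorem residueApp_pt_surjective (y : Y.carrier) : Function.Surjective (residueApp (pt y)) := by
  intro t
  obtain ⟨s, hs⟩ := IsLocalRing.residue_surjective (t ⟨y, mem_pt y⟩)
  refine ⟨s, funext fun ⟨z, hz⟩ => ?_⟩
  obtain rfl := eq_of_mem_pt hz
  exact (congrArg _ (res_self _ s)).trans hs

variable (Y) in
/-- The inclusion of the residue fields. -/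
def residueHom : residueScheme Y ⟶ Y where
  hom :=
    { base := 𝟙 Y.carrier
      c :=
        { app U := ⟨residueApp U.unop, continuous_fieldSections_iff.mpr fun y =>
            continuous_residue y.2⟩
          naturality U V i := Subtype.ext (RingHom.ext fun s => funext fun y =>
            residue_res i.unop.le y.2 s) } }
  isLocalHom y := by
    refine isLocalHom_stalkMap_forgetTopology_of_isUnit_res _ y fun U s V hV hy hu =>
      ⟨pt y, pt_le (hV hy), mem_pt _, ?_⟩
    by_contra hs
    have hzero := (residue_eq_zero_iff (Y := Y) (U := U) (y := y) (hV hy) s).mpr hs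
    have hunit := hu.map (Pi.evalRingHom (fun y : V => residueField Y y.1) ⟨y, hy⟩)
    exact hunit.ne_zero hzero

variable (Y) in
-- `I` is the nilradical of the chart: a section vanishes at every point iff it vanishes modulo `I`.
theorem isClosed_kerSheaf_residueHom : (kerSheaf (residueHom Y)).IsClosed := fun x => by
  obtain ⟨c, p, rfl⟩ := exists_point_eq x
  let I : Ideal c.ring := ⨅ p : SpfPoint c.ring, p.1.asIdeal
  obtain ⟨J, hJ⟩ := c.isAdmissible.exists_idealOfDefinition
  have hI : IsOpen (I : Set c.ring) := isOpen_ideal_of_le (le_iInf hJ.le) hJ.isOpen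
  have : IsReduced (c.ring ⧸ I) := by
    refine (Ideal.isRadical_iff_quotient_reduced I).mp fun a ⟨n, ha⟩ => ?_
    exact Ideal.mem_iInf.mpr fun p => p.1.isPrime.mem_of_pow_mem n (Ideal.mem_iInf.mp ha p)
  refine ⟨c, c.point_mem_range p, I, ?_, fun U hU s => ?_⟩
  · exact AddSubgroup.isClosed_of_isOpen I.toAddSubgroup hI
  refine (residueApp_eq_zero_iff s).trans ⟨fun h K hK => ?_, fun h y hy => ?_⟩
  · refine Spf.component_eq_zero (J := ⟨I, hI⟩) (s := c.pull U s) hK ?_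
    refine SpecSections.eq_zero_of_forall_not_isUnit_value fun q hq hu => ?_
    exact h _ hq ((isUnit_res_pt_iff c (Spf.ofSpec ⟨I, hI⟩ q) hq s).mpr
      ((Spf.isUnitAt_iff _ q hq).mpr hu))
  · obtain ⟨p, rfl⟩ := hU hy
    exact fun hu => Spf.not_isUnitAt_of_component_eq_zero (J := ⟨p.1.asIdeal, p.2⟩)
      (h _ (iInf_le _ p)) hy le_rfl ((isUnit_res_pt_iff c p hy s).mp hu)

variable (Y) in
theorem support_kerSheaf_residueHom : (kerSheaf (residueHom Y)).support = Set.univ :=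
  Set.eq_univ_of_forall fun y U hy h =>
    (residueApp_eq_zero_iff (1 : Y.sections U)).mp h y hy (by rw [map_one]; exact isUnit_one)

theorem discreteTopology_fieldSections_pt (κ : Y.carrier → Type u) (y : Y.carrier) :
    DiscreteTopology (FieldSections (T := Y.carrier) κ (pt y)) := by
  refine discreteTopology_iff_isOpen_singleton.mpr fun t => ?_
  have hopen := @IsOpen.preimage _ _ _ ⊥ _
    (continuous_fieldSections_apply (κ := κ) (U := pt y) ⟨y, mem_pt y⟩) {t ⟨y, mem_pt y⟩} trivial
  refine (congrArg IsOpen (Set.ext fun t' => ⟨fun h => ?_, fun h => congrFun h _⟩)).mp hopen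
  refine funext fun ⟨z, hz⟩ => ?_
  obtain rfl := eq_of_mem_pt hz
  exact h

variable (Y) in
theorem isClosedImmersion_residueHom : IsClosedImmersion (residueHom Y) := by
  refine ⟨kerSheaf (residueHom Y), isClosed_kerSheaf_residueHom Y, Topology.IsEmbedding.id,
    Set.range_id.trans (support_kerSheaf_residueHom Y).symm, fun U => rfl, _, isBasis_pt, ?_⟩
  rintro _ ⟨y, rfl⟩
  have := discreteTopology_fieldSections_pt (residueField Y) y
  exact ⟨residueApp_pt_surjective y, ((residueHom Y).hom.c.app (op (pt y))).2, fun S _ =>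
    isOpen_discrete (α := FieldSections (residueField Y) (pt y)) _⟩

end Discrete

theorem IsPseudoImmersion.injective [DiscreteTopology Y.carrier] {f : Y ⟶ X}
    (hf : IsPseudoImmersion f) : Function.Injective f.hom.base :=
  (hf _ _ (isOrdinary_fieldScheme _) (isClosedImmersion_residueHom Y).isImmersion)
    |>.isEmbedding.injective

end FormalScheme

/-! ### Ideal sheaves of morphisms to a discrete formal scheme -/

theorem IsAdmissibleRing.exists_openIdeal_basis {A : Type u} [CommRing A] [TopologicalSpace A]
    [IsTopologicalRing A] (hA : IsAdmissibleRing A) :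
    ∃ J : ℕ → OpenIdeal A, Antitone (fun n => (J n).1) ∧
      (nhds (0 : A)).HasBasis (fun _ => True) (fun n => ((J n).1 : Set A)) := by
  obtain ⟨I, hI, hb⟩ := hA.exists_basis
  exact ⟨fun n => ⟨I n, AddSubgroup.isOpen_of_mem_nhds (Submodule.toAddSubgroup (I n))
    (hb.mem_of_mem trivial)⟩, hI, hb⟩

namespace Spf

variable {A : Type u} [CommRing A] [TopologicalSpace A] [IsTopologicalRing A]

theorem ofRing_surjective (hA : IsAdmissibleRing A) {U : Opens (top A)}
    (hU : ∀ J : OpenIdeal A, openOf U J = ⊤) : Function.Surjective (ofRing U) := fun s => by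
  obtain ⟨I, hI, hb⟩ := hA.exists_openIdeal_basis
  choose a ha using fun n => exists_ofRing_component_eq (hU (I n)) s
  have hsub : ∀ (J : OpenIdeal A) (b c : A), b - c ∈ J.1 ↔ (ofRing U b).1 J = (ofRing U c).1 J :=
    fun J b c => by
      rw [← ofRing_component_eq_zero_iff (hU J), map_sub]
      exact sub_eq_zero
  obtain ⟨x, hx⟩ := exists_forall_sub_mem_of_completeSpace hA.complete hI hb a fun n =>
    (hsub (I n) _ _).mpr ((component_eq (hI (Nat.le_succ n)) (ha (n + 1))).symm.trans (ha n))
  refine ⟨x, sections_ext fun J => ?_⟩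
  obtain ⟨n, -, hn⟩ := hb.mem_iff.mp (J.2.mem_nhds J.1.zero_mem)
  exact component_eq hn (((hsub (I n) _ _).mp (hx n)).trans (ha n).symm)

end Spf

theorem mem_of_isClosed_of_forall_openIdeal {A : Type u} [CommRing A] [TopologicalSpace A]
    [IsTopologicalRing A] (hA : IsAdmissibleRing A) {I : Ideal A} (hI : IsClosed (I : Set A))
    {a : A} (h : ∀ K : OpenIdeal A, I ≤ K.1 → a ∈ K.1) : a ∈ I := by
  obtain ⟨𝔞, -, hb⟩ := hA.exists_openIdeal_basis
  refine (hI.closure_eq ▸ mem_closure_iff_nhds_zero.mpr fun N hN => ?_ : a ∈ (I : Set A))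
  obtain ⟨n, -, hn⟩ := hb.mem_iff.mp hN
  obtain ⟨i, hi, b, hb, hab⟩ := Submodule.mem_sup.mp
    (h ⟨I ⊔ (𝔞 n).1, isOpen_ideal_of_le le_sup_right (𝔞 n).2⟩ le_sup_left)
  refine ⟨i, hi, hn ?_⟩
  rw [← hab]
  simpa using neg_mem hb

namespace AffineChart

variable {X : FormalScheme.{u}} (c : AffineChart X.toPresheafedSpace)

theorem openOf_preimage_range (J : OpenIdeal c.ring) :
    Spf.openOf (c.preimage c.range) J = ⊤ :=
  eq_top_iff.mpr fun q _ => c.point_mem_range (Spf.ofSpec J q)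

/-- The map from the ring of a chart to the sections over the chart. -/
def ofRing : c.ring →+* X.sections c.range :=
  (RingEquiv.ofBijective (c.pull c.range)
    (c.isHomeomorph_pull le_rfl).bijective).symm.toRingHom.comp (Spf.ofRing (c.preimage c.range))

theorem pull_ofRing (a : c.ring) :
    c.pull c.range (c.ofRing a) = Spf.ofRing (c.preimage c.range) a :=
  (RingEquiv.ofBijective (c.pull c.range)
    (c.isHomeomorph_pull le_rfl).bijective).apply_symm_apply _

theorem ofRing_surjective : Function.Surjective c.ofRing :=
  (RingEquiv.ofBijective (c.pull c.range)
    (c.isHomeomorph_pull le_rfl).bijective).symm.surjective.comp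
      (Spf.ofRing_surjective c.isAdmissible c.openOf_preimage_range)

theorem continuous_ofRing : Continuous c.ofRing := by
  refine (c.isHomeomorph_pull le_rfl).isEmbedding.continuous_iff.mpr ?_
  exact (Spf.continuous_ofRing (U := c.preimage c.range)).congr fun a => (c.pull_ofRing a).symm

theorem value_eq_zero_of_pull_res_eq_zero {U V : Opens X.carrier} (h : V ≤ U)
    {t : X.sections U} {K : OpenIdeal c.ring} {q : PrimeSpectrum.Top (c.ring ⧸ K.1)}
    (hq : q ∈ Spf.openOf (c.preimage V) K) (ht : (c.pull V (X.res h t)).1 K = 0) :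
    SpecSections.value q (h hq) ((c.pull U t).1 K) = 0 := by
  rw [c.pull_res] at ht
  have hvalue := SpecSections.value_res (Spf.openOf_mono (show c.preimage V ≤ c.preimage U
    from fun _ hx => h hx) K) q hq ((c.pull U t).1 K)
  exact hvalue.symm.trans ((congrArg _ ht).trans (map_zero _))

end AffineChart

namespace FormalScheme

variable {X Y : FormalScheme.{u}}

theorem continuous_res {U V : Opens X.carrier} (h : V ≤ U) : Continuous (X.res h) :=
  (X.presheaf.map (homOfLE h).op).2

theorem Hom.continuous_app (f : Y ⟶ X) (U : Opens X.carrier) : Continuous (Hom.app f U) :=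
  (f.hom.c.app (op U)).2

theorem isClosed_singleton_zero [DiscreteTopology X.carrier] (V : Opens X.carrier) :
    IsClosed ({0} : Set (X.sections V)) := by
  choose c p hp using exists_point_eq (X := X)
  have hzero : ({0} : Set (X.sections V)) = ⋂ (x : V) (J : OpenIdeal (c x.1).ring),
      {s | ((c x.1).pull (pt x.1) (X.res (pt_le x.2) s)).1 J = 0} := by
    refine Set.ext fun s => ⟨?_, fun hs => eq_of_locally_eq fun x hx =>
      ⟨pt x, pt_le hx, mem_pt x, ?_⟩⟩
    · rintro rfl
      refine Set.mem_iInter₂.mpr fun x J => ?_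
      change Spf.component _ J _ = 0
      rw [map_zero, map_zero, map_zero]
    · refine ((c x).isHomeomorph_pull ?_).injective (Spf.sections_ext fun J => ?_)
      · exact pt_le ⟨p x, hp x⟩
      · refine (Set.mem_iInter₂.mp hs ⟨x, hx⟩ J).trans ?_
        change _ = Spf.component _ J _
        rw [map_zero, map_zero, map_zero]
  rw [hzero]
  refine isClosed_iInter fun x => isClosed_iInter fun J => ?_
  refine IsClosed.preimage (continuous_res (pt_le x.2))
    (t := {s | ((c x.1).pull (pt x.1) s).1 J = 0}) ?_
  exact AddSubgroup.isClosed_of_isOpen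
    (((Spf.component _ J).comp ((c x.1).pull (pt x.1))).toAddMonoidHom.ker)
    (isOpen_pull_component_eq_zero (c x.1) x.1 J)

/-- The section `t` over `U` restricts to the section `s` over `V` and vanishes off `V`. -/
def IsExtensionByZero {U V : Opens X.carrier} (h : V ≤ U) (s : X.sections V) (t : X.sections U) :
    Prop :=
  X.res h t = s ∧ ∀ (W : Opens X.carrier) (hW : W ≤ U), W ⊓ V = ⊥ → X.res hW t = 0

variable [DiscreteTopology X.carrier] {U V : Opens X.carrier} {h : V ≤ U} {s : X.sections V}

theorem exists_isExtensionByZero (h : V ≤ U) (s : X.sections V) :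
    ∃ t : X.sections U, IsExtensionByZero h s t := by
  let V' : Opens X.carrier := ⟨(U : Set X.carrier) \ V, isOpen_discrete _⟩
  have hV' : V' ≤ U := fun _ hx => hx.1
  obtain ⟨t, hts, ht0⟩ := exists_gluing_of_disjoint h hV'
    (fun x hx => (em (x ∈ V)).imp id fun h => ⟨hx, h⟩)
    (eq_bot_iff.mpr fun x hx => hx.2.2 hx.1) s 0
  refine ⟨t, hts, fun W hW hWV => ?_⟩
  have hWV' : W ≤ V' := fun x hx => ⟨hW hx, fun hxV => (hWV.le ⟨hx, hxV⟩ : x ∈ (⊥ : Opens _))⟩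
  rw [← res_res hV' hWV', ht0, map_zero]

theorem res_surjective (h : V ≤ U) : Function.Surjective (X.res h) :=
  fun s => (exists_isExtensionByZero h s).imp fun _ ht => ht.1

theorem IsExtensionByZero.res_pt_eq_zero {t : X.sections U} (ht : IsExtensionByZero h s t)
    {x : X.carrier} (hxU : x ∈ U) (hxV : x ∉ V) : X.res (pt_le hxU) t = 0 :=
  ht.2 _ _ (eq_bot_iff.mpr fun _ hz => hxV (eq_of_mem_pt hz.1 ▸ hz.2))

theorem IsExtensionByZero.app_eq_zero_iff {t : X.sections U} (ht : IsExtensionByZero h s t)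
    (f : Y ⟶ X) : Hom.app f U t = 0 ↔ Hom.app f V s = 0 := by
  refine ⟨fun ht0 => ?_, fun hs => eq_of_locally_eq fun y hy => ?_⟩
  · rw [← ht.1, app_res, ht0, map_zero]
  by_cases hyV : f.hom.base y ∈ V
  · refine ⟨Hom.preimage f V, fun _ hz => h hz, hyV, ?_⟩
    rw [map_zero]
    refine (app_res f h t).symm.trans ?_
    rw [ht.1, hs]
  · have hle : pt (f.hom.base y) ≤ U := pt_le hy
    refine ⟨Hom.preimage f (pt (f.hom.base y)), fun _ hz => hle hz, rfl, ?_⟩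
    rw [map_zero]
    refine (app_res f hle t).symm.trans ?_
    rw [ht.res_pt_eq_zero hy hyV, map_zero]

theorem IsExtensionByZero.mem_iff (c : AffineChart X.toPresheafedSpace) {h : V ≤ c.range}
    {a : c.ring} (ha : IsExtensionByZero h s (c.ofRing a)) {I : Ideal c.ring}
    (hI : IsClosed (I : Set c.ring)) : a ∈ I ↔ c.pull V s ∈ triangle I (c.preimage V) := by
  refine ⟨fun haI K hK => ?_, fun hs => ?_⟩
  · rw [← ha.1, c.pull_res, c.pull_ofRing]
    have hzero := (Spf.ofRing_component_eq_zero_iff (c.openOf_preimage_range K) a).mpr (hK haI)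
    exact (congrArg _ hzero).trans (map_zero _)
  · refine mem_of_isClosed_of_forall_openIdeal c.isAdmissible hI fun K hK => ?_
    refine (Spf.ofRing_component_eq_zero_iff (c.openOf_preimage_range K) a).mp ?_
    rw [← c.pull_ofRing]
    refine SpecSections.ext_value fun q hq => ?_
    rw [map_zero]
    by_cases hqV : c.point (Spf.ofSpec K q) ∈ V
    · exact c.value_eq_zero_of_pull_res_eq_zero h hqV (by rw [ha.1]; exact hs K hK)
    · refine c.value_eq_zero_of_pull_res_eq_zero (pt_le hq) (mem_pt _) ?_
      rw [ha.res_pt_eq_zero hq hqV, map_zero]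
      rfl

theorem isClosed_kerSheaf [DiscreteTopology Y.carrier] (f : Y ⟶ X) :
    (kerSheaf f).IsClosed := fun x => by
  obtain ⟨c, p, rfl⟩ := exists_point_eq x
  let I : Ideal c.ring := RingHom.ker ((Hom.app f c.range).comp c.ofRing)
  have hI : IsClosed (I : Set c.ring) :=
    (isClosed_singleton_zero _).preimage ((Hom.continuous_app f _).comp c.continuous_ofRing)
  refine ⟨c, c.point_mem_range p, I, hI, fun U hU s => ?_⟩
  obtain ⟨t, ht⟩ := exists_isExtensionByZero hU s
  obtain ⟨a, rfl⟩ := c.ofRing_surjective t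
  exact (ht.app_eq_zero_iff f).symm.trans (ht.mem_iff c hI)

end FormalScheme

/-! ### Pseudo-immersions into a discrete formal scheme -/

namespace FormalScheme

variable {X Y : FormalScheme.{u}} [DiscreteTopology X.carrier]

theorem isArtinianRing_quotient (c : AffineChart X.toPresheafedSpace) [IsNoetherianRing c.ring]
    (J : OpenIdeal c.ring) : IsArtinianRing (c.ring ⧸ J.1) := by
  have hspf : DiscreteTopology (SpfPoint c.ring) :=
    @Topology.IsEmbedding.discreteTopology _ X.carrier _ _ _ ‹_›
      c.isOpenImmersion.base_open.isEmbedding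
  have hspec : DiscreteTopology (PrimeSpectrum (c.ring ⧸ J.1)) :=
    (Spf.isEmbedding_ofSpec J).discreteTopology
  exact isArtinianRing_iff_krullDimLE_zero.mpr
    (PrimeSpectrum.discreteTopology_iff_finite_and_krullDimLE_zero.mp hspec).2

-- The image of `f` on sections is dense: restrict `f` to the ordinary subscheme of `Y` given by
-- an open ideal contained in `J` and in the prime `q`, on which `f` is an immersion.
theorem IsPseudoImmersion.exists_app_component_eq {f : Y ⟶ X} (hf : IsPseudoImmersion f)
    (d : AffineChart Y.toPresheafedSpace) (q : SpfPoint d.ring) {x : X.carrier}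
    (hx : f.hom.base (d.point q) = x)
    (t : Spf.sections (d.preimage (Hom.preimage f (pt x)))) (J : OpenIdeal d.ring) :
    ∃ r : X.sections (pt x), (d.pull (Hom.preimage f (pt x)) (Hom.app f (pt x) r)).1 J = t.1 J := by
  let K : OpenIdeal d.ring := J.inf ⟨q.1.asIdeal, q.2⟩
  have := discreteTopology_quotientRing K
  have hker : RingHom.ker (quotientHom K).1 = K.1 := Ideal.mk_ker
  have hsurj : Function.Surjective (quotientHom K).1 := Ideal.Quotient.mk_surjective
  obtain ⟨z, hz⟩ : q ∈ Set.range (Spf.mapPoint (quotientHom K).2) :=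
    (Set.ext_iff.mp (Spf.range_mapPoint (quotientHom K).2 hsurj) q).mpr
      (hker.le.trans inf_le_right)
  have hzx : (quotientImmersion d K ≫ f).hom.base z = x :=
    (congrArg (fun q => f.hom.base (d.point q)) hz).trans hx
  obtain ⟨U, hU, hzU, hquot⟩ :=
    (hf.isImmersion_quotientImmersion_comp d K).exists_isOpenQuotientMap z (pt x) hzx
  obtain rfl : U = pt x := le_antisymm hU (pt_le (hzx ▸ hzU))
  obtain ⟨r, hr⟩ := hquot.surjective (Spf.pullback (quotientHom K).2 _ t)
  have hzero : Spf.pullback (quotientHom K).2 _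
      (d.pull (Hom.preimage f (pt x)) (Hom.app f (pt x) r) - t) = 0 := by
    rw [map_sub, sub_eq_zero]
    exact hr
  exact ⟨r, Spf.component_eq (J := K) inf_le_left (sub_eq_zero.mp
    ((Spf.pullback_eq_zero_iff (quotientHom K).2 hsurj _).mp hzero K hker.le))⟩

theorem IsPseudoImmersion.isOpenQuotientMap_pull_comp {f : Y ⟶ X} (hf : IsPseudoImmersion f)
    (c : AffineChart X.toPresheafedSpace) [IsNoetherianRing c.ring] {I : Ideal c.ring}
    (hI : IsAdic I) (d : AffineChart Y.toPresheafedSpace) (q : SpfPoint d.ring) {x : X.carrier}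
    (hx : f.hom.base (d.point q) = x)
    (hV : (d.preimage (Hom.preimage f (pt x)) : Set (SpfPoint d.ring)).Subsingleton)
    {γ : c.ring →+* X.sections (pt x)} (hγ : Continuous γ) (hγs : Function.Surjective γ) :
    IsOpenQuotientMap ((d.pull (Hom.preimage f (pt x))).comp ((Hom.app f (pt x)).comp γ)) := by
  have hanti : Antitone fun n => I ^ n := fun m n h => Ideal.pow_le_pow_right h
  obtain ⟨J, hJ, hJb⟩ := d.isAdmissible.exists_openIdeal_basis
  refine isOpenQuotientMap_of_isCompleteChain hanti hI.hasBasis_nhds_zero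
    (𝔫 := fun n => RingHom.ker (Spf.component _ (J n)))
    (fun k => isArtinianRing_quotient c ⟨I ^ k, (isAdic_iff.mp hI).1 k⟩)
    (exists_forall_sub_mem_of_completeSpace c.isAdmissible.complete hanti hI.hasBasis_nhds_zero)
    (fun m n h s hs => Spf.component_eq_zero (hJ h) hs)
    (eq_bot_iff.mpr fun t ht => Spf.sections_ext fun K => ?_)
    (fun n => Spf.isOpen_component_eq_zero _ (Spf.isCompact_openOf_of_subsingleton hV _))
    ((d.continuous_pull _).comp ((Hom.continuous_app f _).comp hγ)) fun t n => ?_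
  · obtain ⟨n, -, hn⟩ := hJb.mem_iff.mp (K.2.mem_nhds K.1.zero_mem)
    exact Spf.component_eq_zero hn (Ideal.mem_iInf.mp ht n)
  · obtain ⟨r, hr⟩ := hf.exists_app_component_eq d q hx t (J n)
    obtain ⟨a, rfl⟩ := hγs r
    refine ⟨a, ?_⟩
    rw [RingHom.mem_ker, map_sub, sub_eq_zero]
    exact hr.symm

theorem isOpenQuotientMap_app_of_notMem_range (f : Y ⟶ X) {x : X.carrier}
    (hx : x ∉ Set.range f.hom.base) : IsOpenQuotientMap (Hom.app f (pt x)) := by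
  have : Subsingleton (Y.sections (Hom.preimage f (pt x))) :=
    subsingleton_sections (eq_bot_iff.mpr fun y hy => hx ⟨y, hy⟩)
  exact ⟨fun t => ⟨0, Subsingleton.elim _ t⟩, Hom.continuous_app f _, fun _ _ => isOpen_discrete _⟩

theorem IsPseudoImmersion.isOpenQuotientMap_app (hX : X.IsNoetherian) {f : Y ⟶ X}
    (hf : IsPseudoImmersion f) (x : X.carrier) : IsOpenQuotientMap (Hom.app f (pt x)) := by
  by_cases hx : x ∈ Set.range f.hom.base
  swap
  · exact isOpenQuotientMap_app_of_notMem_range f hx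
  have := hf.discreteTopology
  obtain ⟨y, hy⟩ := hx
  obtain ⟨d, q, rfl⟩ := exists_point_eq y
  obtain ⟨c, hxc, hnoeth, I, hI⟩ := hX.exists_chart x
  have hfiber : ∀ z ∈ Hom.preimage f (pt x), z = d.point q :=
    fun z hz => hf.injective (Eq.trans hz hy.symm)
  have hpull := d.isHomeomorph_pull (U := Hom.preimage f (pt x))
    fun z hz => hfiber z hz ▸ d.point_mem_range q
  let γ : c.ring →+* X.sections (pt x) := (X.res (pt_le hxc)).comp c.ofRing
  have hγ : Continuous γ := (continuous_res _).comp c.continuous_ofRing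
  have hγs : Function.Surjective γ := (res_surjective _).comp c.ofRing_surjective
  have hβ := hf.isOpenQuotientMap_pull_comp c hI d q hy
    (fun a ha b hb => d.point_injective ((hfiber _ ha).trans (hfiber _ hb).symm)) hγ hγs
  have happγ : IsOpenQuotientMap (Hom.app f (pt x) ∘ γ) := by
    refine (congrArg IsOpenQuotientMap (funext fun a => ?_)).mp
      ((hpull.homeomorph _).symm.isOpenQuotientMap.comp hβ)
    exact (hpull.homeomorph _).symm_apply_apply _
  exact happγ.of_comp hγ hγs (Hom.continuous_app f _)

theorem IsPseudoImmersion.isClosedImmersion (hX : X.IsNoetherian) {f : Y ⟶ X}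
    (hf : IsPseudoImmersion f) : IsClosedImmersion f := by
  have hY := hf.discreteTopology
  refine ⟨kerSheaf f, isClosed_kerSheaf f, ?_, Set.ext fun x => ⟨?_, fun hx => ?_⟩, fun U => rfl,
    _, isBasis_pt, ?_⟩
  · exact (Topology.IsOpenEmbedding.of_continuous_injective_isOpenMap (ContinuousMap.continuous _)
      hf.injective fun _ _ => isOpen_discrete _).isEmbedding
  · rintro ⟨y, rfl⟩ U hy h
    have := nontrivial_sections (U := Hom.preimage f U) hy
    exact one_ne_zero ((map_one (Hom.app f U)).symm.trans h)
  · by_contra hxf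
    have : Subsingleton (Y.sections (Hom.preimage f (pt x))) :=
      subsingleton_sections (eq_bot_iff.mpr fun y hy => hxf ⟨y, hy⟩)
    exact hx (pt x) (mem_pt x) (Subsingleton.elim _ _)
  · rintro _ ⟨x, rfl⟩
    exact hf.isOpenQuotientMap_app hX x

end FormalScheme

end

theorem mainTheorem2 (X : FormalScheme.{u}) (hX : X.IsNoetherian) :
    (∀ (Y : FormalScheme.{u}) (f : Y ⟶ X),
        FormalScheme.IsPseudoImmersion f → FormalScheme.IsImmersion f) ↔
      DiscreteTopology X.carrier :=
  ⟨FormalScheme.discreteTopology_of_isImmersion hX,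
    fun _ _ _ hf => (hf.isClosedImmersion hX).isImmersion⟩
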